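/- Let $k$ be a field of characteristic $3$, let $V$ be a two-dimensional vector space over $k$ with a nonzero alternating bilinear form $\langle\cdot|\cdot\rangle$, and let $C$ be a Hurwitz algebra over $k$ (a nonzero unital algebra with a regular multiplicative quadratic form $q$), with polar form $\mathrm b$ and standard involution $\bar x=\mathrm b(x,1)1-x$. Let $S=\bar C$ be the associated para-Hurwitz algebra, i.e. $C$ with the product $x\bullet y=\bar x\bar y$ and the form $\mathrm b$. Let $S_{1,2}$ be the para-Hurwitz superalgebra of $B(1,2)=k1\oplus V$ (even part $k1$, odd part $V$, unit $1$, $uv=\langle u|v\rangle 1$, $\mathrm b(1,1)=2$, $\mathrm b(u,v)=\langle u|v\rangle$ for $u,v\in V$). For a symmetric composition superalgebra $R$ (such as $S$, with zero odd part, and $S_{1,2}$), with product $\bullet$ and form $\mathrm b$, let $\mathfrak{tri}(R)$ be its triality Lie superalgebra: its part of parity $i$ consists of the triples $(d_0,d_1,d_2)$ of linear maps of parity $i$ with $\mathrm b(d_n(x),y)+(-1)^{i|x|}\mathrm b(x,d_n(y))=0$ and $d_0(x\bullet y)=d_1(x)\bullet y+(-1)^{i|x|}x\bullet d_2(y)$.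 Put $\theta(d_0,d_1,d_2)=(d_2,d_0,d_1)$ and $t_{x,y}=(\sigma_{x,y},\tfrac12\mathrm b(x,y)1-r_xl_y,\tfrac12\mathrm b(x,y)1-l_xr_y)$, where $\sigma_{x,y}(z)=(-1)^{|y||z|}\mathrm b(x,z)y-(-1)^{|x|(|y|+|z|)}\mathrm b(y,z)x$, $l_x(y)=x\bullet y$ and $r_x(y)=(-1)^{|x||y|}y\bullet x$. For symmetric composition superalgebras $R,R'$, let $\mathfrak g(R,R')=\mathfrak{tri}(R)\oplus\mathfrak{tri}(R')\oplus\bigoplus_{i=0}^2\iota_i(R\otimes R')$, with the super-anticommutative bracket for which $\mathfrak{tri}(R)\oplus\mathfrak{tri}(R')$ is a subsuperalgebra (a direct sum of ideals) and, for homogeneous elements and indices modulo $3$, $$[(d_0,d_1,d_2),\iota_i(x\otimes x')]=\iota_i(d_i(x)\otimes x'),\qquad [(d'_0,d'_1,d'_2),\iota_i(x\otimes x')]=(-1)^{|d_i'||x|}\iota_i(x\otimes d'_i(x')),$$ $$[\iota_i(x\otimes x'),\iota_{i+1}(y\otimes y')]=(-1)^{|x'||y|}\iota_{i+2}((x\bullet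 y)\otimes(x'\bullet y')),$$ $$[\iota_i(x\otimes x'),\iota_i(y\otimes y')]=(-1)^{|x||x'|+|x||y'|+|y||y'|}\mathrm b'(x',y')\theta^i(t_{x,y})+(-1)^{|y||x'|}\mathrm b(x,y)\theta'^i(t'_{x',y'}).$$ Here $(d_0,d_1,d_2)\in\mathfrak{tri}(R)$, $(d'_0,d'_1,d'_2)\in\mathfrak{tri}(R')$, $x,y\in R$, $x',y'\in R'$, and primes denote the objects of $R'$. Let $J=H_3(C,*)$ be the algebra of hermitian $3\times3$ matrices over $C$ with $x\circ y=\tfrac12(xy+yx)$ and $L_x(y)=x\circ y$. Number rows and columns $0,1,2$; let $e_i$ be the diagonal matrix units, and for $a\in C$ let $\iota_i(a)\in J$ be the matrix with entry $2a$ in position $(i+2,i+1)$, entry $2\bar a$ in position $(i+1,i+2)$ (indices modulo $3$), and zeros elsewhere. Let $t$ be the trace, $J_0=\ker t$, and $T=T_J^o=J_0/k1$ (note $t(1)=3=0$), with $(\hat x|\hat y)=t(x\circ y)$ and $[\hat x\hat y\hat z]=\widehat{[L_x,L_y](z)}$, where $\hat x$ is the class of $x$. Let $\mathfrak g(J)=(\mathfrak{sp}(V)\oplus\mathrm{der}\,J)\oplus(V\otimes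 T)$, with even part the direct sum of ideals $\mathfrak{sp}(V)\oplus\mathrm{der}\,J$ acting naturally on the odd part $V\otimes T$, and $$[u\otimes\hat x,v\otimes\hat y]=-(\hat x|\hat y)\gamma_{u,v}+\langle u|v\rangle[L_x,L_y],\qquad \gamma_{u,v}=\langle u|\cdot\rangle v+\langle v|\cdot\rangle u .$$ Then $T$ is an orthogonal triple system, that is, its form is nonzero and symmetric, and $[xxy]=0$, $[xyy]=(x|y)y-(y|y)x$, $[xy[uvw]]=[[xyu]vw]+[u[xyv]w]+[uv[xyw]]$ and $([xyu]|v)+(u|[xyv])=0$ for all $x,y,u,v,w\in T$; $\mathrm{der}\,J$ preserves $J_0$ and $k1$ and acts faithfully on $T$; $\mathfrak g(S_{1,2},S)$ and $\mathfrak g(J)$ are Lie superalgebras; there is exactly one linear map $\Psi:\mathfrak g(S_{1,2},S)\to\mathfrak g(J)$ such that * $\Psi(\tilde f,\tilde f,\tilde f)=f$ for $f\in\mathfrak{sp}(V)$, where $\tilde f(1)=0$ and $\tilde f|_V=f$, so that $(\tilde f,\tilde f,\tilde f)\in\mathfrak{tri}(S_{1,2})_{\bar 0}$; * $\Psi(d_0,d_1,d_2)$,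 for $(d_0,d_1,d_2)\in\mathfrak{tri}(S)$, is the derivation of $J$ with $e_i\mapsto0$ and $\iota_i(a)\mapsto\iota_i(d_i(a))$; * $\Psi(\iota_i(1\otimes a))=2[L_{\iota_i(a)},L_{e_{i+1}}]\in\mathrm{der}\,J$ for $a\in S$; * $\Psi(\sigma_{1,u},\sigma_{1,u},\sigma_{1,u})=u\otimes\widehat{e_0-e_1}$ for $u\in V$, where $(\sigma_{1,u},\sigma_{1,u},\sigma_{1,u})\in\mathfrak{tri}(S_{1,2})_{\bar 1}$; * $\Psi(\iota_i(u\otimes s))=u\otimes\widehat{\iota_i(s)}$ for $u\in V$, $s\in S$ and $i=0,1,2$; and $\Psi$ is an isomorphism of Lie superalgebras. -/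

import Mathlib

set_option maxSynthPendingDepth 3
set_option linter.unusedSectionVars false

open scoped TensorProduct

/-! ## Superspaces, superalgebras and Lie superalgebras

Parities are elements of `ZMod 2`; a superspace structure on a vector space is given by the two
projections onto its even and odd parts. -/

/-- The Koszul sign `(-1)^(ij)`. -/
def koszul (k : Type*) [Field k] (i j : ZMod 2) : k := (-1) ^ (i.val * j.val)

/-- A superspace structure: the projections `pr 0`, `pr 1` onto the even and the odd part. -/
structure Superspace (k M : Type*) [Field k] [AddCommGroup M] [Module k M] where
  pr : ZMod 2 → Module.End k M
  pr_pr : ∀ i j x, pr i (pr j x) = if i = j then pr i x else 0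
  pr_add : ∀ x, pr 0 x + pr 1 x = x

namespace Superspace

variable {k M N : Type*} [Field k] [AddCommGroup M] [Module k M] [AddCommGroup N] [Module k N]

/-- The homogeneous elements of parity `i`. -/
def part (P : Superspace k M) (i : ZMod 2) : Submodule k M := LinearMap.range (P.pr i)

/-- The parity `i` component of an endomorphism of a superspace. -/
def endPr (P : Superspace k M) (i : ZMod 2) : Module.End k M →ₗ[k] Module.End k M :=
  ∑ j, (LinearMap.llcomp k M M M (P.pr (i + j))).comp (LinearMap.lcomp k M (P.pr j))

theorem endPr_apply (P : Superspace k M) (i : ZMod 2) (f : Module.End k M) (x : M) :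
    P.endPr i f x = ∑ j, P.pr (i + j) (f (P.pr j x)) := by
  simp [endPr, LinearMap.sum_apply]

/-- The supercommutator `[f, g] = f g - (-1)^(|f||g|) g f` of endomorphisms of a superspace. -/
def superComm (P : Superspace k M) :
    Module.End k M →ₗ[k] Module.End k M →ₗ[k] Module.End k M :=
  LinearMap.mul k (Module.End k M) - ∑ i, ∑ j, koszul k i j •
    (LinearMap.mul k (Module.End k M)).flip.compl₁₂ (P.endPr i) (P.endPr j)

theorem superComm_apply (P : Superspace k M) (f g : Module.End k M) :
    P.superComm f g = f * g - ∑ i, ∑ j, koszul k i j • (P.endPr j g * P.endPr i f) := by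
  simp [superComm, LinearMap.sum_apply]

/-- The parity `i` component of an element of a tensor product of superspaces. -/
def tensorPr (P : Superspace k M) (Q : Superspace k N) (i : ZMod 2) : Module.End k (M ⊗[k] N) :=
  ∑ j, TensorProduct.map (P.pr (i + j)) (Q.pr j)

end Superspace

/-- `LieG 0 ⊕ LieG 1`, with the restriction of the product `br` of the ambient space `A`, is a Lie
superalgebra. The last condition is a consequence of the others in characteristic different
from `3`, and part of the definition in characteristic `3`. -/
structure IsLieSuperalgebra {k A : Type*} [Field k] [AddCommGroup A] [Module k A]
    (br : A →ₗ[k] A →ₗ[k] A) (G : ZMod 2 → Submodule k A) : Prop where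
  disjoint : Disjoint (G 0) (G 1)
  closed : ∀ i j x y, x ∈ G i → y ∈ G j → br x y ∈ G (i + j)
  skew : ∀ i j x y, x ∈ G i → y ∈ G j → br x y = -(koszul k i j • br y x)
  jacobi : ∀ i j x y z, x ∈ G i → y ∈ G j → z ∈ G 0 ⊔ G 1 →
    br x (br y z) = br (br x y) z + koszul k i j • br y (br x z)
  cube : ∀ x, x ∈ G 1 → br x (br x x) = 0

/-- `Ψ` is an isomorphism of Lie superalgebras from `G 0 ⊕ G 1` onto `G' 0 ⊕ G' 1`: a bijective
linear map that preserves parity and products. -/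
structure IsLieSuperIso {k A B : Type*} [Field k] [AddCommGroup A] [Module k A]
    [AddCommGroup B] [Module k B] (br : A →ₗ[k] A →ₗ[k] A) (G : ZMod 2 → Submodule k A)
    (br' : B →ₗ[k] B →ₗ[k] B) (G' : ZMod 2 → Submodule k B)
    (Ψ : ↥(G 0 ⊔ G 1) →ₗ[k] ↥(G' 0 ⊔ G' 1)) : Prop where
  bijective : Function.Bijective Ψ
  parity : ∀ i (X : ↥(G 0 ⊔ G 1)), (X : A) ∈ G i → (Ψ X : B) ∈ G' i
  map_br : ∀ X Y Z : ↥(G 0 ⊔ G 1), (Z : A) = br X Y → (Ψ Z : B) = br' (Ψ X) (Ψ Y)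

/-- A superspace with an even bilinear product `mul` and an even bilinear form `form`. -/
structure FormedSuperalgebra (k S : Type*) [Field k] [AddCommGroup S] [Module k S] extends
    Superspace k S where
  mul : S →ₗ[k] S →ₗ[k] S
  mul_pr : ∀ i j x y, pr (i + j) (mul (pr i x) (pr j y)) = mul (pr i x) (pr j y)
  form : LinearMap.BilinForm k S
  form_pr : ∀ i j x y, i ≠ j → form (pr i x) (pr j y) = 0

namespace FormedSuperalgebra

variable {k S : Type*} [Field k] [AddCommGroup S] [Module k S]

/-- The standard involution `x ↦ b(x,1)1 - x`, where `e` is the unit. -/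
def conj (A : FormedSuperalgebra k S) (e : S) : S →ₗ[k] S :=
  (A.form.flip e).smulRight e - LinearMap.id

theorem conj_apply (A : FormedSuperalgebra k S) (e x : S) :
    A.conj e x = A.form x e • e - x := by
  simp [conj]

theorem conj_pr (A : FormedSuperalgebra k S) {e : S} (he : A.pr 0 e = e) (i : ZMod 2) (x : S) :
    A.conj e (A.pr i x) = A.pr i (A.conj e x) := by
  have hx := A.pr_add x
  have h10 : ∀ y, A.form (A.pr 1 y) e = 0 := fun y => by
    rw [← he]; exact A.form_pr 1 0 y e (by decide)
  have h1e : A.pr 1 e = 0 := by rw [← he, A.pr_pr]; simp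
  have hfx : A.form x e = A.form (A.pr 0 x) e := by
    conv_lhs => rw [← hx]
    simp [h10]
  have hi : i = 0 ∨ i = 1 := by revert i; decide
  rcases hi with rfl | rfl
  · simp [conj_apply, he, hfx]
  · simp [conj_apply, h10, h1e]

/-- The para-Hurwitz superalgebra of a Hurwitz superalgebra with unit `e`: the same superspace and
form, with the product `x • y = x̄ ȳ`. -/
def para (A : FormedSuperalgebra k S) (e : S) (he : A.pr 0 e = e) : FormedSuperalgebra k S where
  toSuperspace := A.toSuperspace
  mul := A.mul.compl₁₂ (A.conj e) (A.conj e)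
  mul_pr i j x y := by
    simp only [LinearMap.compl₁₂_apply, A.conj_pr he]
    exact A.mul_pr i j _ _
  form := A.form
  form_pr := A.form_pr

/-- `osp(S,b)_i`, the parity `i` part of the orthosymplectic Lie superalgebra. -/
def osp (A : FormedSuperalgebra k S) (i : ZMod 2) : Set (Module.End k S) :=
  {f | (∀ p, ∀ x ∈ A.part p, f x ∈ A.part (i + p)) ∧
    ∀ p, ∀ x ∈ A.part p, ∀ y, A.form (f x) y + koszul k i p * A.form x (f y) = 0}

/-- `tri(S)_i`, the parity `i` part of the triality Lie superalgebra. -/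
def tri (A : FormedSuperalgebra k S) (i : ZMod 2) : Submodule k (Fin 3 → Module.End k S) where
  carrier := {d | (∀ n, d n ∈ A.osp i) ∧ ∀ p, ∀ x ∈ A.part p, ∀ y,
    d 0 (A.mul x y) = A.mul (d 1 x) y + koszul k i p • A.mul x (d 2 y)}
  zero_mem' := by
    refine ⟨fun n => ⟨fun p x _ => ?_, fun p x _ y => ?_⟩, fun p x _ y => ?_⟩ <;> simp
  add_mem' := by
    rintro d d' ⟨h1, h2⟩ ⟨h1', h2'⟩
    refine ⟨fun n => ⟨fun p x hx => ?_, fun p x hx y => ?_⟩, fun p x hx y => ?_⟩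
    · exact Submodule.add_mem _ ((h1 n).1 p x hx) ((h1' n).1 p x hx)
    · have a := (h1 n).2 p x hx y
      have b := (h1' n).2 p x hx y
      simp only [Pi.add_apply, LinearMap.add_apply, map_add]
      linear_combination a + b
    · have a := h2 p x hx y
      have b := h2' p x hx y
      simp only [Pi.add_apply, LinearMap.add_apply, map_add, a, b, smul_add]
      abel
  smul_mem' := by
    rintro c d ⟨h1, h2⟩
    refine ⟨fun n => ⟨fun p x hx => ?_, fun p x hx y => ?_⟩, fun p x hx y => ?_⟩
    · exact Submodule.smul_mem _ c ((h1 n).1 p x hx)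
    · have a := (h1 n).2 p x hx y
      simp only [Pi.smul_apply, LinearMap.smul_apply, map_smul, smul_eq_mul]
      linear_combination c * a
    · have a := h2 p x hx y
      simp only [Pi.smul_apply, LinearMap.smul_apply, map_smul, a, smul_add]
      rw [smul_comm c]

/-- `l_x(y) = x • y`. -/
def lmul (A : FormedSuperalgebra k S) : S →ₗ[k] Module.End k S := A.mul

/-- `r_x(y) = (-1)^(|x||y|) y • x`. -/
def rmul (A : FormedSuperalgebra k S) : S →ₗ[k] Module.End k S :=
  ∑ i, ∑ j, koszul k i j • A.mul.flip.compl₁₂ (A.pr i) (A.pr j)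

theorem rmul_apply (A : FormedSuperalgebra k S) (x y : S) :
    A.rmul x y = ∑ i, ∑ j, koszul k i j • A.mul (A.pr j y) (A.pr i x) := by
  simp [rmul, LinearMap.sum_apply]

/-- `σ_{x,y}(z) = (-1)^(|y||z|) b(x,z) y - (-1)^(|x|(|y|+|z|)) b(y,z) x`. -/
def sigma (A : FormedSuperalgebra k S) : S →ₗ[k] S →ₗ[k] Module.End k S :=
  ∑ p, ∑ q, ∑ r,
    (LinearMap.compl₁₂
      (koszul k q r • (LinearMap.smulRightₗ.comp A.form : S →ₗ[k] S →ₗ[k] Module.End k S)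
        - koszul k p (q + r) •
          (LinearMap.smulRightₗ.comp A.form : S →ₗ[k] S →ₗ[k] Module.End k S).flip)
      (A.pr p) (A.pr q)).compr₂ (LinearMap.lcomp k S (A.pr r))

theorem sigma_apply (A : FormedSuperalgebra k S) (x y z : S) :
    A.sigma x y z = ∑ p, ∑ q, ∑ r,
      (koszul k q r • A.form (A.pr p x) (A.pr r z) • A.pr q y
        - koszul k p (q + r) • A.form (A.pr q y) (A.pr r z) • A.pr p x) := by
  simp [sigma, LinearMap.sum_apply]

/-- `t_{x,y} = (σ_{x,y}, ½ b(x,y) 1 - r_x l_y, ½ b(x,y) 1 - l_x r_y)`. -/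
def t (A : FormedSuperalgebra k S) : S →ₗ[k] S →ₗ[k] (Fin 3 → Module.End k S) :=
  LinearMap.mk₂ k (fun x y => ![A.sigma x y,
      (2⁻¹ * A.form x y) • 1 - A.rmul x * A.lmul y,
      (2⁻¹ * A.form x y) • 1 - A.lmul x * A.rmul y])
    (by
      intro x x' y; funext n
      fin_cases n <;> simp [mul_add, add_smul, add_mul] <;> abel)
    (by
      intro c x y; funext n
      fin_cases n <;> simp [mul_left_comm, smul_sub, mul_smul])
    (by
      intro x y y'; funext n
      fin_cases n <;> simp [mul_add, add_smul] <;> abel)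
    (by
      intro c x y; funext n
      fin_cases n <;> simp [mul_left_comm, smul_sub, mul_smul])

end FormedSuperalgebra

/-- `θ^n`, where `θ(d₀,d₁,d₂) = (d₂,d₀,d₁)`. -/
def thetaPow {E : Type*} (n : Fin 3) (d : Fin 3 → E) : Fin 3 → E := fun i => d (i - n)

/-! ## The Lie superalgebra `g(S,S')`

Its elements are written `(d, d', ξ)`, with `d ∈ tri(S)`, `d' ∈ tri(S')` and
`ξ = ι_0(ξ_0) + ι_1(ξ_1) + ι_2(ξ_2)`, `ξ_i ∈ S ⊗ S'`. The bracket is defined on all triples of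
endomorphisms. -/

/-- The ambient space of `g(S,S')`. -/
abbrev MagicSpace (k S S' : Type*) [Field k] [AddCommGroup S] [Module k S]
    [AddCommGroup S'] [Module k S'] : Type _ :=
  (Fin 3 → Module.End k S) × (Fin 3 → Module.End k S') × (Fin 3 → S ⊗[k] S')

namespace Magic

open FormedSuperalgebra

variable {k S S' : Type*} [Field k] [AddCommGroup S] [Module k S] [AddCommGroup S'] [Module k S']

/-- The parity `i` component of an element of the ambient space. -/
def pr (A : FormedSuperalgebra k S) (B : FormedSuperalgebra k S') (i : ZMod 2) :
    MagicSpace k S S' →ₗ[k] MagicSpace k S S' where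
  toFun X := (fun n => A.endPr i (X.1 n), fun n => B.endPr i (X.2.1 n),
    fun n => A.tensorPr B.toSuperspace i (X.2.2 n))
  map_add' X Y := by ext <;> simp
  map_smul' c X := by ext <;> simp

/-- `x ⊗ x' ↦ (-1)^(|d'||x|) x ⊗ d'(x')`. -/
def rAct (A : FormedSuperalgebra k S) (B : FormedSuperalgebra k S') :
    Module.End k S' →ₗ[k] Module.End k (S ⊗[k] S') :=
  ∑ p, ∑ q, koszul k p q •
    ((LinearMap.lTensorHom S).comp (B.endPr p)).compl₂ ((A.pr q).rTensor S')

/-- `(x ⊗ x', y ⊗ y') ↦ (-1)^(|x'||y|) (x • y) ⊗ (x' • y')`. -/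
def tensorMul (A : FormedSuperalgebra k S) (B : FormedSuperalgebra k S') :
    S ⊗[k] S' →ₗ[k] S ⊗[k] S' →ₗ[k] S ⊗[k] S' :=
  ∑ p, ∑ q, koszul k p q • (TensorProduct.map₂ A.mul B.mul).compl₁₂
    ((B.pr p).lTensor S) ((A.pr q).rTensor S')

/-- `(x ⊗ x', y ⊗ y') ↦ (-1)^(|x||x'|+|x||y'|+|y||y'|) b'(x',y') t_{x,y}`. -/
def tPart (A : FormedSuperalgebra k S) (B : FormedSuperalgebra k S') :
    S ⊗[k] S' →ₗ[k] S ⊗[k] S' →ₗ[k] (Fin 3 → Module.End k S) :=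
  ∑ p, ∑ p', ∑ q, ∑ q', (koszul k p p' * koszul k p q' * koszul k q q') •
    ((TensorProduct.map₂ A.t B.form).compr₂
      (TensorProduct.rid k (Fin 3 → Module.End k S)).toLinearMap).compl₁₂
      (TensorProduct.map (A.pr p) (B.pr p')) (TensorProduct.map (A.pr q) (B.pr q'))

/-- `(x ⊗ x', y ⊗ y') ↦ (-1)^(|y||x'|) b(x,y) t'_{x',y'}`. -/
def tPart' (A : FormedSuperalgebra k S) (B : FormedSuperalgebra k S') :
    S ⊗[k] S' →ₗ[k] S ⊗[k] S' →ₗ[k] (Fin 3 → Module.End k S') :=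
  ∑ p', ∑ q, koszul k q p' •
    ((TensorProduct.map₂ A.form B.t).compr₂
      (TensorProduct.lid k (Fin 3 → Module.End k S')).toLinearMap).compl₁₂
      ((B.pr p').lTensor S) ((A.pr q).rTensor S')

/-- The brackets `[d, ι_n(ξ)]`, `[d', ι_n(ξ)]` and `[ι_n(ξ), ι_{n+1}(η)] = ι_{n+2}(ξ η)`, for the
components of `X` on the left and of `Y` on the right. -/
def half (A : FormedSuperalgebra k S) (B : FormedSuperalgebra k S') :
    MagicSpace k S S' →ₗ[k] MagicSpace k S S' →ₗ[k] (Fin 3 → S ⊗[k] S') :=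
  LinearMap.mk₂ k (fun X Y n => (X.1 n).rTensor S' (Y.2.2 n) + rAct A B (X.2.1 n) (Y.2.2 n)
      + tensorMul A B (X.2.2 (n + 1)) (Y.2.2 (n + 2)))
    (by intro X X' Y; funext n; simp [LinearMap.rTensor_add]; abel)
    (by intro c X Y; funext n; simp [LinearMap.rTensor_smul])
    (by intro X Y Y'; funext n; simp; abel)
    (by intro c X Y; funext n; simp)

/-- The bracket of `g(S,S')`; the products with the factors in the other order are
given by super-anticommutativity. -/
def bracket (A : FormedSuperalgebra k S) (B : FormedSuperalgebra k S') :
    MagicSpace k S S' →ₗ[k] MagicSpace k S S' →ₗ[k] MagicSpace k S S' :=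
  LinearMap.mk₂ k (fun X Y =>
    (fun i => A.superComm (X.1 i) (Y.1 i)
        + ∑ n, thetaPow n (tPart A B (X.2.2 n) (Y.2.2 n)) i,
     fun i => B.superComm (X.2.1 i) (Y.2.1 i)
        + ∑ n, thetaPow n (tPart' A B (X.2.2 n) (Y.2.2 n)) i,
     half A B X Y - ∑ p, ∑ q, koszul k p q • half A B (pr A B q Y) (pr A B p X)))
    (by
      intro X X' Y
      refine Prod.ext (funext fun i => ?_) (Prod.ext (funext fun i => ?_) ?_)
      all_goals simp [thetaPow, Finset.sum_add_distrib]; abel)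
    (by
      intro c X Y
      refine Prod.ext (funext fun i => ?_) (Prod.ext (funext fun i => ?_) ?_)
      all_goals simp [thetaPow, Finset.smul_sum, smul_sub, smul_comm c])
    (by
      intro X Y Y'
      refine Prod.ext (funext fun i => ?_) (Prod.ext (funext fun i => ?_) ?_)
      all_goals simp [thetaPow, Finset.sum_add_distrib]; abel)
    (by
      intro c X Y
      refine Prod.ext (funext fun i => ?_) (Prod.ext (funext fun i => ?_) ?_)
      all_goals simp [thetaPow, Finset.smul_sum, smul_sub, smul_comm c])

/-- The parity `i` part of `g(S,S')`. -/
def part (A : FormedSuperalgebra k S) (B : FormedSuperalgebra k S') (i : ZMod 2) :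
    Submodule k (MagicSpace k S S') :=
  (A.tri i).prod ((B.tri i).prod
    (Submodule.pi Set.univ fun _ => LinearMap.range (A.tensorPr B.toSuperspace i)))

end Magic

/-! ## The superalgebra `S_{1,2}` -/

section SuperB

variable {k V : Type*} [Field k] [AddCommGroup V] [Module k V]

/-- The superalgebra `B(1,2) = k1 ⊕ V`, with unit `(1, 0)`, product `uv = ⟨u|v⟩1` for odd `u, v`,
and form `b(1,1) = 2`, `b(u,v) = ⟨u|v⟩`. -/
def superB (ω : LinearMap.BilinForm k V) : FormedSuperalgebra k (k × V) where
  pr i := if i = 0 then (LinearMap.inl k k V).comp (LinearMap.fst k k V)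
    else (LinearMap.inr k k V).comp (LinearMap.snd k k V)
  pr_pr i j x := by
    have h : ∀ i : ZMod 2, i = 0 ∨ i = 1 := by decide
    rcases h i with rfl | rfl <;> rcases h j with rfl | rfl <;> simp
  pr_add x := by simp
  mul := LinearMap.mk₂ k (fun x y => (x.1 * y.1 + ω x.2 y.2, x.1 • y.2 + y.1 • x.2))
    (by intro x x' y; ext <;> simp [add_mul, add_smul] <;> abel)
    (by intro c x y; ext <;> simp [mul_add, mul_assoc, mul_smul, smul_comm c])
    (by intro x y y'; ext <;> simp [mul_add, add_smul] <;> abel)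
    (by intro c x y; ext <;> simp [mul_add, mul_left_comm, mul_smul, smul_comm c])
  mul_pr i j x y := by
    have h : ∀ i : ZMod 2, i = 0 ∨ i = 1 := by decide
    have h2 : (1 + 1 : ZMod 2) = 0 := by decide
    rcases h i with rfl | rfl <;> rcases h j with rfl | rfl <;> simp [h2]
  form := LinearMap.mk₂ k (fun x y => 2 * (x.1 * y.1) + ω x.2 y.2)
    (by intro x x' y; simp; ring)
    (by intro c x y; simp; ring)
    (by intro x y y'; simp; ring)
    (by intro c x y; simp; ring)
  form_pr i j x y hij := by
    have h : ∀ i : ZMod 2, i = 0 ∨ i = 1 := by decide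
    rcases h i with rfl | rfl <;> rcases h j with rfl | rfl <;> simp at hij ⊢

/-- `S_{1,2}`, the para-Hurwitz superalgebra of `B(1,2)`. -/
def superS (ω : LinearMap.BilinForm k V) : FormedSuperalgebra k (k × V) :=
  (superB ω).para (1, 0) (by simp [superB])

/-- `sp(V)`. -/
def spV (ω : LinearMap.BilinForm k V) : Submodule k (Module.End k V) :=
  LinearMap.skewAdjointSubmodule ω

/-- `γ_{u,v} = ⟨u|·⟩v + ⟨v|·⟩u`. -/
def gammaV (ω : LinearMap.BilinForm k V) : V →ₗ[k] V →ₗ[k] Module.End k V :=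
  (LinearMap.smulRightₗ.comp ω : V →ₗ[k] V →ₗ[k] Module.End k V)
    + (LinearMap.smulRightₗ.comp ω : V →ₗ[k] V →ₗ[k] Module.End k V).flip

theorem gammaV_apply (ω : LinearMap.BilinForm k V) (u v w : V) :
    gammaV ω u v w = ω u w • v + ω v w • u := by
  simp [gammaV]

end SuperB

/-! ## Hurwitz algebras and `3 × 3` hermitian matrices -/

section Hurwitz

variable {k C : Type*} [Field k] [NonAssocRing C] [Module k C] [IsScalarTower k C C]
  [SMulCommClass k C C]

/-- `q` is the norm of a Hurwitz algebra: a regular multiplicative quadratic form on the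
(nonzero, unital) algebra `C`, the characteristic being different from `2`. -/
structure IsHurwitz (q : QuadraticForm k C) : Prop where
  nontrivial : Nontrivial C
  regular : q.polarBilin.Nondegenerate
  map_mul : ∀ x y, q (x * y) = q x * q y

/-- An algebra `C` with norm `q`, as a superalgebra with zero odd part. -/
def algC (q : QuadraticForm k C) : FormedSuperalgebra k C where
  pr i := if i = 0 then LinearMap.id else 0
  pr_pr i j x := by
    have h : ∀ i : ZMod 2, i = 0 ∨ i = 1 := by decide
    rcases h i with rfl | rfl <;> rcases h j with rfl | rfl <;> simp
  pr_add x := by simp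
  mul := LinearMap.mul k C
  mul_pr i j x y := by
    have h : ∀ i : ZMod 2, i = 0 ∨ i = 1 := by decide
    rcases h i with rfl | rfl <;> rcases h j with rfl | rfl <;> simp
  form := q.polarBilin
  form_pr i j x y hij := by
    have h : ∀ i : ZMod 2, i = 0 ∨ i = 1 := by decide
    rcases h i with rfl | rfl <;> rcases h j with rfl | rfl <;> simp at hij ⊢

/-- The para-Hurwitz algebra `S = C̄` of `C`. -/
def paraC (q : QuadraticForm k C) : FormedSuperalgebra k C :=
  (algC q).para 1 (by simp [algC])

/-- The standard involution of `C`. -/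
def cconj (q : QuadraticForm k C) : C →ₗ[k] C := (algC q).conj 1

theorem cconj_apply (q : QuadraticForm k C) (x : C) :
    cconj q x = QuadraticMap.polar q x 1 • (1 : C) - x := by
  simp [cconj, FormedSuperalgebra.conj_apply, algC]

namespace IsHurwitz

open QuadraticMap

variable {q : QuadraticForm k C}

theorem map_one (hq : IsHurwitz q) : q 1 = 1 := by
  have h1 := hq.map_mul 1 1
  rw [mul_one] at h1
  have h0 : q 1 ≠ 0 := by
    intro h
    have hz : ∀ x, q x = 0 := fun x => by
      have := hq.map_mul x 1
      rwa [mul_one, h, mul_zero] at this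
    have := hq.nontrivial
    apply one_ne_zero (α := C)
    apply hq.regular.1
    intro y
    simp [polar, hz]
  exact (mul_left_cancel₀ h0 (by rw [mul_one]; exact h1)).symm

theorem polar_left (hq : IsHurwitz q) (x y z : C) :
    polar q (x * y) (x * z) = q x * polar q y z := by
  simp only [polar, ← mul_add, hq.map_mul]; ring

theorem polar_four (hq : IsHurwitz q) (x y z w : C) :
    polar q (x * y) (z * w) + polar q (x * w) (z * y) = polar q x z * polar q y w := by
  have h := hq.polar_left (x + z) y w
  rw [add_mul, add_mul] at h
  simp only [polar_add_left, polar_add_right, hq.polar_left] at h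
  have h2 := polar_comm q (x * w) (z * y)
  simp only [polar] at h h2 ⊢
  linear_combination h + h2

theorem polar_mul_right (hq : IsHurwitz q) (x y z : C) :
    polar q (x * y) z = polar q x (z * cconj q y) := by
  have h := hq.polar_four x y z 1
  rw [mul_one, mul_one] at h
  simp only [cconj_apply, mul_sub, mul_smul_comm, mul_one, polar_sub_right, polar_smul_right,
    smul_eq_mul]
  linear_combination h

theorem polar_mul_left (hq : IsHurwitz q) (x y z : C) :
    polar q (x * y) z = polar q y (cconj q x * z) := by
  have h := hq.polar_four x y 1 z
  rw [one_mul, one_mul, polar_comm q (x * z) y] at h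
  simp only [cconj_apply, sub_mul, smul_mul_assoc, one_mul, polar_sub_right, polar_smul_right,
    smul_eq_mul]
  linear_combination h

theorem polar_conj (q : QuadraticForm k C) (x z : C) :
    polar q (cconj q x) z = polar q x (cconj q z) := by
  simp only [cconj_apply, polar_sub_right, polar_smul_right, polar_sub_left, polar_smul_left,
    smul_eq_mul, polar_comm q 1 z]
  ring

theorem polar_one_one (hq : IsHurwitz q) : polar q 1 1 = 2 := by
  have h : q (1 + 1) = 4 * q 1 := by
    have := QuadraticMap.map_smul q (2 : k) 1
    rw [two_smul] at this
    rw [this]; simp; norm_num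
  rw [polar, h, hq.map_one]; norm_num

theorem conj_one (hq : IsHurwitz q) : cconj q 1 = 1 := by
  rw [cconj_apply, hq.polar_one_one, two_smul]; abel

theorem conj_conj (hq : IsHurwitz q) (x : C) : cconj q (cconj q x) = x := by
  rw [cconj_apply q (cconj q x), polar_conj, hq.conj_one, cconj_apply]; abel

theorem conj_mul (hq : IsHurwitz q) (x y : C) :
    cconj q (x * y) = cconj q y * cconj q x := by
  rw [← sub_eq_zero]
  apply hq.regular.1
  intro z
  simp only [polarBilin_apply_apply, polar_sub_left]
  rw [hq.polar_mul_right (cconj q y), hq.conj_conj, polar_comm q (cconj q y),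
    hq.polar_mul_left z, polar_conj, hq.polar_mul_right x, sub_self]

theorem trace_comm (hq : IsHurwitz q) (x y : C) : polar q (x * y) 1 = polar q (y * x) 1 := by
  rw [hq.polar_mul_right, hq.polar_mul_left y, one_mul, mul_one]

theorem trace_assoc (hq : IsHurwitz q) (x y z : C) :
    polar q (x * y * z) 1 = polar q (x * (y * z)) 1 := by
  rw [hq.polar_mul_right, hq.polar_mul_right, one_mul, hq.polar_mul_right x (y * z), one_mul,
    hq.conj_mul]

end IsHurwitz

/-- The `3 × 3` matrices over `C` that are equal to their conjugate transposes. -/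
def hermitian (q : QuadraticForm k C) : Submodule k (Matrix (Fin 3) (Fin 3) C) where
  carrier := {x | ∀ i j, x i j = cconj q (x j i)}
  zero_mem' := by intro i j; simp
  add_mem' := by
    intro x y hx hy i j
    rw [Matrix.add_apply, Matrix.add_apply, map_add, ← hx, ← hy]
  smul_mem' := by
    intro c x hx i j
    rw [Matrix.smul_apply, Matrix.smul_apply, map_smul, ← hx]

/-- `J = H_3(C,*)`. -/
def Herm (q : QuadraticForm k C) : Type _ := ↥(hermitian q)

namespace Herm

variable {q : QuadraticForm k C}

instance : AddCommGroup (Herm q) := inferInstanceAs (AddCommGroup (hermitian q))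

instance : Module k (Herm q) := inferInstanceAs (Module k (hermitian q))

/-- The underlying matrix of an element of `J`. -/
def val : Herm q →ₗ[k] Matrix (Fin 3) (Fin 3) C := (hermitian q).subtype

/-- The element of `J` given by a hermitian matrix. -/
def mk (m : Matrix (Fin 3) (Fin 3) C) (hm : m ∈ hermitian q) : Herm q :=
  (⟨m, hm⟩ : hermitian q)

@[simp] theorem val_mk (m : Matrix (Fin 3) (Fin 3) C) (hm : m ∈ hermitian q) :
    (mk m hm).val = m := rfl

@[ext] theorem ext {x y : Herm q} (h : x.val = y.val) : x = y := Subtype.ext h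

theorem val_apply (x : Herm q) (i j : Fin 3) : x.val i j = cconj q (x.val j i) :=
  Subtype.property (p := fun m => m ∈ hermitian q) x i j

end Herm

/-- The Jordan product `x ∘ y = ½(xy + yx)` on `J`. -/
def jmul {q : QuadraticForm k C} (hq : IsHurwitz q) : Herm q →ₗ[k] Herm q →ₗ[k] Herm q :=
  LinearMap.mk₂ k (fun x y => Herm.mk ((2⁻¹ : k) • (x.val * y.val + y.val * x.val)) (by
      refine Submodule.smul_mem _ _ fun i j => ?_
      simp only [Matrix.add_apply, Matrix.mul_apply, map_add, map_sum, hq.conj_mul]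
      rw [add_comm]
      congr 1 <;> refine Finset.sum_congr rfl fun l _ => ?_
      · rw [← x.val_apply, ← y.val_apply]
      · rw [← x.val_apply, ← y.val_apply]))
    (by intro x x' y; ext1; simp [add_mul, mul_add]; module)
    (by intro c x y; ext1; simp [smul_comm c])
    (by intro x y y'; ext1; simp [add_mul, mul_add]; module)
    (by intro c x y; ext1; simp [smul_comm c])

theorem jmul_val {q : QuadraticForm k C} (hq : IsHurwitz q) (x y : Herm q) :
    (jmul hq x y).val = (2⁻¹ : k) • (x.val * y.val + y.val * x.val) := rfl

/-- The trace `t : J → k`; a diagonal entry `α1` of a hermitian matrix contributes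
`½ b(α1,1) = α`. -/
def jtrace (q : QuadraticForm k C) : Herm q →ₗ[k] k where
  toFun x := 2⁻¹ * ∑ i, QuadraticMap.polar q (x.val i i) 1
  map_add' x y := by simp [Finset.sum_add_distrib, QuadraticMap.polar_add_left, mul_add]
  map_smul' c x := by
    simp only [map_smul, Matrix.smul_apply, QuadraticMap.polar_smul_left, smul_eq_mul,
      ← Finset.mul_sum, RingHom.id_apply]
    ring

/-- The identity matrix. -/
def jone {q : QuadraticForm k C} (hq : IsHurwitz q) : Herm q :=
  Herm.mk 1 fun i j => by
    rcases eq_or_ne i j with rfl | h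
    · simp [hq.conj_one]
    · simp [Matrix.one_apply_ne h, Matrix.one_apply_ne h.symm]

theorem jone_val {q : QuadraticForm k C} (hq : IsHurwitz q) : (jone hq).val = 1 := rfl

/-- The idempotents `e_0, e_1, e_2`. -/
def je {q : QuadraticForm k C} (hq : IsHurwitz q) (n : Fin 3) : Herm q :=
  Herm.mk (Matrix.single n n 1) fun i j => by
    rcases eq_or_ne n i with rfl | hi
    · rcases eq_or_ne n j with rfl | hj
      · simp [hq.conj_one]
      · simp [Matrix.single, hj]
    · simp [Matrix.single, hi]

/-- `ι_n(a)`: the hermitian matrix with entries `2a` in position `(n+2,n+1)`, `2ā` in position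
`(n+1,n+2)`, and `0` elsewhere, the rows and columns being numbered `0, 1, 2` modulo `3`. -/
def jiota {q : QuadraticForm k C} (hq : IsHurwitz q) (n : Fin 3) : C →ₗ[k] Herm q where
  toFun a := Herm.mk ((2 : k) • (Matrix.single (n + 2) (n + 1) a
      + Matrix.single (n + 1) (n + 2) (cconj q a))) (by
    refine Submodule.smul_mem _ _ fun i j => ?_
    fin_cases n <;> fin_cases i <;> fin_cases j <;> simp [Matrix.single, hq.conj_conj])
  map_add' a b := by ext1; simp [Matrix.single_add]; module
  map_smul' c a := by ext1; simp [← Matrix.smul_single, smul_comm c]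

/-! ## The orthogonal triple system `T_J = J_0 / k1` -/

theorem jmul_comm {q : QuadraticForm k C} (hq : IsHurwitz q) (x y : Herm q) :
    jmul hq x y = jmul hq y x := by
  ext1; simp [jmul_val, add_comm]

theorem jmul_one {q : QuadraticForm k C} (hq : IsHurwitz q) (h2 : (2 : k) ≠ 0)
    (x : Herm q) : jmul hq x (jone hq) = x := by
  ext1
  simp only [jmul_val, jone_val, mul_one, one_mul]
  rw [← two_smul k, smul_smul, inv_mul_cancel₀ h2, one_smul]

/-- The trace form `t(x,y) = t(x ∘ y)`. -/
def jform {q : QuadraticForm k C} (hq : IsHurwitz q) : LinearMap.BilinForm k (Herm q) :=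
  (jmul hq).compr₂ (jtrace q)

/-- The trace form is associative. -/
theorem jform_assoc {q : QuadraticForm k C} (hq : IsHurwitz q) (x y z : Herm q) :
    jform hq (jmul hq x y) z = jform hq x (jmul hq y z) := by
  let τ : Matrix (Fin 3) (Fin 3) C →ₗ[k] k :=
    (q.polarBilin.flip 1).comp (Matrix.traceLinearMap (Fin 3) k C)
  have hτ : ∀ m, τ m = ∑ i, QuadraticMap.polar q (m i i) 1 := fun m => by
    simp [τ, Matrix.trace]
  have hsum : ∀ f : Fin 3 → C,
      QuadraticMap.polar q (∑ i, f i) 1 = ∑ i, QuadraticMap.polar q (f i) 1 := fun f => by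
    simp [Fin.sum_univ_three, QuadraticMap.polar_add_left]
  have hc : ∀ a b, τ (a * b) = τ (b * a) := fun a b => by
    simp only [hτ, Matrix.mul_apply, hsum]
    rw [Finset.sum_comm]
    simp only [hq.trace_comm]
  have ha : ∀ a b c, τ (a * b * c) = τ (a * (b * c)) := fun a b c => by
    simp only [hτ, Matrix.mul_apply, Finset.sum_mul, Finset.mul_sum, hsum]
    refine Finset.sum_congr rfl fun i _ => ?_
    rw [Finset.sum_comm]
    simp only [hq.trace_assoc]
  have ht : ∀ x : Herm q, jtrace q x = 2⁻¹ * τ x.val := fun x => by rw [hτ]; rfl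
  simp only [jform, LinearMap.compr₂_apply, ht, jmul_val, map_smul, map_add,
    add_mul, mul_add, smul_mul_assoc, mul_smul_comm, smul_eq_mul]
  have h1 := ha x.val y.val z.val
  have h2 := hc z.val (x.val * y.val)
  have h3 := hc (y.val * z.val) x.val
  have h4 : τ (y.val * x.val * z.val) = τ (x.val * (z.val * y.val)) := by
    rw [ha, hc, ha]
  have h5 := hc z.val (y.val * x.val)
  have h6 := hc (z.val * y.val) x.val
  rw [h2, h3, h5, h6, h1, h4]

/-- `J_0`, the elements of trace zero. -/
def jzero (q : QuadraticForm k C) : Submodule k (Herm q) := LinearMap.ker (jtrace q)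

/-- The elements of `J_0` lying in `k1`; in characteristic `3` this is `k1`. -/
def jscalar {q : QuadraticForm k C} (hq : IsHurwitz q) : Submodule k (jzero q) :=
  (Submodule.span k {jone hq}).comap (jzero q).subtype

/-- `T_J = J_0 / k1`. -/
abbrev TJ {q : QuadraticForm k C} (hq : IsHurwitz q) : Type _ := jzero q ⧸ jscalar hq

/-- The linear maps `J → J` which preserve both `J_0` and `k1`. -/
def stab {q : QuadraticForm k C} (hq : IsHurwitz q) :
    Subalgebra k (Module.End k (Herm q)) where
  carrier := {f | (∀ x ∈ jzero q, f x ∈ jzero q) ∧ f (jone hq) ∈ Submodule.span k {jone hq}}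
  mul_mem' := by
    rintro f g ⟨hf, hf'⟩ ⟨hg, hg'⟩
    refine ⟨fun x hx => hf _ (hg x hx), ?_⟩
    obtain ⟨c, hc⟩ := Submodule.mem_span_singleton.1 hg'
    rw [Module.End.mul_apply, ← hc, map_smul]
    exact Submodule.smul_mem _ c hf'
  add_mem' := by
    rintro f g ⟨hf, hf'⟩ ⟨hg, hg'⟩
    exact ⟨fun x hx => Submodule.add_mem _ (hf x hx) (hg x hx), Submodule.add_mem _ hf' hg'⟩
  algebraMap_mem' := by
    intro c
    exact ⟨fun x hx => Submodule.smul_mem _ c hx,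
      Submodule.smul_mem _ c (Submodule.mem_span_singleton_self _)⟩

/-- The action on `T_J = J_0 / k1` induced by a linear map of `J` which preserves `J_0`
and `k1`. -/
def stabAct {q : QuadraticForm k C} (hq : IsHurwitz q) : stab hq →ₗ[k] Module.End k (TJ hq) where
  toFun f := (jscalar hq).mapQ (jscalar hq) (f.1.restrict f.2.1) (by
    intro x hx
    obtain ⟨c, hc⟩ := Submodule.mem_span_singleton.1 hx
    change f.1 x.1 ∈ Submodule.span k {jone hq}
    rw [Submodule.subtype_apply] at hc
    rw [← hc, map_smul]
    exact Submodule.smul_mem _ c f.2.2)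
  map_add' f g := by ext x; rfl
  map_smul' c f := by ext x; rfl

theorem lie_mem_stab {q : QuadraticForm k C} (hq : IsHurwitz q) (h2 : (2 : k) ≠ 0)
    (x y : Herm q) :
    jmul hq x * jmul hq y - jmul hq y * jmul hq x ∈ stab hq := by
  refine ⟨fun z _ => ?_, ?_⟩
  · have h : ∀ w, jtrace q w = jform hq w (jone hq) := fun w => by
      simp [jform, jmul_one hq h2]
    rw [jzero, LinearMap.mem_ker, h]
    have hs : ∀ a b, jform hq a b = jform hq b a := fun a b => by
      simp [jform, jmul_comm hq a b]
    simp only [LinearMap.sub_apply, Module.End.mul_apply, map_sub]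
    rw [jform_assoc, jform_assoc, jmul_one hq h2, jmul_one hq h2, ← jform_assoc, jmul_comm hq x y,
      jform_assoc, sub_self]
  · simp only [LinearMap.sub_apply, Module.End.mul_apply]
    rw [jmul_one hq h2, jmul_one hq h2, jmul_comm, sub_self]
    exact Submodule.zero_mem _

section CharThree

variable [CharP k 3]

theorem two_ne_zero_of_charP_three (k : Type*) [Field k] [CharP k 3] : (2 : k) ≠ 0 := by
  intro h
  have h3 : ((3 : ℕ) : k) = 0 := CharP.cast_eq_zero k 3
  push_cast at h3
  exact one_ne_zero (α := k) (by linear_combination h3 - h)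

/-- `(x,y) ↦ [L_x, L_y]`. -/
def jlie {q : QuadraticForm k C} (hq : IsHurwitz q) : Herm q →ₗ[k] Herm q →ₗ[k] stab hq :=
  LinearMap.mk₂ k (fun x y => ⟨jmul hq x * jmul hq y - jmul hq y * jmul hq x,
      lie_mem_stab hq (two_ne_zero_of_charP_three k) x y⟩)
    (by intro x x' y; ext1; simp [add_mul, mul_add]; abel)
    (by intro c x y; ext1; simp [smul_sub])
    (by intro x y y'; ext1; simp [add_mul, mul_add]; abel)
    (by intro c x y; ext1; simp [smul_sub])

theorem jlie_one {q : QuadraticForm k C} (hq : IsHurwitz q) (x : Herm q) :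
    jlie hq x (jone hq) = 0 ∧ jlie hq (jone hq) x = 0 := by
  have h : jmul hq (jone hq) = 1 := by
    ext1 y
    rw [jmul_comm, jmul_one hq (two_ne_zero_of_charP_three k)]; rfl
  constructor <;> ext1 <;> simp [jlie, h]

/-- The bilinear form `(x̂|ŷ) = t(x ∘ y)` on `T_J`. -/
def tform {q : QuadraticForm k C} (hq : IsHurwitz q) : LinearMap.BilinForm k (TJ hq) :=
  LinearMap.liftQ₂ (jscalar hq) (jscalar hq)
    ((jform hq).compl₁₂ (jzero q).subtype (jzero q).subtype)
    (by
      intro x hx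
      obtain ⟨c, hc⟩ := Submodule.mem_span_singleton.1 hx
      ext y
      have hy : jtrace q y.1 = 0 := y.2
      simp only [LinearMap.compl₁₂_apply, ← hc]
      simp [jform, jmul_comm hq (jone hq), jmul_one hq (two_ne_zero_of_charP_three k), hy])
    (by
      intro x hx
      obtain ⟨c, hc⟩ := Submodule.mem_span_singleton.1 hx
      ext y
      have hy : jtrace q y.1 = 0 := y.2
      simp only [LinearMap.flip_apply, LinearMap.compl₁₂_apply, ← hc]
      simp [jform, jmul_one hq (two_ne_zero_of_charP_three k), hy])

/-- `(x̂,ŷ) ↦ [L_x, L_y]`, for `x, y ∈ J_0`. -/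
def tlie {q : QuadraticForm k C} (hq : IsHurwitz q) : TJ hq →ₗ[k] TJ hq →ₗ[k] stab hq :=
  LinearMap.liftQ₂ (jscalar hq) (jscalar hq)
    ((jlie hq).compl₁₂ (jzero q).subtype (jzero q).subtype)
    (by
      intro x hx
      obtain ⟨c, hc⟩ := Submodule.mem_span_singleton.1 hx
      refine LinearMap.ext fun y => ?_
      simp only [LinearMap.compl₁₂_apply, ← hc]
      simp [(jlie_one hq _).2])
    (by
      intro x hx
      obtain ⟨c, hc⟩ := Submodule.mem_span_singleton.1 hx
      refine LinearMap.ext fun y => ?_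
      simp only [LinearMap.flip_apply, LinearMap.compl₁₂_apply, ← hc]
      simp [(jlie_one hq _).1])

/-- The triple product `[x̂ŷẑ]`, the class of `[L_x, L_y](z)`, on `T_J`. -/
def ttriple {q : QuadraticForm k C} (hq : IsHurwitz q) :
    TJ hq →ₗ[k] TJ hq →ₗ[k] Module.End k (TJ hq) :=
  (tlie hq).compr₂ (stabAct hq)

end CharThree

end Hurwitz

/-- Orthogonal triple systems: `B` is the bilinear form, and `T x y z` the triple
product `[xyz]`. -/
structure IsOrthogonalTripleSystem {k M : Type*} [Field k] [AddCommGroup M] [Module k M]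
    (B : LinearMap.BilinForm k M) (T : M →ₗ[k] M →ₗ[k] Module.End k M) : Prop where
  ne_zero : B ≠ 0
  symm : ∀ x y, B x y = B y x
  alt : ∀ x, T x x = 0
  right : ∀ x y, T x y y = B x y • y - B y y • x
  deriv : ∀ x y u v w, T x y (T u v w) = T (T x y u) v w + T u (T x y v) w + T u v (T x y w)
  skew : ∀ x y u v, B (T x y u) v + B u (T x y v) = 0

/-! ## The Lie superalgebra `g(J) = (sp(V) ⊕ der J) ⊕ (V ⊗ T_J)` -/

namespace GJ

variable {k V C : Type*} [Field k] [CharP k 3] [AddCommGroup V] [Module k V] [NonAssocRing C]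
  [Module k C] [IsScalarTower k C C] [SMulCommClass k C C] {q : QuadraticForm k C}

/-- The derivations of `J`. -/
def der (hq : IsHurwitz q) : Submodule k (Module.End k (Herm q)) where
  carrier := {d | ∀ x y, d (jmul hq x y) = jmul hq (d x) y + jmul hq x (d y)}
  zero_mem' := by intro x y; simp
  add_mem' := by
    intro d d' h h' x y
    simp only [LinearMap.add_apply, map_add, h x y, h' x y]; abel
  smul_mem' := by
    intro c d h x y
    simp only [LinearMap.smul_apply, map_smul, h x y, smul_add]

/-- The ambient space of `g(J)`: all triples `(f, d, ξ)` with `f ∈ gl(V)`, `d` a linear map of `J`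
that acts on `T_J`, and `ξ ∈ V ⊗ T_J`. -/
abbrev Space (V : Type*) [AddCommGroup V] [Module k V] (hq : IsHurwitz q) : Type _ :=
  Module.End k V × stab hq × (V ⊗[k] TJ hq)

/-- The action of `(f, d)` on `V ⊗ T_J`. -/
def act (hq : IsHurwitz q) : Space V hq →ₗ[k] Module.End k (V ⊗[k] TJ hq) :=
  (LinearMap.rTensorHom (TJ hq)).comp (LinearMap.fst k _ _)
    + ((LinearMap.lTensorHom V).comp (stabAct hq)).comp
      ((LinearMap.fst k _ _).comp (LinearMap.snd k _ _))

/-- `(u ⊗ x, v ⊗ y) ↦ (x|y) γ_{u,v}`. -/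
def gammaPart (ω : LinearMap.BilinForm k V) (hq : IsHurwitz q) :
    V ⊗[k] TJ hq →ₗ[k] V ⊗[k] TJ hq →ₗ[k] Module.End k V :=
  (TensorProduct.map₂ (gammaV ω) (tform hq)).compr₂
    (TensorProduct.rid k (Module.End k V)).toLinearMap

/-- `(u ⊗ x̂, v ⊗ ŷ) ↦ ⟨u|v⟩ [L_x, L_y]`. -/
def liePart (ω : LinearMap.BilinForm k V) (hq : IsHurwitz q) :
    V ⊗[k] TJ hq →ₗ[k] V ⊗[k] TJ hq →ₗ[k] stab hq :=
  (TensorProduct.map₂ ω (tlie hq)).compr₂ (TensorProduct.lid k (stab hq)).toLinearMap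

/-- The bracket of `g(J)`. -/
def bracket (ω : LinearMap.BilinForm k V) (hq : IsHurwitz q) :
    Space V hq →ₗ[k] Space V hq →ₗ[k] Space V hq :=
  LinearMap.mk₂ k (fun X Y =>
    (X.1 * Y.1 - Y.1 * X.1 - gammaPart ω hq X.2.2 Y.2.2,
     X.2.1 * Y.2.1 - Y.2.1 * X.2.1 + liePart ω hq X.2.2 Y.2.2,
     act hq X Y.2.2 - act hq Y X.2.2))
    (by
      intro X X' Y
      refine Prod.ext ?_ (Prod.ext ?_ ?_)
      all_goals simp [add_mul, mul_add]; abel)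
    (by
      intro c X Y
      refine Prod.ext ?_ (Prod.ext ?_ ?_)
      all_goals simp [smul_sub])
    (by
      intro X Y Y'
      refine Prod.ext ?_ (Prod.ext ?_ ?_)
      all_goals simp [add_mul, mul_add]; abel)
    (by
      intro c X Y
      refine Prod.ext ?_ (Prod.ext ?_ ?_)
      all_goals simp [smul_sub])

/-- The even part `sp(V) ⊕ der J` and the odd part `V ⊗ T_J` of `g(J)`. -/
def part (ω : LinearMap.BilinForm k V) (hq : IsHurwitz q) (i : ZMod 2) :
    Submodule k (Space V hq) :=
  if i = 0 then (spV ω).prod (((der hq).comap (stab hq).val.toLinearMap).prod ⊥)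
  else (⊥ : Submodule k (Module.End k V)).prod ((⊥ : Submodule k (stab hq)).prod ⊤)

end GJ

/-! ## The map `Ψ` -/

section Psi

variable {k V C : Type*} [Field k] [CharP k 3] [AddCommGroup V] [Module k V] [NonAssocRing C]
  [Module k C] [IsScalarTower k C C] [SMulCommClass k C C] {q : QuadraticForm k C}

theorem jtrace_jiota (hq : IsHurwitz q) (n : Fin 3) (a : C) : jtrace q (jiota hq n a) = 0 := by
  fin_cases n <;> simp [jtrace, jiota, Fin.sum_univ_three, Matrix.single]

theorem jtrace_je_sub (hq : IsHurwitz q) : jtrace q (je hq 0 - je hq 1) = 0 := by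
  simp [jtrace, je, Fin.sum_univ_three, Matrix.single]

/-- The linear map `D_{(d_0,d_1,d_2)}` of `J`, with `e_i ↦ 0` and `ι_i(a) ↦ ι_i(d_i(a))`; the
coordinate `a_i` of `x ∈ J` in `ι_i(S)` is half the entry of `x` in position `(i+2,i+1)`. -/
def Dtri (hq : IsHurwitz q) (d : Fin 3 → Module.End k C) : Module.End k (Herm q) :=
  ∑ n, (jiota hq n).comp ((d n).comp ((2⁻¹ : k) •
    (Matrix.entryLinearMap k C (n + 2) (n + 1)).comp Herm.val))

theorem Dtri_mem_stab (hq : IsHurwitz q) (d : Fin 3 → Module.End k C) :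
    Dtri hq d ∈ stab hq := by
  refine ⟨fun x _ => ?_, ?_⟩
  · rw [jzero, LinearMap.mem_ker]
    simp [Dtri, jtrace_jiota]
  · have : Dtri hq d (jone hq) = 0 := by
      simp [Dtri, jone_val]
    rw [this]
    exact Submodule.zero_mem _

/-- The inner derivation `D_i(a) = 2[L_{ι_i(a)}, L_{e_{i+1}}]`. -/
def Di (hq : IsHurwitz q) (n : Fin 3) (a : C) : stab hq :=
  (2 : k) • jlie hq (jiota hq n a) (je hq (n + 1))

/-- `ι̂_i(a)`, the class of `ι_i(a)` in `T_J`. -/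
def tiota (hq : IsHurwitz q) (n : Fin 3) (a : C) : TJ hq :=
  (jscalar hq).mkQ ⟨jiota hq n a, jtrace_jiota hq n a⟩

/-- `ι̂(1)`, the class of `e_0 - e_1` in `T_J`. -/
def tone (hq : IsHurwitz q) : TJ hq :=
  (jscalar hq).mkQ ⟨je hq 0 - je hq 1, jtrace_je_sub hq⟩

/-- The formulas that define `Ψ : g(S_{1,2},S) → g(J)`. The elements of `g(S_{1,2},S)` on the left
are, in this order: `f ∈ sp(V) ≃ tri(S_{1,2})_0`, acting by `0` on `1`; `(d_0,d_1,d_2) ∈ tri(S)`;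
`ι_i(1 ⊗ a)`; `u ∈ V ≃ tri(S_{1,2})_1`, acting by `σ_{1,u}`; and `ι_i(u ⊗ s)`. -/
structure IsPsi (ω : LinearMap.BilinForm k V) (hq : IsHurwitz q)
    (Ψ : ↥(Magic.part (superS ω) (paraC q) 0 ⊔ Magic.part (superS ω) (paraC q) 1) →ₗ[k]
      ↥(GJ.part ω hq 0 ⊔ GJ.part ω hq 1)) : Prop where
  sp : ∀ f ∈ spV ω, ∃ h, (Ψ ⟨(fun _ => LinearMap.prodMap 0 f, 0, 0), h⟩ : GJ.Space V hq)
    = (f, 0, 0)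
  tri : ∀ d ∈ (paraC q).tri 0, ∃ h, (Ψ ⟨(0, d, 0), h⟩ : GJ.Space V hq)
    = (0, ⟨Dtri hq d, Dtri_mem_stab hq d⟩, 0)
  iota_one : ∀ n a, ∃ h, (Ψ ⟨(0, 0, Pi.single n ((1, 0) ⊗ₜ a)), h⟩ : GJ.Space V hq)
    = (0, Di hq n a, 0)
  odd : ∀ u, ∃ h, (Ψ ⟨(fun _ => (superS ω).sigma (1, 0) (0, u), 0, 0), h⟩ : GJ.Space V hq)
    = (0, 0, u ⊗ₜ tone hq)
  iota_odd : ∀ n u s, ∃ h, (Ψ ⟨(0, 0, Pi.single n ((0, u) ⊗ₜ s)), h⟩ : GJ.Space V hq)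
    = (0, 0, u ⊗ₜ tiota hq n s)

end Psi

set_option linter.unusedSimpArgs false

/-! ## Para-Hurwitz algebras -/

section ParaHurwitz

open QuadraticMap

variable {k C : Type*} [Field k] [NonAssocRing C] [Module k C] [IsScalarTower k C C]
  [SMulCommClass k C C] {q : QuadraticForm k C}

/-! The map Ψ is the restriction of one explicit linear map `psiLin` between the ambient spaces,
which is shown to send g(S_{1,2},S) bijectively onto g(J) and to preserve products. The Jacobi
identity is verified only in g(J), where it follows from the axioms of the triple system T. It is
then pulled back along Ψ (`IsSuperEmbedding.isLieSuperalgebra`), so nothing about g(S_{1,2},S) being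
a Lie superalgebra is needed beforehand.

An element of J has three diagonal coordinates in k and three coordinates in C. Since 2 = 1/2 = -1
in characteristic 3, the Jordan product in these coordinates involves only the form and the product
of S (`jdiag_jmul`, `jcoord_jmul`). Statements about J thereby become instances of b(x•y,z) =
b(x,y•z) and of the linearised identities (x•y)•x = q(x)y = x•(y•x). In this way D_i(a) is a
derivation (`Di_mem_der`), [L_{ι_i(a)},L_{ι_i(b)}] is the derivation attached to θ^i(t_{a,b})
(`jlie_jiota_jiota`), and [L_{ι_i(a)},L_{ι_{i+1}(b)}] = D_{i+2}(a•b) (`jlie_jiota_jiota_succ`).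
Subtracting suitable D_i(a_i) from a derivation makes it kill every e_i, and then it comes from a
triality triple. Hence der J is the sum of tri(S) and of the D_i(S) (`der_decomposition`), and this
sum is direct and acts faithfully on T (`eq_zero_of_stabAct`).

The quotient T has a basis-like decomposition into the class of e_0-e_1 and the classes of the
ι_i(S); in characteristic 3 the differences e_i-e_{i+1} all have the same class. The identity for
[xyy] is a coordinate computation (`ttriple_right`), and the remaining axioms hold because [L_x,L_y]
is a derivation and derivations have trace zero. The Jacobi identity for three odd elements of g(J)
combines the linearised [xyy] identity with ⟨u|v⟩w + ⟨v|w⟩u + ⟨w|u⟩v = 0, valid in a plane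
(`oddTriple_cyclic`).

On the other side, characteristic 3 forces every triality triple of S_{1,2} to have three equal
components: they are sp(V) in even degree and the maps σ_{1,u} in odd degree (`mem_superS_tri_zero`,
`mem_superS_tri_one`). So g(S_{1,2},S) is spanned by five families of generators
(`Magic.part_eq_span`), whose images are sp(V), the two pieces of der J and the two pieces of V ⊗ T.
Products are compared on pairs of generators (`Magic.compat_gen`), and the same spanning set gives
the uniqueness of Ψ. -/

theorem paraC_mul_apply (q : QuadraticForm k C) (x y : C) :
    (paraC q).mul x y = cconj q x * cconj q y := rfl

theorem paraC_form_apply (q : QuadraticForm k C) (x y : C) :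
    (paraC q).form x y = polar q x y := rfl

theorem paraC_form_comm (q : QuadraticForm k C) (x y : C) :
    (paraC q).form x y = (paraC q).form y x := polar_comm q x y

theorem paraC_pr_zero (q : QuadraticForm k C) : (paraC q).pr 0 = LinearMap.id := rfl

theorem paraC_pr_one (q : QuadraticForm k C) : (paraC q).pr 1 = 0 := rfl

/-! ### Identities of symmetric composition algebras -/

namespace IsHurwitz

theorem polar_right (hq : IsHurwitz q) (x y z : C) :
    polar q (y * x) (z * x) = polar q y z * q x := by
  simp only [polar, ← add_mul, hq.map_mul]; ring

theorem eq_of_polar (hq : IsHurwitz q) {x y : C} (h : ∀ z, polar q x z = polar q y z) : x = y := by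
  rw [← sub_eq_zero]
  apply hq.regular.1
  intro z
  rw [polarBilin_apply_apply, polar_sub_left, h, sub_self]

/-- Multiplication by the conjugate is adjoint to multiplication by the element, and multiplication
by x scales the polar form by q(x); nondegeneracy does the rest. -/
theorem conj_mul_mul (hq : IsHurwitz q) (x y : C) : cconj q x * (x * y) = q x • y := by
  refine hq.eq_of_polar fun z => ?_
  rw [hq.polar_mul_left, hq.conj_conj, hq.polar_left, polar_smul_left, smul_eq_mul]

theorem mul_mul_conj (hq : IsHurwitz q) (x y : C) : (y * x) * cconj q x = q x • y := by
  refine hq.eq_of_polar fun z => ?_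
  rw [hq.polar_mul_right, hq.conj_conj, hq.polar_right, polar_smul_left, smul_eq_mul, mul_comm]

/-- Unfolding the bars gives (yx)x̄. Together with its mirror image, this is the defining identity
of a symmetric composition algebra, and the algebra of C is used later mostly through the
linearisations below. -/
theorem para_mul_mul_self (hq : IsHurwitz q) (x y : C) :
    (paraC q).mul ((paraC q).mul x y) x = q x • y := by
  rw [paraC_mul_apply, paraC_mul_apply, hq.conj_mul, hq.conj_conj, hq.conj_conj, hq.mul_mul_conj]

theorem para_mul_self_mul (hq : IsHurwitz q) (x y : C) :
    (paraC q).mul x ((paraC q).mul y x) = q x • y := by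
  rw [paraC_mul_apply, paraC_mul_apply, hq.conj_mul, hq.conj_conj, hq.conj_conj, hq.conj_mul_mul]

/-- Polarisation in x of (x•y)•x = q(x)y. -/
theorem para_left (hq : IsHurwitz q) (x y z : C) :
    (paraC q).mul ((paraC q).mul x y) z + (paraC q).mul ((paraC q).mul z y) x
      = (paraC q).form x z • y := by
  have h := hq.para_mul_mul_self (x + z) y
  have hx := hq.para_mul_mul_self x y
  have hz := hq.para_mul_mul_self z y
  simp only [map_add, LinearMap.add_apply] at h
  rw [paraC_form_apply, polar, sub_smul, sub_smul, ← h, ← hx, ← hz]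
  abel

theorem para_right (hq : IsHurwitz q) (x y z : C) :
    (paraC q).mul x ((paraC q).mul y z) + (paraC q).mul z ((paraC q).mul y x)
      = (paraC q).form x z • y := by
  have h := hq.para_mul_self_mul (x + z) y
  have hx := hq.para_mul_self_mul x y
  have hz := hq.para_mul_self_mul z y
  simp only [map_add, LinearMap.add_apply] at h
  rw [paraC_form_apply, polar, sub_smul, sub_smul, ← h, ← hx, ← hz]
  abel

theorem para_assoc (hq : IsHurwitz q) (x y z : C) :
    (paraC q).form ((paraC q).mul x y) z = (paraC q).form x ((paraC q).mul y z) := by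
  simp only [paraC_mul_apply, paraC_form_apply]
  rw [hq.polar_mul_right, hq.conj_conj, polar_conj, hq.conj_mul]

theorem para_assoc' (hq : IsHurwitz q) (x y z : C) :
    (paraC q).form x ((paraC q).mul y z) = (paraC q).form y ((paraC q).mul z x) := by
  rw [paraC_form_comm, hq.para_assoc]

theorem para_four (hq : IsHurwitz q) (x y z w : C) :
    (paraC q).form ((paraC q).mul x y) ((paraC q).mul z w)
      + (paraC q).form ((paraC q).mul x w) ((paraC q).mul z y)
      = (paraC q).form x z * (paraC q).form y w := by
  simp only [paraC_mul_apply, paraC_form_apply]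
  rw [hq.polar_four, polar_conj, polar_conj, hq.conj_conj, hq.conj_conj]

theorem eq_of_form (hq : IsHurwitz q) {x y : C}
    (h : ∀ z, (paraC q).form x z = (paraC q).form y z) : x = y :=
  hq.eq_of_polar h

end IsHurwitz

/-! ### Triality triples of a para-Hurwitz algebra -/

theorem paraC_part_zero (q : QuadraticForm k C) : (paraC q).part 0 = ⊤ := by
  rw [Superspace.part, paraC_pr_zero, LinearMap.range_id]

theorem paraC_part_one (q : QuadraticForm k C) : (paraC q).part 1 = ⊥ := by
  rw [Superspace.part, paraC_pr_one, LinearMap.range_zero]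

theorem zmod_two_cases (i : ZMod 2) : i = 0 ∨ i = 1 := by revert i; decide

theorem koszul_zero_left (j : ZMod 2) : koszul k 0 j = 1 := by simp [koszul]

theorem koszul_zero_right (j : ZMod 2) : koszul k j 0 = 1 := by simp [koszul]

theorem koszul_one_one : koszul k 1 1 = -1 := by simp [koszul, ZMod.val_one]

theorem sum_zmod_two {M : Type*} [AddCommMonoid M] (f : ZMod 2 → M) :
    ∑ i, f i = f 0 + f 1 := Fin.sum_univ_two f

theorem paraC_mem_osp_zero (f : Module.End k C) :
    f ∈ (paraC q).osp 0 ↔ ∀ x y, (paraC q).form (f x) y + (paraC q).form x (f y) = 0 := by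
  constructor
  · intro h x y
    have := h.2 0 x (by simp [paraC_part_zero]) y
    rwa [koszul_zero_left, one_mul] at this
  · intro h
    refine ⟨fun p x hx => ?_, fun p x hx y => ?_⟩
    · rcases zmod_two_cases p with rfl | rfl
      · rw [add_zero, paraC_part_zero]; trivial
      · rw [paraC_part_one, Submodule.mem_bot] at hx
        simp [hx]
    · rw [koszul_zero_left, one_mul, h]

theorem paraC_mem_tri_zero (d : Fin 3 → Module.End k C) :
    d ∈ (paraC q).tri 0 ↔
      (∀ n x y, (paraC q).form (d n x) y + (paraC q).form x (d n y) = 0) ∧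
      ∀ x y, d 0 ((paraC q).mul x y) = (paraC q).mul (d 1 x) y + (paraC q).mul x (d 2 y) := by
  constructor
  · intro h
    refine ⟨fun n => (paraC_mem_osp_zero _).1 (h.1 n), fun x y => ?_⟩
    have := h.2 0 x (by simp [paraC_part_zero]) y
    rwa [koszul_zero_left, one_smul] at this
  · intro h
    refine ⟨fun n => (paraC_mem_osp_zero _).2 (h.1 n), fun p x _ y => ?_⟩
    rw [koszul_zero_left, one_smul, h.2]

/-- An odd map sends the even part, here everything, into the odd part, here zero. -/
theorem paraC_tri_one : (paraC q).tri 1 = ⊥ := by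
  rw [eq_bot_iff]
  intro d hd
  rw [Submodule.mem_bot]
  ext n x
  have := (hd.1 n).1 0 x (by simp [paraC_part_zero])
  rwa [add_zero, paraC_part_one, Submodule.mem_bot] at this

/-- Triality triples satisfy the triality relation for all cyclic permutations. -/
theorem IsHurwitz.tri_cyclic (hq : IsHurwitz q) {d : Fin 3 → Module.End k C}
    (hd : d ∈ (paraC q).tri 0) (n : Fin 3) (x y : C) :
    d n ((paraC q).mul x y) = (paraC q).mul (d (n + 1) x) y + (paraC q).mul x (d (n + 2) y) := by
  rw [paraC_mem_tri_zero] at hd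
  obtain ⟨hs, ht⟩ := hd
  -- One cyclic shift: the relation for (a,b,c) is applied to z•x and paired with y; skewness and
  -- associativity of the form then move every term to the form of the relation for (b,c,a) paired
  -- with z.
  have step : ∀ a b c : Fin 3,
      (∀ x y, d a ((paraC q).mul x y) = (paraC q).mul (d b x) y + (paraC q).mul x (d c y)) →
      ∀ x y, d b ((paraC q).mul x y) = (paraC q).mul (d c x) y + (paraC q).mul x (d a y) := by
    intro a b c h x y
    refine hq.eq_of_form fun z => ?_
    have h1 := hs b ((paraC q).mul x y) z
    have e3 := congrArg (fun w => (paraC q).form w y) (h z x)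
    have e4 := hs a ((paraC q).mul z x) y
    have e5 : (paraC q).form ((paraC q).mul (d b z) x) y
        = (paraC q).form ((paraC q).mul x y) (d b z) := by
      rw [hq.para_assoc, paraC_form_comm]
    have e6 : (paraC q).form ((paraC q).mul z (d c x)) y
        = (paraC q).form ((paraC q).mul (d c x) y) z := by
      rw [hq.para_assoc, paraC_form_comm]
    have e7 : (paraC q).form ((paraC q).mul z x) (d a y)
        = (paraC q).form ((paraC q).mul x (d a y)) z := by
      rw [hq.para_assoc, paraC_form_comm]
    simp only [map_add, LinearMap.add_apply] at e3 ⊢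
    linear_combination h1 + e5 + e3 - e4 + e6 + e7
  have h0 := ht
  have h1 := step 0 1 2 h0
  have h2 := step 1 2 0 h1
  fin_cases n
  · exact h0 x y
  · exact h1 x y
  · exact h2 x y

/-! ### The triples t_{x,y} -/

theorem paraC_lmul_apply (x y : C) : (paraC q).lmul x y = (paraC q).mul x y := rfl

theorem paraC_rmul_apply (x y : C) : (paraC q).rmul x y = (paraC q).mul y x := by
  rw [FormedSuperalgebra.rmul_apply]
  simp [sum_zmod_two, koszul_zero_left, paraC_pr_zero, paraC_pr_one]

theorem paraC_sigma_apply (x y z : C) :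
    (paraC q).sigma x y z = (paraC q).form x z • y - (paraC q).form y z • x := by
  rw [FormedSuperalgebra.sigma_apply]
  simp [sum_zmod_two, koszul_zero_left, paraC_pr_zero, paraC_pr_one]

theorem paraC_t_zero (x y z : C) :
    (paraC q).t x y 0 z = (paraC q).form x z • y - (paraC q).form y z • x :=
  paraC_sigma_apply x y z

theorem paraC_t_one (x y z : C) :
    (paraC q).t x y 1 z
      = (2⁻¹ * (paraC q).form x y) • z - (paraC q).mul ((paraC q).mul y z) x := by
  simp [FormedSuperalgebra.t, paraC_rmul_apply, paraC_lmul_apply]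

theorem paraC_t_two (x y z : C) :
    (paraC q).t x y 2 z
      = (2⁻¹ * (paraC q).form x y) • z - (paraC q).mul x ((paraC q).mul z y) := by
  simp [FormedSuperalgebra.t, paraC_rmul_apply, paraC_lmul_apply]

/-- Skewness of the last two components amounts to the linearised multiplicativity of q, the
constant ½b(x,y) being exactly the symmetric part that must be removed. The triality relation is a
combination of linearised composition identities. -/
theorem IsHurwitz.t_mem_tri (hq : IsHurwitz q) (h2 : (2 : k) ≠ 0) (x y : C) :
    (paraC q).t x y ∈ (paraC q).tri 0 := by
  rw [paraC_mem_tri_zero]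
  refine ⟨fun n z w => ?_, fun z w => ?_⟩
  · fin_cases n
    · change (paraC q).form ((paraC q).t x y 0 z) w + (paraC q).form z ((paraC q).t x y 0 w) = 0
      simp only [paraC_t_zero, map_sub, map_smul, LinearMap.sub_apply, LinearMap.smul_apply,
        smul_eq_mul]
      rw [paraC_form_comm q z x, paraC_form_comm q z y]
      ring
    · change (paraC q).form ((paraC q).t x y 1 z) w + (paraC q).form z ((paraC q).t x y 1 w) = 0
      simp only [paraC_t_one, map_sub, map_smul, LinearMap.sub_apply, LinearMap.smul_apply,
        smul_eq_mul]
      have e1 := hq.para_assoc ((paraC q).mul y z) x w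
      have e2 := hq.para_assoc' z ((paraC q).mul y w) x
      have e3 := hq.para_four y z x w
      have e4 : 2⁻¹ * (2 : k) = 1 := inv_mul_cancel₀ h2
      have e5 := paraC_form_comm q x y
      have e6 := hq.para_four y w x z
      rw [paraC_form_comm q ((paraC q).mul y w)] at e2
      rw [paraC_form_comm q ((paraC q).mul x z)] at e2
      linear_combination - e1 - e2 - e3 + (paraC q).form x y * (paraC q).form z w * e4
        + (paraC q).form z w * e5
    · change (paraC q).form ((paraC q).t x y 2 z) w + (paraC q).form z ((paraC q).t x y 2 w) = 0
      simp only [paraC_t_two, map_sub, map_smul, LinearMap.sub_apply, LinearMap.smul_apply,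
        smul_eq_mul]
      have e1 := (hq.para_assoc x ((paraC q).mul z y) w).trans (hq.para_assoc' _ _ _)
      have e2 := hq.para_assoc z x ((paraC q).mul w y)
      have e3 := hq.para_four z y w x
      have e4 : 2⁻¹ * (2 : k) = 1 := inv_mul_cancel₀ h2
      have e5 := paraC_form_comm q x y
      linear_combination - e1 + e2 - e3 + (paraC q).form x y * (paraC q).form z w * e4
        + (paraC q).form z w * e5
  · rw [paraC_t_zero, paraC_t_one, paraC_t_two]
    -- The cross terms (w•x)•(y•z) and z•(y•(w•x)) cancel in the first identity minus the second
    -- plus z• the third, leaving ((y•z)•x)•w + z•(x•(w•y)), which is what the last two components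
    -- contribute.
    have e1 := hq.para_left ((paraC q).mul y z) x w
    have e2 := hq.para_right ((paraC q).mul w x) y z
    have e3 := hq.para_right y w x
    have e4 : 2⁻¹ * (2 : k) = 1 := inv_mul_cancel₀ h2
    have e5 := congrArg ((paraC q).mul z) e3
    have e6 : (paraC q).form ((paraC q).mul w x) z = (paraC q).form x ((paraC q).mul z w) :=
      (hq.para_assoc _ _ _).trans (hq.para_assoc' _ _ _)
    have e7 : (paraC q).form ((paraC q).mul y z) w = (paraC q).form y ((paraC q).mul z w) :=
      hq.para_assoc _ _ _
    simp only [map_sub, map_smul, map_add, LinearMap.sub_apply, LinearMap.smul_apply, e6, e7,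
      paraC_form_comm q y x] at e1 e2 e3 e5 ⊢
    have e8 : (2⁻¹ * (paraC q).form x y) • (paraC q).mul z w
        + (2⁻¹ * (paraC q).form x y) • (paraC q).mul z w
        = (paraC q).form x y • (paraC q).mul z w := by
      rw [← add_smul]; congr 1; linear_combination (paraC q).form x y * e4
    linear_combination (norm := module) e1 - e2 + e5 - e8

end ParaHurwitz


/-! ## Coordinates on `H_3(C,*)` in characteristic `3` -/

section Coordinates

open QuadraticMap

theorem fin_three_add (n : Fin 3) :
    n + 1 + 1 = n + 2 ∧ n + 1 + 2 = n ∧ n + 2 + 1 = n ∧ n + 2 + 2 = n + 1 := by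
  revert n; decide

theorem fin_three_ne (n : Fin 3) :
    n ≠ n + 1 ∧ n ≠ n + 2 ∧ n + 1 ≠ n ∧ n + 2 ≠ n ∧ n + 1 ≠ n + 2 ∧ n + 2 ≠ n + 1 := by
  revert n; decide

theorem fin_three_cases (n i : Fin 3) : i = n ∨ i = n + 1 ∨ i = n + 2 := by
  revert n i; decide

theorem Fin.sum_three_cyclic {M : Type*} [AddCommMonoid M] (n : Fin 3) (f : Fin 3 → M) :
    ∑ i, f i = f n + f (n + 1) + f (n + 2) := by
  rw [Fin.sum_univ_three]
  fin_cases n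
  · rfl
  · change f 0 + f 1 + f 2 = f 1 + f 2 + f 0
    abel
  · change f 0 + f 1 + f 2 = f 2 + f 0 + f 1
    abel

section Scalars

variable (k : Type*) [Field k] [CharP k 3]

theorem three_eq_zero_of_charP_three : (3 : k) = 0 := by
  have h3 : ((3 : ℕ) : k) = 0 := CharP.cast_eq_zero k 3
  exact_mod_cast h3

theorem two_eq_neg_one_of_charP_three : (2 : k) = -1 := by
  linear_combination three_eq_zero_of_charP_three k

theorem inv_two_eq_neg_one_of_charP_three : (2⁻¹ : k) = -1 := by
  rw [two_eq_neg_one_of_charP_three, inv_neg, inv_one]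

end Scalars

variable {k C : Type*} [Field k] [CharP k 3] [NonAssocRing C] [Module k C] [IsScalarTower k C C]
  [SMulCommClass k C C] {q : QuadraticForm k C}

theorem three_smul_eq_zero {M : Type*} [AddCommGroup M] [Module k M] (x : M) :
    (3 : k) • x = 0 := by
  rw [three_eq_zero_of_charP_three, zero_smul]

/-- The coefficient of `e_n`. -/
def jdiag (q : QuadraticForm k C) (n : Fin 3) : Herm q →ₗ[k] k :=
  (2⁻¹ : k) • (q.polarBilin.flip 1).comp ((Matrix.entryLinearMap k C n n).comp Herm.val)

/-- The coordinate in `ι_n(C)`. -/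
def jcoord (q : QuadraticForm k C) (n : Fin 3) : Herm q →ₗ[k] C :=
  (2⁻¹ : k) • (Matrix.entryLinearMap k C (n + 2) (n + 1)).comp Herm.val

theorem jdiag_apply (n : Fin 3) (x : Herm q) :
    jdiag q n x = - polar q (x.val n n) 1 := by
  simp [jdiag, inv_two_eq_neg_one_of_charP_three]

theorem jcoord_apply (n : Fin 3) (x : Herm q) : jcoord q n x = - x.val (n + 2) (n + 1) := by
  simp [jcoord, inv_two_eq_neg_one_of_charP_three]

/-- A diagonal entry is fixed by the involution, so twice it equals b(·,1)1; as 2 = -1, it is a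
scalar multiple of 1. -/
theorem val_diag (x : Herm q) (n : Fin 3) : x.val n n = jdiag q n x • (1 : C) := by
  have h := x.val_apply n n
  rw [cconj_apply] at h
  rw [jdiag_apply]
  have h3 := three_smul_eq_zero (k := k) (x.val n n)
  linear_combination (norm := module) h3 - h

/-- The sign comes from the factor 2 = -1 in ι_n(a). -/
theorem val_lower (x : Herm q) (n : Fin 3) : x.val (n + 2) (n + 1) = - jcoord q n x := by
  rw [jcoord_apply, neg_neg]

theorem val_upper (x : Herm q) (n : Fin 3) :
    x.val (n + 1) (n + 2) = - cconj q (jcoord q n x) := by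
  rw [x.val_apply, val_lower, map_neg]

theorem herm_ext {x y : Herm q} (h : ∀ n, jdiag q n x = jdiag q n y)
    (h' : ∀ n, jcoord q n x = jcoord q n y) : x = y := by
  ext i j
  rcases fin_three_cases i j with rfl | rfl | rfl
  · rw [val_diag, val_diag, h]
  · have e := val_upper x (i + 2)
    have e' := val_upper y (i + 2)
    rw [(fin_three_add i).2.2.1, (fin_three_add i).2.2.2] at e e'
    rw [e, e', h']
  · have e := val_lower x (i + 1)
    have e' := val_lower y (i + 1)
    rw [(fin_three_add i).2.1, (fin_three_add i).1] at e e'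
    rw [e, e', h']

/-- Computations with D_n and ι_n are uniform in n only when the indices are listed as n, n+1, n+2;
this criterion avoids splitting into three numerical cases. -/
theorem herm_ext_cyclic (n : Fin 3) {x y : Herm q} (h0 : jdiag q n x = jdiag q n y)
    (h1 : jdiag q (n + 1) x = jdiag q (n + 1) y) (h2 : jdiag q (n + 2) x = jdiag q (n + 2) y)
    (h0' : jcoord q n x = jcoord q n y) (h1' : jcoord q (n + 1) x = jcoord q (n + 1) y)
    (h2' : jcoord q (n + 2) x = jcoord q (n + 2) y) : x = y := by
  refine herm_ext (fun i => ?_) fun i => ?_ <;> rcases fin_three_cases n i with rfl | rfl | rfl <;>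
    assumption

/-- Together with `jcoord_jmul` this is the Peirce multiplication of J. The matrix product
contributes conjugates that combine into the form and the para-Hurwitz product, so matrices are not
needed in the computations that follow. -/
theorem jdiag_jmul (hq : IsHurwitz q) (n : Fin 3) (x y : Herm q) :
    jdiag q n (jmul hq x y) = jdiag q n x * jdiag q n y
      - ((paraC q).form (jcoord q (n + 1) x) (jcoord q (n + 1) y)
        + (paraC q).form (jcoord q (n + 2) x) (jcoord q (n + 2) y)) := by
  have key : ∀ u v : C, polar q (u * cconj q v) 1 = polar q u v := fun u v => by
    rw [hq.polar_mul_right, one_mul, hq.conj_conj]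
  have key' : ∀ u v : C, polar q (cconj q u * v) 1 = polar q u v := fun u v => by
    rw [hq.trace_comm, key, polar_comm]
  have hu := fun z : Herm q => val_upper z (n + 2)
  have hl := fun z : Herm q => val_lower z (n + 2)
  have hu' := fun z : Herm q => val_upper z (n + 1)
  have hl' := fun z : Herm q => val_lower z (n + 1)
  simp only [(fin_three_add n).1, (fin_three_add n).2.1, (fin_three_add n).2.2.1,
    (fin_three_add n).2.2.2] at hu hl hu' hl'
  rw [jdiag_apply, jmul_val, inv_two_eq_neg_one_of_charP_three]
  simp only [Matrix.smul_apply, Matrix.add_apply, Matrix.mul_apply, Fin.sum_three_cyclic n,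
    hu, hl, hu', hl', val_diag, paraC_form_apply, polar_smul_left, polar_add_left, smul_eq_mul,
    neg_mul_neg, key, key', smul_mul_smul_comm, mul_one, hq.polar_one_one]
  rw [polar_comm q (jcoord q (n + 1) y), polar_comm q (jcoord q (n + 2) y)]
  -- Each term appears with coefficient ±2 where ±1 is wanted with the opposite sign, so the
  -- discrepancy is a multiple of 3.
  linear_combination (jdiag q n x * jdiag q n y +
    polar q (jcoord q (n + 1) x) (jcoord q (n + 1) y) + 
    polar q (jcoord q (n + 2) x) (jcoord q (n + 2) y)) * three_eq_zero_of_charP_three k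

theorem jcoord_jmul (hq : IsHurwitz q) (n : Fin 3) (x y : Herm q) :
    jcoord q n (jmul hq x y) =
      (paraC q).mul (jcoord q (n + 1) x) (jcoord q (n + 2) y)
      + (paraC q).mul (jcoord q (n + 1) y) (jcoord q (n + 2) x)
      - (jdiag q (n + 1) x + jdiag q (n + 2) x) • jcoord q n y
      - (jdiag q (n + 1) y + jdiag q (n + 2) y) • jcoord q n x := by
  have hu := fun z : Herm q => val_upper z (n + 2)
  have hl := fun z : Herm q => val_lower z n
  have hu' := fun z : Herm q => val_upper z (n + 1)
  simp only [(fin_three_add n).1, (fin_three_add n).2.1, (fin_three_add n).2.2.1,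
    (fin_three_add n).2.2.2] at hu hl hu'
  rw [jcoord_apply, jmul_val, inv_two_eq_neg_one_of_charP_three]
  simp only [Matrix.smul_apply, Matrix.add_apply, Matrix.mul_apply, Fin.sum_three_cyclic n,
    hu, hl, hu', val_diag, paraC_mul_apply, mul_neg, neg_mul, smul_mul_assoc,
    mul_smul_comm, mul_one, one_mul]
  module

theorem je_val (hq : IsHurwitz q) (n : Fin 3) : (je hq n).val = Matrix.single n n 1 := rfl

theorem jdiag_je (hq : IsHurwitz q) (i j : Fin 3) :
    jdiag q i (je hq j) = if j = i then 1 else 0 := by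
  rw [jdiag_apply, je_val]
  split_ifs with h
  · subst h
    rw [Matrix.single_apply_same, hq.polar_one_one]
    linear_combination -three_eq_zero_of_charP_three k
  · rw [Matrix.single_apply_of_ne _ _ _ _ _ (by tauto)]
    simp

theorem jcoord_je (hq : IsHurwitz q) (i j : Fin 3) : jcoord q i (je hq j) = 0 := by
  rw [jcoord_apply, je_val, Matrix.single_apply_of_ne, neg_zero]
  rintro ⟨h, h'⟩
  exact (fin_three_ne i).2.2.2.2.1 (h'.symm.trans h)

theorem jdiag_jiota (hq : IsHurwitz q) (i j : Fin 3) (a : C) :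
    jdiag q i (jiota hq j a) = 0 := by
  rw [jdiag_apply]
  fin_cases i <;> fin_cases j <;> simp [jiota, Matrix.single]

theorem jcoord_jiota (hq : IsHurwitz q) (i j : Fin 3) (a : C) :
    jcoord q i (jiota hq j a) = if j = i then a else 0 := by
  rw [jcoord_apply]
  fin_cases i <;> fin_cases j <;>
    simp [jiota, Matrix.single, two_eq_neg_one_of_charP_three]

theorem herm_eq_sum (hq : IsHurwitz q) (x : Herm q) :
    x = ∑ i, jdiag q i x • je hq i + ∑ i, jiota hq i (jcoord q i x) := by
  refine herm_ext (fun n => ?_) fun n => ?_ <;>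
    simp [jdiag_je, jdiag_jiota, jcoord_je, jcoord_jiota]

/-- `J` is spanned by the `e_i` and the `ι_i(a)`. -/
theorem herm_induction (hq : IsHurwitz q) (P : Submodule k (Herm q)) (he : ∀ i, je hq i ∈ P)
    (hi : ∀ i a, jiota hq i a ∈ P) (x : Herm q) : x ∈ P := by
  rw [herm_eq_sum hq x]
  exact P.add_mem (P.sum_mem fun i _ => P.smul_mem _ (he i)) (P.sum_mem fun i _ => hi i _)

theorem jtrace_eq (x : Herm q) : jtrace q x = ∑ i, jdiag q i x := by
  simp [jtrace, jdiag_apply, inv_two_eq_neg_one_of_charP_three]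

theorem jdiag_jone (hq : IsHurwitz q) (n : Fin 3) : jdiag q n (jone hq) = 1 := by
  rw [jdiag_apply, jone_val, Matrix.one_apply_eq, hq.polar_one_one]
  linear_combination -three_eq_zero_of_charP_three k

theorem jcoord_jone (hq : IsHurwitz q) (n : Fin 3) : jcoord q n (jone hq) = 0 := by
  rw [jcoord_apply, jone_val, Matrix.one_apply_ne (fin_three_ne n).2.2.2.2.2, neg_zero]

end Coordinates

/-! ## Derivations of `H_3(C,*)` -/

section Derivations

variable {k C : Type*} [Field k] [CharP k 3] [NonAssocRing C] [Module k C] [IsScalarTower k C C]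
  [SMulCommClass k C C] {q : QuadraticForm k C}

theorem Dtri_apply (hq : IsHurwitz q) (d : Fin 3 → Module.End k C) (x : Herm q) :
    Dtri hq d x = ∑ n, jiota hq n (d n (jcoord q n x)) := by
  rw [Dtri, LinearMap.sum_apply]
  rfl

theorem jdiag_Dtri (hq : IsHurwitz q) (d : Fin 3 → Module.End k C) (n : Fin 3) (x : Herm q) :
    jdiag q n (Dtri hq d x) = 0 := by
  simp [Dtri_apply, jdiag_jiota]

theorem jcoord_Dtri (hq : IsHurwitz q) (d : Fin 3 → Module.End k C) (n : Fin 3) (x : Herm q) :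
    jcoord q n (Dtri hq d x) = d n (jcoord q n x) := by
  simp [Dtri_apply, jcoord_jiota]

theorem jlie_apply (hq : IsHurwitz q) (x y z : Herm q) :
    (jlie hq x y).1 z = jmul hq x (jmul hq y z) - jmul hq y (jmul hq x z) := rfl

theorem Di_apply (hq : IsHurwitz q) (n : Fin 3) (a : C) (z : Herm q) :
    (Di hq n a).1 z = jmul hq (je hq (n + 1)) (jmul hq (jiota hq n a) z)
      - jmul hq (jiota hq n a) (jmul hq (je hq (n + 1)) z) := by
  rw [Di, two_eq_neg_one_of_charP_three, neg_one_smul]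
  change -((jlie hq _ _).1 z) = _
  rw [jlie_apply, neg_sub]

/-- The factor 2 = -1 turns 2[L_{ι_n(a)},L_{e_{n+1}}] into [L_{e_{n+1}},L_{ι_n(a)}], whose effect on
coordinates is read off from the Peirce multiplication. Later facts about D_n(a) are derived from
this table. -/
theorem Di_coords (hq : IsHurwitz q) (n : Fin 3) (a : C) (z : Herm q) :
    jdiag q n ((Di hq n a).1 z) = 0 ∧
    jdiag q (n + 1) ((Di hq n a).1 z) = (paraC q).form a (jcoord q n z) ∧
    jdiag q (n + 2) ((Di hq n a).1 z) = - (paraC q).form a (jcoord q n z) ∧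
    jcoord q n ((Di hq n a).1 z) = (jdiag q (n + 2) z - jdiag q (n + 1) z) • a ∧
    jcoord q (n + 1) ((Di hq n a).1 z) = (paraC q).mul (jcoord q (n + 2) z) a ∧
    jcoord q (n + 2) ((Di hq n a).1 z) = - (paraC q).mul a (jcoord q (n + 1) z) := by
  obtain ⟨e1, e2, e3, e4⟩ := fin_three_add n
  obtain ⟨n1, n2, n3, n4, n5, n6⟩ := fin_three_ne n
  have h3 := three_smul_eq_zero (k := k) a
  refine ⟨?_, ?_, ?_, ?_, ?_, ?_⟩ <;>
    simp only [Di_apply, map_sub, jdiag_jmul, jcoord_jmul, jdiag_je, jdiag_jiota, jcoord_je,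
      jcoord_jiota, e1, e2, e3, e4, n1, n2, n3, n4, n5, n6, if_true, if_false, map_zero, map_neg,
      LinearMap.zero_apply, map_smul, map_add, LinearMap.add_apply, LinearMap.sub_apply,
      LinearMap.smul_apply, zero_smul, smul_zero, smul_eq_mul]
  · ring
  · linear_combination -(paraC q).form a (jcoord q n z) * three_eq_zero_of_charP_three k
  · ring
  · linear_combination (norm := module) jdiag q (n + 1) z • h3
  · module
  · module

/-- The Leibniz rule is compared coordinate by coordinate, so the Jordan identity for J is not
invoked. Diagonal coordinates need only associativity and symmetry of the form; off-diagonal ones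
need the linearised composition identities. -/
theorem Di_mem_der (hq : IsHurwitz q) (n : Fin 3) (a : C) : (Di hq n a).1 ∈ GJ.der hq := by
  intro x y
  obtain ⟨e1, e2, e3, e4⟩ := fin_three_add n
  have D := Di_coords hq n a
  have B : ∀ x y, (paraC q).form x y = (paraC q).form y x := paraC_form_comm q
  have h3 := three_eq_zero_of_charP_three k
  have h3a := three_smul_eq_zero (k := k) a
  refine herm_ext_cyclic n ?_ ?_ ?_ ?_ ?_ ?_ <;>
    simp only [map_add, jdiag_jmul, jcoord_jmul, e1, e2, e3, e4, (D _).1, (D _).2.1, (D _).2.2.1,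
      (D _).2.2.2.1, (D _).2.2.2.2.1, (D _).2.2.2.2.2, map_sub, map_smul, map_neg,
      LinearMap.neg_apply, LinearMap.smul_apply, smul_eq_mul]
  all_goals
    -- The coordinates of two elements of J are independent variables from here on; only identities
    -- in k and C remain.
    generalize jdiag q n x = ξ₀, jdiag q (n + 1) x = ξ₁, jdiag q (n + 2) x = ξ₂,
      jcoord q n x = x₀, jcoord q (n + 1) x = x₁, jcoord q (n + 2) x = x₂,
      jdiag q n y = η₀, jdiag q (n + 1) y = η₁, jdiag q (n + 2) y = η₂,
      jcoord q n y = y₀, jcoord q (n + 1) y = y₁, jcoord q (n + 2) y = y₂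
  · linear_combination hq.para_assoc x₂ a y₁ - hq.para_assoc a x₁ y₂ - hq.para_assoc' a x₁ y₂
  · linear_combination -hq.para_assoc a x₁ y₂ + hq.para_assoc' a y₁ x₂ + hq.para_assoc' y₁ x₂ a
      + (η₂ - η₁) * B x₀ a - (ξ₁ * (paraC q).form a y₀ + η₁ * (paraC q).form a x₀) * h3
  · linear_combination -hq.para_assoc' a x₁ y₂ - hq.para_assoc' a y₁ x₂ - hq.para_assoc' y₁ x₂ a
      + hq.para_assoc x₂ a y₁ + (η₂ - η₁) * B x₀ a
      + (ξ₂ * (paraC q).form a y₀ + η₂ * (paraC q).form a x₀) * h3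
  · have e1 := hq.para_left x₂ a y₂
    have e2 := hq.para_right y₁ a x₁
    rw [B y₁ x₁] at e2
    linear_combination (norm := module) e2 - e1 + (ξ₂ * η₂ - ξ₁ * η₁) • h3a
  · have e1 := hq.para_left x₀ y₁ a
    have e2 := hq.para_left y₀ x₁ a
    rw [B _ a] at e1 e2
    simp only [LinearMap.add_apply, LinearMap.sub_apply, LinearMap.smul_apply]
    linear_combination (norm := module) e1 + e2
  · linear_combination (norm := module) -hq.para_right a x₂ y₀ - hq.para_right a y₂ x₀

theorem jlie_swap (hq : IsHurwitz q) (x y : Herm q) : jlie hq x y = - jlie hq y x := by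
  ext1
  change _ = -(jlie hq y x).1
  ext1 z
  rw [LinearMap.neg_apply, jlie_apply, jlie_apply, neg_sub]

theorem stab_ext (hq : IsHurwitz q) (n : Fin 3) {f g : stab hq}
    (h : ∀ z, (jdiag q n (f.1 z) = jdiag q n (g.1 z) ∧
      jdiag q (n + 1) (f.1 z) = jdiag q (n + 1) (g.1 z) ∧
      jdiag q (n + 2) (f.1 z) = jdiag q (n + 2) (g.1 z)) ∧
      jcoord q n (f.1 z) = jcoord q n (g.1 z) ∧
      jcoord q (n + 1) (f.1 z) = jcoord q (n + 1) (g.1 z) ∧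
      jcoord q (n + 2) (f.1 z) = jcoord q (n + 2) (g.1 z)) : f = g := by
  ext1
  ext1 z
  obtain ⟨⟨h1, h2, h3⟩, h4, h5, h6⟩ := h z
  exact herm_ext_cyclic n h1 h2 h3 h4 h5 h6

theorem jlie_je_je (hq : IsHurwitz q) (i j : Fin 3) : jlie hq (je hq i) (je hq j) = 0 := by
  ext1
  ext1 z
  rw [jlie_apply]
  refine herm_ext (fun n => ?_) (fun n => ?_) <;>
    simp only [map_sub, jdiag_jmul, jcoord_jmul, jdiag_je, jcoord_je, map_zero,
      LinearMap.zero_apply, ZeroMemClass.coe_zero]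
  · ring
  · module

/-- The element ι_n(a) lies in the Peirce 0-space of e_n. -/
theorem jlie_jiota_je (hq : IsHurwitz q) (n : Fin 3) (a : C) :
    jlie hq (jiota hq n a) (je hq n) = 0 := by
  obtain ⟨e1, e2, e3, e4⟩ := fin_three_add n
  obtain ⟨n1, n2, n3, n4, n5, n6⟩ := fin_three_ne n
  refine stab_ext hq n fun z => ⟨⟨?_, ?_, ?_⟩, ?_, ?_, ?_⟩ <;>
    simp only [jlie_apply, map_sub, jdiag_jmul, jcoord_jmul, jdiag_je, jdiag_jiota, jcoord_je,
      jcoord_jiota, e1, e2, e3, e4, n1, n2, n3, n4, n5, n6, if_true, if_false, map_zero,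
      LinearMap.zero_apply, map_smul, map_add, LinearMap.add_apply, LinearMap.sub_apply,
      LinearMap.smul_apply, smul_zero, smul_eq_mul, ZeroMemClass.coe_zero]
  · ring
  · ring
  · ring
  · module
  · module
  · module

theorem jlie_jiota_je_one (hq : IsHurwitz q) (n : Fin 3) (a : C) :
    jlie hq (jiota hq n a) (je hq (n + 1)) = - Di hq n a := by
  rw [Di, two_eq_neg_one_of_charP_three, neg_one_smul, neg_neg]

theorem jone_eq_sum (hq : IsHurwitz q) : jone hq = ∑ i, je hq i := by
  refine herm_ext (fun n => ?_) (fun n => ?_) <;>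
    simp [jdiag_jone, jcoord_jone, jdiag_je, jcoord_je]

/-- The three idempotents add up to 1 and L_1 is the identity, so the three commutators with ι_n(a)
add up to zero. -/
theorem jlie_jiota_je_two (hq : IsHurwitz q) (n : Fin 3) (a : C) :
    jlie hq (jiota hq n a) (je hq (n + 2)) = Di hq n a := by
  have h := (jlie_one hq (jiota hq n a)).1
  rw [jone_eq_sum, Fin.sum_three_cyclic n, map_add, map_add, jlie_jiota_je, jlie_jiota_je_one,
    zero_add, neg_add_eq_zero] at h
  exact h.symm

/-- This is the J-side counterpart of the product of ι_n and ι_{n+1} in g(S_{1,2},S). Together with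
the lemma on equal indices, it makes all commutators of multiplications by off-diagonal elements
explicit. -/
theorem jlie_jiota_jiota_succ (hq : IsHurwitz q) (n : Fin 3) (a b : C) :
    jlie hq (jiota hq n a) (jiota hq (n + 1) b) = Di hq (n + 2) ((paraC q).mul a b) := by
  obtain ⟨e1, e2, e3, e4⟩ := fin_three_add n
  obtain ⟨n1, n2, n3, n4, n5, n6⟩ := fin_three_ne n
  have D := Di_coords hq (n + 2) ((paraC q).mul a b)
  rw [e3, e4] at D
  have B : ∀ x y, (paraC q).form x y = (paraC q).form y x := paraC_form_comm q
  have h3 := three_eq_zero_of_charP_three k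
  refine stab_ext hq n fun z => ⟨⟨?_, ?_, ?_⟩, ?_, ?_, ?_⟩ <;>
    simp only [jlie_apply, map_sub, jdiag_jmul, jcoord_jmul, jdiag_je, jdiag_jiota, jcoord_je,
      jcoord_jiota, e1, e2, e3, e4, n1, n2, n3, n4, n5, n6, if_true, if_false, map_zero,
      LinearMap.zero_apply, map_smul, map_add, LinearMap.add_apply, LinearMap.sub_apply,
      LinearMap.smul_apply, smul_zero, smul_eq_mul, (D _).1, (D _).2.1, (D _).2.2.1,
      (D _).2.2.2.1, (D _).2.2.2.2.1, (D _).2.2.2.2.2]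
  · linear_combination -hq.para_assoc a b (jcoord q (n + 2) z)
      - hq.para_assoc' a b (jcoord q (n + 2) z)
  · linear_combination hq.para_assoc a b (jcoord q (n + 2) z)
  · linear_combination -hq.para_assoc' a b (jcoord q (n + 2) z)
  · linear_combination (norm := module) -hq.para_right b a (jcoord q (n + 1) z)
  · linear_combination (norm := module) hq.para_left a b (jcoord q n z)
  · module

theorem thetaPow_cyclic {E : Type*} (n : Fin 3) (d : Fin 3 → E) :
    thetaPow n d n = d 0 ∧ thetaPow n d (n + 1) = d 1 ∧ thetaPow n d (n + 2) = d 2 := by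
  refine ⟨?_, ?_, ?_⟩ <;> simp [thetaPow]

/-- The commutator kills diagonal coordinates by symmetry of the form; its action on C_n, C_{n+1},
C_{n+2} is t_{a,b} rotated by n, because the linearised composition identities rewrite a commutator
of two multiplications as a scalar minus a single product. -/
theorem jlie_jiota_jiota (hq : IsHurwitz q) (n : Fin 3) (a b : C) :
    jlie hq (jiota hq n a) (jiota hq n b)
      = ⟨Dtri hq (thetaPow n ((paraC q).t a b)), Dtri_mem_stab hq _⟩ := by
  obtain ⟨e1, e2, e3, e4⟩ := fin_three_add n
  obtain ⟨n1, n2, n3, n4, n5, n6⟩ := fin_three_ne n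
  obtain ⟨t1, t2, t3⟩ := thetaPow_cyclic n ((paraC q).t a b)
  have B : ∀ x y, (paraC q).form x y = (paraC q).form y x := paraC_form_comm q
  have h3 := three_eq_zero_of_charP_three k
  refine stab_ext hq n fun z => ⟨⟨?_, ?_, ?_⟩, ?_, ?_, ?_⟩ <;>
    simp only [jlie_apply, map_sub, jdiag_jmul, jcoord_jmul, jdiag_je, jdiag_jiota, jcoord_je,
      jcoord_jiota, e1, e2, e3, e4, n1, n2, n3, n4, n5, n6, if_true, if_false, map_zero,
      LinearMap.zero_apply, map_smul, map_add, LinearMap.add_apply, LinearMap.sub_apply,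
      LinearMap.smul_apply, smul_zero, smul_eq_mul, jdiag_Dtri, jcoord_Dtri, t1, t2, t3,
      paraC_t_zero, paraC_t_one, paraC_t_two, inv_two_eq_neg_one_of_charP_three]
  · ring
  · linear_combination (jdiag q (n + 1) z + jdiag q (n + 2) z) * B a b
  · linear_combination (jdiag q (n + 1) z + jdiag q (n + 2) z) * B a b
  · linear_combination (norm := module)
      (paraC q).form b (jcoord q n z) • three_smul_eq_zero (k := k) a
      - (paraC q).form a (jcoord q n z) • three_smul_eq_zero (k := k) b
  · linear_combination (norm := module) -hq.para_left a (jcoord q (n + 1) z) b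
      + three_smul_eq_zero (k := k) ((paraC q).mul ((paraC q).mul b (jcoord q (n + 1) z)) a)
  · linear_combination (norm := module) -hq.para_right a (jcoord q (n + 2) z) b
      + three_smul_eq_zero (k := k) ((paraC q).mul a ((paraC q).mul (jcoord q (n + 2) z) b))

/-- The triality relation is invariant under cyclic shifts of the components. -/
theorem IsHurwitz.thetaPow_t_mem_tri (hq : IsHurwitz q) (n : Fin 3) (a b : C) :
    thetaPow n ((paraC q).t a b) ∈ (paraC q).tri 0 := by
  have h := hq.t_mem_tri (two_ne_zero_of_charP_three k) a b
  rw [paraC_mem_tri_zero]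
  refine ⟨fun m => ((paraC_mem_tri_zero _).1 h).1 _, ?_⟩
  have := hq.tri_cyclic h (0 - n)
  have e : ∀ n : Fin 3, 0 - n + 1 = 1 - n ∧ 0 - n + 2 = 2 - n := by decide
  rw [(e n).1, (e n).2] at this
  exact this

/-! ### Products of Peirce components and the structure of der J -/

theorem jmul_je_je (hq : IsHurwitz q) (i j : Fin 3) :
    jmul hq (je hq i) (je hq j) = if i = j then je hq i else 0 := by
  refine herm_ext (fun n => ?_) (fun n => ?_)
  · rw [jdiag_jmul]
    simp only [jdiag_je, jcoord_je, map_zero, apply_ite (jdiag q n)]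
    split_ifs <;> simp_all
  · rw [jcoord_jmul]
    simp only [jcoord_je, map_zero, apply_ite (jcoord q n)]
    simp

/-- The Peirce eigenvalue ½ is -1 in characteristic 3. -/
theorem jmul_je_jiota (hq : IsHurwitz q) (n : Fin 3) (a : C) :
    jmul hq (je hq n) (jiota hq n a) = 0 ∧
    jmul hq (je hq (n + 1)) (jiota hq n a) = -jiota hq n a ∧
    jmul hq (je hq (n + 2)) (jiota hq n a) = -jiota hq n a := by
  obtain ⟨e1, e2, e3, e4⟩ := fin_three_add n
  obtain ⟨n1, n2, n3, n4, n5, n6⟩ := fin_three_ne n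
  refine ⟨?_, ?_, ?_⟩ <;> refine herm_ext_cyclic n ?_ ?_ ?_ ?_ ?_ ?_ <;>
    simp [jdiag_jmul, jcoord_jmul, jdiag_je, jdiag_jiota, jcoord_je, jcoord_jiota, n1, n2, n3, n4,
      n5, n6, e1, e2, e3, e4]

theorem jmul_jiota_jiota (hq : IsHurwitz q) (n : Fin 3) (a b : C) :
    jmul hq (jiota hq n a) (jiota hq n b)
      = -(paraC q).form a b • (je hq (n + 1) + je hq (n + 2)) := by
  obtain ⟨e1, e2, e3, e4⟩ := fin_three_add n
  obtain ⟨n1, n2, n3, n4, n5, n6⟩ := fin_three_ne n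
  refine herm_ext_cyclic n ?_ ?_ ?_ ?_ ?_ ?_ <;>
    simp [jdiag_jmul, jcoord_jmul, jdiag_je, jdiag_jiota, jcoord_je, jcoord_jiota, n1, n2, n3, n4,
      n5, n6, e1, e2, e3, e4]

theorem jmul_jiota_jiota_succ (hq : IsHurwitz q) (n : Fin 3) (a b : C) :
    jmul hq (jiota hq n a) (jiota hq (n + 1) b) = jiota hq (n + 2) ((paraC q).mul a b) := by
  obtain ⟨e1, e2, e3, e4⟩ := fin_three_add n
  obtain ⟨n1, n2, n3, n4, n5, n6⟩ := fin_three_ne n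
  refine herm_ext_cyclic n ?_ ?_ ?_ ?_ ?_ ?_ <;>
    simp [jdiag_jmul, jcoord_jmul, jdiag_je, jdiag_jiota, jcoord_je, jcoord_jiota, n1, n2, n3, n4,
      n5, n6, e1, e2, e3, e4]

theorem Dtri_je (hq : IsHurwitz q) (d : Fin 3 → Module.End k C) (i : Fin 3) :
    Dtri hq d (je hq i) = 0 := by
  simp [Dtri_apply, jcoord_je]

theorem Dtri_jiota (hq : IsHurwitz q) (d : Fin 3 → Module.End k C) (n : Fin 3) (a : C) :
    Dtri hq d (jiota hq n a) = jiota hq n (d n a) := by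
  refine herm_ext (fun i => ?_) fun i => ?_
  · rw [jdiag_Dtri, jdiag_jiota]
  · rw [jcoord_Dtri, jcoord_jiota, jcoord_jiota]
    split_ifs with h
    · rw [h]
    · rw [map_zero]

/-- Skewness of the components gives the diagonal coordinates of the Leibniz rule, and the three
cyclic triality relations give the off-diagonal ones. -/
theorem Dtri_mem_der (hq : IsHurwitz q) {d : Fin 3 → Module.End k C}
    (hd : d ∈ (paraC q).tri 0) : Dtri hq d ∈ GJ.der hq := by
  have hs := ((paraC_mem_tri_zero d).1 hd).1
  intro x y
  refine herm_ext (fun n => ?_) fun n => ?_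
  · simp only [map_add, jdiag_Dtri, jcoord_Dtri, jdiag_jmul]
    linear_combination hs (n + 1) (jcoord q (n + 1) x) (jcoord q (n + 1) y)
      + hs (n + 2) (jcoord q (n + 2) x) (jcoord q (n + 2) y)
  · simp only [map_add, map_sub, map_smul, jdiag_Dtri, jcoord_Dtri, jcoord_jmul,
      hq.tri_cyclic hd n]
    module

theorem Di_je (hq : IsHurwitz q) (n : Fin 3) (a : C) :
    (Di hq n a).1 (je hq n) = 0 ∧
    (Di hq n a).1 (je hq (n + 1)) = -jiota hq n a ∧
    (Di hq n a).1 (je hq (n + 2)) = jiota hq n a := by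
  obtain ⟨n1, n2, n3, n4, n5, n6⟩ := fin_three_ne n
  have D := Di_coords hq n a
  refine ⟨?_, ?_, ?_⟩ <;> refine herm_ext_cyclic n ?_ ?_ ?_ ?_ ?_ ?_ <;>
    simp [(D _).1, (D _).2.1, (D _).2.2.1, (D _).2.2.2.1, (D _).2.2.2.2.1, (D _).2.2.2.2.2,
      jdiag_je, jcoord_je, jdiag_jiota, jcoord_jiota, n1, n2, n3, n4, n5, n6]

theorem Di_jiota (hq : IsHurwitz q) (n : Fin 3) (a b : C) :
    (Di hq n a).1 (jiota hq n b) = (paraC q).form a b • (je hq (n + 1) - je hq (n + 2)) ∧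
    (Di hq n a).1 (jiota hq (n + 1) b) = -jiota hq (n + 2) ((paraC q).mul a b) ∧
    (Di hq n a).1 (jiota hq (n + 2) b) = jiota hq (n + 1) ((paraC q).mul b a) := by
  obtain ⟨n1, n2, n3, n4, n5, n6⟩ := fin_three_ne n
  have D := Di_coords hq n a
  refine ⟨?_, ?_, ?_⟩ <;> refine herm_ext_cyclic n ?_ ?_ ?_ ?_ ?_ ?_ <;>
    simp [(D _).1, (D _).2.1, (D _).2.2.1, (D _).2.2.2.1, (D _).2.2.2.2.1, (D _).2.2.2.2.2,
      jdiag_je, jcoord_je, jdiag_jiota, jcoord_jiota, n1, n2, n3, n4, n5, n6]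

/-- The derivations of `J` which belong to `stab hq`. -/
def stabDer (hq : IsHurwitz q) : Submodule k (stab hq) :=
  (GJ.der hq).comap (stab hq).val.toLinearMap

theorem mem_stabDer (hq : IsHurwitz q) (f : stab hq) : f ∈ stabDer hq ↔ f.1 ∈ GJ.der hq :=
  Iff.rfl

/-- By bilinearity it is enough to take e_i and ι_i(a), where each commutator has been identified
with zero, with some ±D_i(c) or with a triality derivation. -/
theorem jlie_mem_stabDer (hq : IsHurwitz q) (x y : Herm q) : jlie hq x y ∈ stabDer hq := by
  have base : ∀ i a j b, jlie hq (jiota hq i a) (jiota hq j b) ∈ stabDer hq := by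
    intro i a j b
    rcases fin_three_cases i j with rfl | rfl | rfl
    · rw [jlie_jiota_jiota]
      exact Dtri_mem_der hq (hq.thetaPow_t_mem_tri _ a b)
    · rw [jlie_jiota_jiota_succ]
      exact Di_mem_der hq _ _
    · have h := jlie_jiota_jiota_succ hq (i + 2) b a
      rw [(fin_three_add i).2.2.1] at h
      rw [jlie_swap, h]
      exact Submodule.neg_mem _ (Di_mem_der hq _ _)
  have base' : ∀ i a j, jlie hq (jiota hq i a) (je hq j) ∈ stabDer hq := by
    intro i a j
    rcases fin_three_cases i j with rfl | rfl | rfl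
    · rw [jlie_jiota_je]; exact Submodule.zero_mem _
    · rw [jlie_jiota_je_one]; exact Submodule.neg_mem _ (Di_mem_der hq _ _)
    · rw [jlie_jiota_je_two]; exact Di_mem_der hq _ _
  refine herm_induction hq ((stabDer hq).comap ((jlie hq).flip y)) (fun i => ?_)
    (fun i a => ?_) x
  · refine herm_induction hq ((stabDer hq).comap (jlie hq (je hq i))) (fun j => ?_)
      (fun j b => ?_) y
    · rw [Submodule.mem_comap, jlie_je_je]; exact Submodule.zero_mem _
    · rw [Submodule.mem_comap, jlie_swap]; exact Submodule.neg_mem _ (base' j b i)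
  · exact herm_induction hq ((stabDer hq).comap (jlie hq (jiota hq i a))) (fun j => base' i a j)
      (fun j b => base i a j b) y

theorem der_comm_jlie (hq : IsHurwitz q) {d : Module.End k (Herm q)} (hd : d ∈ GJ.der hq)
    (x y z : Herm q) :
    d ((jlie hq x y).1 z) - (jlie hq x y).1 (d z)
      = (jlie hq (d x) y).1 z + (jlie hq x (d y)).1 z := by
  have h : ∀ x y, d (jmul hq x y) = jmul hq (d x) y + jmul hq x (d y) := hd
  simp only [jlie_apply, map_sub, h, map_add]
  abel

/-- A derivation of `J` that kills the idempotents `e_i` comes from a triality triple. -/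
theorem der_eq_Dtri_of_je (hq : IsHurwitz q) {d : Module.End k (Herm q)} (hd : d ∈ GJ.der hq)
    (he : ∀ i, d (je hq i) = 0) : ∃ d' ∈ (paraC q).tri 0, d = Dtri hq d' := by
  have h : ∀ x y, d (jmul hq x y) = jmul hq (d x) y + jmul hq x (d y) := hd
  -- Killing the idempotents means commuting with each L_{e_i}, so the Peirce spaces are preserved.
  -- The eigenvalue -1 for e_{n+1} and for e_{n+2} already leaves only the coordinate in ι_n.
  have hi : ∀ n a, d (jiota hq n a) = jiota hq n (jcoord q n (d (jiota hq n a))) := by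
    intro n a
    obtain ⟨e1, e2, e3, e4⟩ := fin_three_add n
    obtain ⟨n1, n2, n3, n4, n5, n6⟩ := fin_three_ne n
    have h0 := h (je hq n) (jiota hq n a)
    have h1 := h (je hq (n + 1)) (jiota hq n a)
    have h2 := h (je hq (n + 2)) (jiota hq n a)
    rw [(jmul_je_jiota hq n a).1, he] at h0
    rw [(jmul_je_jiota hq n a).2.1, he] at h1
    rw [(jmul_je_jiota hq n a).2.2, he] at h2
    rw [map_zero, map_zero, LinearMap.zero_apply, zero_add] at h0
    rw [map_zero, map_neg, LinearMap.zero_apply, zero_add, neg_eq_iff_eq_neg] at h1 h2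
    set y := d (jiota hq n a)
    refine herm_ext_cyclic n ?_ ?_ ?_ ?_ ?_ ?_
    · rw [h1]; simp [jdiag_jmul, jdiag_je, jcoord_je, jdiag_jiota, n3]
    · rw [h2]; simp [jdiag_jmul, jdiag_je, jcoord_je, jdiag_jiota, n6]
    · rw [h1]; simp [jdiag_jmul, jdiag_je, jcoord_je, jdiag_jiota, n5]
    · rw [jcoord_jiota, if_pos rfl]
    · rw [h1]; simp [jcoord_jmul, jdiag_je, jcoord_je, jcoord_jiota, n1, n3, n5, e1, e2]
    · rw [h2]; simp [jcoord_jmul, jdiag_je, jcoord_je, jcoord_jiota, n2, n4, n6, e3, e4]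
  refine ⟨fun n => (jcoord q n).comp (d.comp (jiota hq n)), ?_, ?_⟩
  · rw [paraC_mem_tri_zero]
    refine ⟨fun n x y => ?_, fun x y => ?_⟩
    · have hxy := h (jiota hq n x) (jiota hq n y)
      rw [jmul_jiota_jiota, map_smul, map_add, he, he, hi n x, hi n y, jmul_jiota_jiota,
        jmul_jiota_jiota, add_zero, smul_zero] at hxy
      -- The product ι_n(x)∘ι_n(y) is a multiple of e_{n+1}+e_{n+2} and is therefore killed; its
      -- e_{n+1} coordinate is the skewness condition.
      have := congrArg (jdiag q (n + 1)) hxy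
      simp only [map_zero, map_add, map_smul, jdiag_je, (fin_three_ne n).2.2.2.2.2, if_true,
        if_false, smul_eq_mul] at this
      simp only [LinearMap.comp_apply]
      linear_combination this
    · have hxy := h (jiota hq 1 x) (jiota hq 2 y)
      have e : ∀ x y, jmul hq (jiota hq 1 x) (jiota hq 2 y) = jiota hq 0 ((paraC q).mul x y) :=
        fun x y => jmul_jiota_jiota_succ hq 1 x y
      rw [hi 1 x, hi 2 y, e, e, e] at hxy
      have := congrArg (jcoord q 0) hxy
      simp only [map_add, jcoord_jiota, if_true] at this
      exact this
  · ext1 x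
    refine herm_induction hq (LinearMap.eqLocus d (Dtri hq _)) (fun i => ?_) (fun i a => ?_) x
    · rw [LinearMap.mem_eqLocus, he, Dtri_je]
    · rw [LinearMap.mem_eqLocus, Dtri_jiota]
      exact hi i a

/-- Every derivation of `J` is the sum of a derivation given by a triality triple and of inner
derivations `D_i(a_i)`. -/
theorem der_decomposition (hq : IsHurwitz q) {d : Module.End k (Herm q)} (hd : d ∈ GJ.der hq) :
    ∃ d' ∈ (paraC q).tri 0, ∃ a : Fin 3 → C, d = Dtri hq d' + ∑ n, (Di hq n (a n)).1 := by
  have h : ∀ x y, d (jmul hq x y) = jmul hq (d x) y + jmul hq x (d y) := hd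
  -- Forced by D_n(a)(e_{n+1}) = -ι_n(a).
  set a : Fin 3 → C := fun n => -jcoord q n (d (je hq (n + 1))) with ha
  have hD : ∑ n, (Di hq n (a n)).1 ∈ GJ.der hq :=
    Submodule.sum_mem _ fun n _ => Di_mem_der hq n (a n)
  obtain ⟨d', hd', h'⟩ := der_eq_Dtri_of_je hq (Submodule.sub_mem _ hd hD) (fun n => by
    obtain ⟨e1, e2, e3, e4⟩ := fin_three_add n
    obtain ⟨n1, n2, n3, n4, n5, n6⟩ := fin_three_ne n
    have D1 := (Di_je hq (n + 1) (a (n + 1))).2.2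
    have D2 := (Di_je hq (n + 2) (a (n + 2))).2.1
    rw [e2] at D1
    rw [e3] at D2
    have a1 : a (n + 1) = -jcoord q (n + 1) (d (je hq (n + 2))) := by rw [ha]; simp only [e1]
    have a2 : a (n + 2) = -jcoord q (n + 2) (d (je hq n)) := by rw [ha]; simp only [e3]
    -- Idempotency of e_n kills the diagonal coordinates and the coordinate n of d(e_n). Coordinate
    -- n+2 agrees by the choice of a, and orthogonality of e_n and e_{n+2} makes coordinate n+1 of
    -- d(e_n) opposite to that of d(e_{n+2}), which is again given by a.
    have h0 := h (je hq n) (je hq n)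
    have h1 := h (je hq n) (je hq (n + 2))
    rw [jmul_je_je, if_pos rfl] at h0
    rw [jmul_je_je, if_neg n2, map_zero] at h1
    rw [LinearMap.sub_apply, sub_eq_zero, LinearMap.sum_apply, Fin.sum_three_cyclic n,
      (Di_je hq n _).1, D1, D2, zero_add]
    have k0 := fun i => congrArg (jdiag q i) h0
    have l0 := fun i => congrArg (jcoord q i) h0
    have l1 := congrArg (jcoord q (n + 1)) h1
    refine herm_ext_cyclic n ?_ ?_ ?_ ?_ ?_ ?_
    · have := k0 n
      simp [jdiag_jmul, jdiag_je, jcoord_je, jdiag_jiota] at this ⊢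
      exact this
    · have := k0 (n + 1)
      simp [jdiag_jmul, jdiag_je, jcoord_je, jdiag_jiota, n1] at this ⊢
      exact this
    · have := k0 (n + 2)
      simp [jdiag_jmul, jdiag_je, jcoord_je, jdiag_jiota, n2] at this ⊢
      exact this
    · have := l0 n
      simp [jcoord_jmul, jdiag_je, jcoord_je, jcoord_jiota, n1, n2, n3, n4] at this ⊢
      exact this
    · simp [jcoord_jmul, jdiag_je, jcoord_je, jcoord_jiota, n1, n2, n3, n4, n5, n6, e1, e2,
        a1, a2] at l1 ⊢
      linear_combination (norm := module) l1
    · simp [jcoord_jiota, n5, n6, a2])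
  exact ⟨d', hd', a, by rw [← h', sub_add_cancel]⟩

end Derivations

/-! ## The orthogonal triple system `T_J` -/

section TripleSystem

variable {k C : Type*} [Field k] [CharP k 3] [NonAssocRing C] [Module k C] [IsScalarTower k C C]
  [SMulCommClass k C C] {q : QuadraticForm k C}

/-- Both summands in the decomposition of a derivation are already known to preserve J_0 and k1. -/
theorem der_le_stab (hq : IsHurwitz q) {d : Module.End k (Herm q)} (hd : d ∈ GJ.der hq) :
    d ∈ stab hq := by
  obtain ⟨d', -, a, rfl⟩ := der_decomposition hq hd
  refine Subalgebra.add_mem _ (Dtri_mem_stab hq d') ?_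
  exact Subalgebra.sum_mem _ fun n _ => (Di hq n (a n)).2

theorem TJ_induction (hq : IsHurwitz q) {P : TJ hq → Prop}
    (h : ∀ (x : Herm q) (hx : x ∈ jzero q), P ((jscalar hq).mkQ ⟨x, hx⟩)) (x : TJ hq) :
    P x := by
  obtain ⟨⟨x, hx⟩, rfl⟩ := (jscalar hq).mkQ_surjective x
  exact h x hx

theorem tform_mk (hq : IsHurwitz q) (x y : Herm q) (hx : x ∈ jzero q) (hy : y ∈ jzero q) :
    tform hq ((jscalar hq).mkQ ⟨x, hx⟩) ((jscalar hq).mkQ ⟨y, hy⟩) = jform hq x y := rfl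

theorem tlie_mk (hq : IsHurwitz q) (x y : Herm q) (hx : x ∈ jzero q) (hy : y ∈ jzero q) :
    tlie hq ((jscalar hq).mkQ ⟨x, hx⟩) ((jscalar hq).mkQ ⟨y, hy⟩) = jlie hq x y := rfl

theorem stab_mem_jzero {hq : IsHurwitz q} (f : stab hq) {x : Herm q} (hx : x ∈ jzero q) :
    f.1 x ∈ jzero q := f.2.1 x hx

theorem stabAct_mk (hq : IsHurwitz q) (f : stab hq) (x : Herm q) (hx : x ∈ jzero q) :
    stabAct hq f ((jscalar hq).mkQ ⟨x, hx⟩) = (jscalar hq).mkQ ⟨f.1 x, stab_mem_jzero f hx⟩ := rfl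

theorem ttriple_apply (hq : IsHurwitz q) (x y : TJ hq) :
    ttriple hq x y = stabAct hq (tlie hq x y) := rfl

theorem jtrace_cyclic {x : Herm q} (hx : x ∈ jzero q) (n : Fin 3) :
    jdiag q (n + 2) x = -jdiag q n x - jdiag q (n + 1) x := by
  rw [jzero, LinearMap.mem_ker, jtrace_eq, Fin.sum_three_cyclic n] at hx
  linear_combination hx

/-- For a trace-zero element, equality of the first two diagonal coordinates forces the third to be
-2 times the first, that is, equal to it. So modulo k1 one difference of diagonal coordinates
suffices. -/
theorem mkQ_eq (hq : IsHurwitz q) {x y : Herm q} (hx : x ∈ jzero q) (hy : y ∈ jzero q)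
    (h : jdiag q 1 x - jdiag q 0 x = jdiag q 1 y - jdiag q 0 y)
    (h' : ∀ n, jcoord q n x = jcoord q n y) :
    (jscalar hq).mkQ ⟨x, hx⟩ = (jscalar hq).mkQ ⟨y, hy⟩ := by
  rw [← sub_eq_zero, ← map_sub, Submodule.mkQ_apply, Submodule.Quotient.mk_eq_zero]
  change x - y ∈ Submodule.span k {jone hq}
  rw [Submodule.mem_span_singleton]
  refine ⟨jdiag q 0 (x - y), ?_⟩
  have h2x := jtrace_cyclic hx 0
  have h2y := jtrace_cyclic hy 0
  rw [zero_add, zero_add] at h2x h2y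
  refine herm_ext_cyclic 0 ?_ ?_ ?_ ?_ ?_ ?_ <;>
    simp only [map_sub, map_smul, jdiag_jone, jcoord_jone, smul_eq_mul, mul_one, smul_zero, h',
      sub_self, zero_add]
  · linear_combination -h
  · rw [h2x, h2y]
    linear_combination h + (jdiag q 0 x - jdiag q 0 y) * three_eq_zero_of_charP_three k

theorem jform_eq (hq : IsHurwitz q) (x y : Herm q) :
    jform hq x y = ∑ n, (jdiag q n x * jdiag q n y
      + (paraC q).form (jcoord q n x) (jcoord q n y)) := by
  change jtrace q (jmul hq x y) = _
  rw [jtrace_eq, Fin.sum_univ_three, Fin.sum_univ_three, jdiag_jmul, jdiag_jmul, jdiag_jmul]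
  change _ - (_ + _) + (_ - (_ + (paraC q).form (jcoord q 0 x) (jcoord q 0 y)))
    + (_ - ((paraC q).form (jcoord q 0 x) (jcoord q 0 y)
      + (paraC q).form (jcoord q 1 x) (jcoord q 1 y))) = _
  have e1 : (0 : Fin 3) + 1 = 1 := rfl
  have e2 : (0 : Fin 3) + 2 = 2 := rfl
  have e3 : (1 : Fin 3) + 1 = 2 := rfl
  rw [e1, e2, e3]
  linear_combination -((paraC q).form (jcoord q 0 x) (jcoord q 0 y)
    + (paraC q).form (jcoord q 1 x) (jcoord q 1 y)
    + (paraC q).form (jcoord q 2 x) (jcoord q 2 y)) * three_eq_zero_of_charP_three k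

/-- The off-diagonal coordinates of [L_x,L_y](y) agree with the required value already in J. Trace
zero eliminates the third diagonal coordinates, and four instances of the linearised composition
identities reduce the remaining products to scalars times vectors. -/
theorem jcoord_jlie_self (hq : IsHurwitz q) {x y : Herm q} (hx : x ∈ jzero q)
    (hy : y ∈ jzero q) (n : Fin 3) :
    jcoord q n ((jlie hq x y).1 y)
      = jcoord q n (jform hq x y • y - jform hq y y • x) := by
  obtain ⟨e1, e2, e3, e4⟩ := fin_three_add n
  have B : ∀ x y, (paraC q).form x y = (paraC q).form y x := paraC_form_comm q
  rw [jlie_apply, map_sub, map_sub, map_smul, map_smul, jform_eq, jform_eq,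
    Fin.sum_three_cyclic n, Fin.sum_three_cyclic n]
  simp only [map_add, map_sub, map_smul, jcoord_jmul, jdiag_jmul, e1, e2, e3, e4,
    jtrace_cyclic hx n, jtrace_cyclic hy n, LinearMap.add_apply, LinearMap.sub_apply,
    LinearMap.smul_apply]
  have h3 := three_eq_zero_of_charP_three k
  generalize jdiag q n x = ξ₀, jdiag q (n + 1) x = ξ₁,
      jcoord q n x = x₀, jcoord q (n + 1) x = x₁, jcoord q (n + 2) x = x₂,
      jdiag q n y = η₀, jdiag q (n + 1) y = η₁,
      jcoord q n y = y₀, jcoord q (n + 1) y = y₁, jcoord q (n + 2) y = y₂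
  have r1 := hq.para_right y₁ x₀ y₁
  have r2 := hq.para_right y₁ y₀ x₁
  have l1 := hq.para_left y₂ x₀ y₂
  have l2 := hq.para_left x₂ y₀ y₂
  rw [B y₁ x₁] at r2
  linear_combination (norm := skip) r1 - r2 + l1 - l2
  match_scalars <;> grind

/-- Only the difference of two diagonal coordinates is compared, since the identity is wanted modulo
k1. -/
theorem jdiag_jlie_self (hq : IsHurwitz q) {x y : Herm q} (hx : x ∈ jzero q)
    (hy : y ∈ jzero q) (n : Fin 3) :
    jdiag q (n + 1) ((jlie hq x y).1 y) - jdiag q n ((jlie hq x y).1 y)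
      = jdiag q (n + 1) (jform hq x y • y - jform hq y y • x)
        - jdiag q n (jform hq x y • y - jform hq y y • x) := by
  obtain ⟨e1, e2, e3, e4⟩ := fin_three_add n
  have B : ∀ x y, (paraC q).form x y = (paraC q).form y x := paraC_form_comm q
  simp only [jlie_apply, map_sub, map_smul, jform_eq,
    Fin.sum_three_cyclic n]
  simp only [map_add, map_sub, map_smul, jcoord_jmul, jdiag_jmul, e1, e2, e3, e4,
    jtrace_cyclic hx n, jtrace_cyclic hy n, LinearMap.add_apply, LinearMap.sub_apply,
    LinearMap.smul_apply, smul_eq_mul]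
  have h3 := three_eq_zero_of_charP_three k
  generalize jdiag q n x = ξ₀, jdiag q (n + 1) x = ξ₁,
      jcoord q n x = x₀, jcoord q (n + 1) x = x₁, jcoord q (n + 2) x = x₂,
      jdiag q n y = η₀, jdiag q (n + 1) y = η₁,
      jcoord q n y = y₀, jcoord q (n + 1) y = y₁, jcoord q (n + 2) y = y₂
  have a1 := hq.para_assoc' x₀ y₁ y₂
  have a2 := hq.para_assoc' y₁ y₂ x₀
  have a3 := hq.para_assoc' y₀ y₁ x₂
  have a4 := hq.para_assoc' y₁ x₂ y₀
  have a5 := hq.para_assoc' y₀ x₁ y₂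
  have a6 := hq.para_assoc' x₁ y₂ y₀
  have b0 := B x₀ y₀
  have b1 := B x₁ y₁
  have b2 := B x₂ y₂
  -- The instances of associativity and symmetry listed above are the only facts about C that enter;
  -- what remains is polynomial arithmetic modulo 3.
  clear B hq
  grind

theorem ttriple_right (hq : IsHurwitz q) (x y : TJ hq) :
    ttriple hq x y y = tform hq x y • y - tform hq y y • x := by
  induction x using TJ_induction hq with | h x hx => ?_
  induction y using TJ_induction hq with | h y hy => ?_
  rw [ttriple_apply, tlie_mk, stabAct_mk, tform_mk, tform_mk, ← map_smul, ← map_smul, ← map_sub]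
  exact mkQ_eq hq _ _ (jdiag_jlie_self hq hx hy 0) fun n => jcoord_jlie_self hq hx hy n

/-- A triality derivation has no diagonal part, and D_n(a) contributes opposite values in positions
n+1 and n+2. Applied to x∘y this gives invariance of the trace form under derivations. -/
theorem jtrace_der (hq : IsHurwitz q) {d : Module.End k (Herm q)} (hd : d ∈ GJ.der hq)
    (x : Herm q) : jtrace q (d x) = 0 := by
  obtain ⟨d', -, a, rfl⟩ := der_decomposition hq hd
  rw [LinearMap.add_apply, map_add, LinearMap.sum_apply, map_sum, jtrace_eq]
  rw [Finset.sum_eq_zero fun n _ => jdiag_Dtri hq d' n x, Finset.sum_eq_zero, add_zero]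
  intro n _
  obtain ⟨h0, h1, h2, -⟩ := Di_coords hq n (a n) x
  rw [jtrace_eq, Fin.sum_three_cyclic n, h0, h1, h2]
  ring

theorem tform_skew (hq : IsHurwitz q) {f : stab hq} (hf : f ∈ stabDer hq) (x y : TJ hq) :
    tform hq (stabAct hq f x) y + tform hq x (stabAct hq f y) = 0 := by
  induction x using TJ_induction hq with | h x hx => ?_
  induction y using TJ_induction hq with | h y hy => ?_
  rw [stabAct_mk, stabAct_mk, tform_mk, tform_mk]
  have h := jtrace_der hq ((mem_stabDer hq f).1 hf) (jmul hq x y)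
  have h' : f.1 (jmul hq x y) = jmul hq (f.1 x) y + jmul hq x (f.1 y) := hf x y
  rw [h', map_add] at h
  exact h

theorem tlie_equivariant (hq : IsHurwitz q) {f : stab hq} (hf : f ∈ stabDer hq) (x y : TJ hq) :
    f * tlie hq x y - tlie hq x y * f
      = tlie hq (stabAct hq f x) y + tlie hq x (stabAct hq f y) := by
  induction x using TJ_induction hq with | h x hx => ?_
  induction y using TJ_induction hq with | h y hy => ?_
  rw [stabAct_mk, stabAct_mk, tlie_mk, tlie_mk, tlie_mk]
  ext1
  ext1 z
  exact der_comm_jlie hq hf x y z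

theorem tlie_mem_stabDer (hq : IsHurwitz q) (x y : TJ hq) : tlie hq x y ∈ stabDer hq := by
  induction x using TJ_induction hq with | h x hx => ?_
  induction y using TJ_induction hq with | h y hy => ?_
  exact jlie_mem_stabDer hq x y

theorem stabAct_mul (hq : IsHurwitz q) (f g : stab hq) :
    stabAct hq (f * g) = stabAct hq f * stabAct hq g := by
  refine LinearMap.ext fun x => ?_
  induction x using TJ_induction hq with | h x hx => rfl

/-- Taking f = [L_x,L_y], which is itself a derivation, this becomes the fundamental identity of the
triple system. -/
theorem ttriple_equivariant (hq : IsHurwitz q) {f : stab hq} (hf : f ∈ stabDer hq)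
    (x y z : TJ hq) :
    stabAct hq f (ttriple hq x y z) = ttriple hq (stabAct hq f x) y z
      + ttriple hq x (stabAct hq f y) z + ttriple hq x y (stabAct hq f z) := by
  have h := congrArg (fun g => stabAct hq g z) (tlie_equivariant hq hf x y)
  simp only [map_sub, map_add, stabAct_mul, LinearMap.sub_apply, LinearMap.add_apply,
    Module.End.mul_apply] at h
  simp only [ttriple_apply]
  rw [← h, sub_add_cancel]

theorem tlie_swap (hq : IsHurwitz q) (x y : TJ hq) : tlie hq x y = -tlie hq y x := by
  induction x using TJ_induction hq with | h x hx => ?_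
  induction y using TJ_induction hq with | h y hy => ?_
  exact jlie_swap hq x y

theorem tform_comm (hq : IsHurwitz q) (x y : TJ hq) : tform hq x y = tform hq y x := by
  induction x using TJ_induction hq with | h x hx => ?_
  induction y using TJ_induction hq with | h y hy => ?_
  rw [tform_mk, tform_mk, jform_eq, jform_eq]
  exact Finset.sum_congr rfl fun n _ => by rw [mul_comm, paraC_form_comm]

theorem je_sub_mem_jzero (hq : IsHurwitz q) : je hq 0 - je hq 1 ∈ jzero q := jtrace_je_sub hq

theorem jiota_mem_jzero (hq : IsHurwitz q) (n : Fin 3) (a : C) : jiota hq n a ∈ jzero q :=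
  jtrace_jiota hq n a

theorem tone_eq (hq : IsHurwitz q) :
    tone hq = (jscalar hq).mkQ ⟨je hq 0 - je hq 1, je_sub_mem_jzero hq⟩ := rfl

theorem tiota_eq (hq : IsHurwitz q) (n : Fin 3) (a : C) :
    tiota hq n a = (jscalar hq).mkQ ⟨jiota hq n a, jiota_mem_jzero hq n a⟩ := rfl

/-- The square of e_0-e_1 is e_0+e_1, of trace 2. The value -1 also fixes the sign in the product of
two elements σ_{1,u}, σ_{1,v}. -/
theorem tform_tone_tone (hq : IsHurwitz q) : tform hq (tone hq) (tone hq) = -1 := by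
  rw [tone_eq, tform_mk, jform_eq, Fin.sum_univ_three]
  simp [jdiag_je, jcoord_je]
  linear_combination three_eq_zero_of_charP_three k

/-- `T_J` is an orthogonal triple system. -/
theorem isOrthogonalTripleSystem_TJ (hq : IsHurwitz q) :
    IsOrthogonalTripleSystem (tform hq) (ttriple hq) where
  ne_zero h := by
    have := tform_tone_tone hq
    rw [h] at this
    simp at this
  symm := tform_comm hq
  alt x := by
    rw [ttriple_apply]
    induction x using TJ_induction hq with | h x hx => ?_
    have : jlie hq x x = 0 := by ext1; ext1 z; exact sub_self _
    rw [tlie_mk, this, map_zero]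
  right := ttriple_right hq
  deriv x y u v w := ttriple_equivariant hq (tlie_mem_stabDer hq x y) u v w
  skew x y u v := tform_skew hq (tlie_mem_stabDer hq x y) u v

end TripleSystem

/-! ## The Lie superalgebra `g(J)` -/

section GJLie

variable {k V C : Type*} [Field k] [AddCommGroup V] [Module k V] [NonAssocRing C]
  [Module k C] [IsScalarTower k C C] [SMulCommClass k C C] {q : QuadraticForm k C}

theorem mem_spV (ω : LinearMap.BilinForm k V) (f : Module.End k V) :
    f ∈ spV ω ↔ ∀ u v, ω (f u) v + ω u (f v) = 0 := by
  rw [spV, LinearMap.mem_skewAdjointSubmodule]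
  refine forall₂_congr fun u v => ?_
  rw [Pi.neg_apply, map_neg, eq_neg_iff_add_eq_zero]

theorem gammaV_mem_spV {ω : LinearMap.BilinForm k V} (hω : ω.IsAlt) (u v : V) :
    gammaV ω u v ∈ spV ω := by
  rw [mem_spV]
  intro w w'
  simp only [gammaV_apply, map_add, map_smul, LinearMap.add_apply, LinearMap.smul_apply,
    smul_eq_mul]
  linear_combination -ω u w' * hω.neg_eq v w - ω v w' * hω.neg_eq u w

theorem gammaV_comm (ω : LinearMap.BilinForm k V) (u v : V) : gammaV ω u v = gammaV ω v u := by
  ext w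
  rw [gammaV_apply, gammaV_apply, add_comm]

theorem gammaV_equivariant {ω : LinearMap.BilinForm k V} {f : Module.End k V} (hf : f ∈ spV ω)
    (u v : V) : f * gammaV ω u v - gammaV ω u v * f = gammaV ω (f u) v + gammaV ω u (f v) := by
  rw [mem_spV] at hf
  ext w
  simp only [LinearMap.sub_apply, LinearMap.add_apply, Module.End.mul_apply, gammaV_apply,
    map_add, map_smul]
  have e1 := congrArg (· • v) (hf u w)
  have e2 := congrArg (· • u) (hf v w)
  beta_reduce at e1 e2
  linear_combination (norm := module) -e1 - e2

theorem spV_comm {ω : LinearMap.BilinForm k V} {f g : Module.End k V} (hf : f ∈ spV ω)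
    (hg : g ∈ spV ω) : f * g - g * f ∈ spV ω := by
  rw [mem_spV] at *
  intro u v
  simp only [LinearMap.sub_apply, Module.End.mul_apply, map_sub]
  linear_combination hf (g u) v - hg (f u) v + hf u (g v) - hg u (f v)

/-- The expression is trilinear and alternating in three vectors of a plane. -/
theorem alt_two_dim (hV : Module.finrank k V = 2) {ω : LinearMap.BilinForm k V} (hω : ω.IsAlt)
    (u v w : V) : ω u v • w + ω v w • u + ω w u • v = 0 := by
  have : Module.Finite k V := Module.finite_of_finrank_eq_succ hV
  let b : Module.Basis (Fin 2) k V := (Module.finBasis k V).reindex (finCongr hV)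
  rw [← b.sum_repr u, ← b.sum_repr v, ← b.sum_repr w]
  simp only [Fin.sum_univ_two, map_add, map_smul, LinearMap.add_apply, LinearMap.smul_apply,
    hω.self_eq_zero, ← hω.neg_eq (b 1) (b 0), smul_eq_mul]
  module

variable [CharP k 3]

open TensorProduct

theorem bracket_GJ_apply (ω : LinearMap.BilinForm k V) (hq : IsHurwitz q) (X Y : GJ.Space V hq) :
    GJ.bracket ω hq X Y = (X.1 * Y.1 - Y.1 * X.1 - GJ.gammaPart ω hq X.2.2 Y.2.2,
     X.2.1 * Y.2.1 - Y.2.1 * X.2.1 + GJ.liePart ω hq X.2.2 Y.2.2,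
     GJ.act hq X Y.2.2 - GJ.act hq Y X.2.2) := rfl

theorem mem_GJ_part_zero (ω : LinearMap.BilinForm k V) (hq : IsHurwitz q) (X : GJ.Space V hq) :
    X ∈ GJ.part ω hq 0 ↔ ∃ f ∈ spV ω, ∃ d ∈ stabDer hq, X = (f, d, 0) := by
  constructor
  · rintro ⟨h1, h2, h3⟩
    exact ⟨X.1, h1, X.2.1, h2, Prod.ext rfl (Prod.ext rfl h3)⟩
  · rintro ⟨f, hf, d, hd, rfl⟩
    exact ⟨hf, hd, rfl⟩

theorem mem_GJ_part_one (ω : LinearMap.BilinForm k V) (hq : IsHurwitz q) (X : GJ.Space V hq) :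
    X ∈ GJ.part ω hq 1 ↔ ∃ ξ, X = (0, 0, ξ) := by
  constructor
  · rintro ⟨h1, h2, h3⟩
    exact ⟨X.2.2, Prod.ext h1 (Prod.ext h2 rfl)⟩
  · rintro ⟨ξ, rfl⟩
    exact ⟨rfl, rfl, trivial⟩

theorem GJ_act_tmul (hq : IsHurwitz q) (X : GJ.Space V hq) (u : V) (x : TJ hq) :
    GJ.act hq X (u ⊗ₜ x) = X.1 u ⊗ₜ x + u ⊗ₜ stabAct hq X.2.1 x := by
  simp [GJ.act]

theorem gammaPart_tmul (ω : LinearMap.BilinForm k V) (hq : IsHurwitz q) (u v : V) (x y : TJ hq) :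
    GJ.gammaPart ω hq (u ⊗ₜ x) (v ⊗ₜ y) = tform hq x y • gammaV ω u v := by
  simp [GJ.gammaPart]

theorem liePart_tmul (ω : LinearMap.BilinForm k V) (hq : IsHurwitz q) (u v : V) (x y : TJ hq) :
    GJ.liePart ω hq (u ⊗ₜ x) (v ⊗ₜ y) = ω u v • tlie hq x y := by
  simp [GJ.liePart]

variable {ω : LinearMap.BilinForm k V}

theorem gammaPart_mem (hω : ω.IsAlt) (hq : IsHurwitz q) (ξ η : V ⊗[k] TJ hq) :
    GJ.gammaPart ω hq ξ η ∈ spV ω := by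
  induction ξ with
  | zero => simp
  | add a b ha hb => rw [map_add, LinearMap.add_apply]; exact Submodule.add_mem _ ha hb
  | tmul u x =>
    induction η with
    | zero => simp
    | add a b ha hb => rw [map_add]; exact Submodule.add_mem _ ha hb
    | tmul v y =>
      rw [gammaPart_tmul]
      exact Submodule.smul_mem _ _ (gammaV_mem_spV hω u v)

theorem liePart_mem (ω : LinearMap.BilinForm k V) (hq : IsHurwitz q) (ξ η : V ⊗[k] TJ hq) :
    GJ.liePart ω hq ξ η ∈ stabDer hq := by
  induction ξ with
  | zero => simp
  | add a b ha hb => rw [map_add, LinearMap.add_apply]; exact Submodule.add_mem _ ha hb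
  | tmul u x =>
    induction η with
    | zero => simp
    | add a b ha hb => rw [map_add]; exact Submodule.add_mem _ ha hb
    | tmul v y =>
      rw [liePart_tmul]
      exact Submodule.smul_mem _ _ (tlie_mem_stabDer hq x y)

theorem gammaPart_comm (ω : LinearMap.BilinForm k V) (hq : IsHurwitz q) (ξ η : V ⊗[k] TJ hq) :
    GJ.gammaPart ω hq ξ η = GJ.gammaPart ω hq η ξ := by
  induction ξ with
  | zero => simp
  | add a b ha hb => rw [map_add, map_add, LinearMap.add_apply, ha, hb]
  | tmul u x =>
    induction η with
    | zero => simp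
    | add a b ha hb => rw [map_add, map_add, LinearMap.add_apply, ha, hb]
    | tmul v y => rw [gammaPart_tmul, gammaPart_tmul, gammaV_comm, tform_comm]

theorem liePart_comm (hω : ω.IsAlt) (hq : IsHurwitz q) (ξ η : V ⊗[k] TJ hq) :
    GJ.liePart ω hq ξ η = GJ.liePart ω hq η ξ := by
  induction ξ with
  | zero => simp
  | add a b ha hb => rw [map_add, map_add, LinearMap.add_apply, ha, hb]
  | tmul u x =>
    induction η with
    | zero => simp
    | add a b ha hb => rw [map_add, map_add, LinearMap.add_apply, ha, hb]
    | tmul v y => rw [liePart_tmul, liePart_tmul, tlie_swap, ← hω.neg_eq, neg_smul_neg]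

theorem GJ_act_comm (hq : IsHurwitz q) (X Y : GJ.Space V hq) (ξ : V ⊗[k] TJ hq) :
    GJ.act hq (X.1 * Y.1 - Y.1 * X.1, X.2.1 * Y.2.1 - Y.2.1 * X.2.1, 0) ξ
      = GJ.act hq X (GJ.act hq Y ξ) - GJ.act hq Y (GJ.act hq X ξ) := by
  induction ξ with
  | zero => simp
  | add a b ha hb => simp only [map_add, ha, hb]; abel
  | tmul u x =>
    simp only [GJ_act_tmul, map_add, map_sub, stabAct_mul, LinearMap.sub_apply,
      Module.End.mul_apply, sub_tmul, tmul_sub]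
    abel

/-- Elements of sp(V) act on γ as derivations, and derivations of J are skew for the form on T, so
the two actions combine on the tensor product. -/
theorem gammaPart_equivariant (hq : IsHurwitz q) {f : Module.End k V} (hf : f ∈ spV ω)
    {d : stab hq} (hd : d ∈ stabDer hq) (ξ η : V ⊗[k] TJ hq) :
    f * GJ.gammaPart ω hq ξ η - GJ.gammaPart ω hq ξ η * f
      = GJ.gammaPart ω hq (GJ.act hq (f, d, 0) ξ) η
        + GJ.gammaPart ω hq ξ (GJ.act hq (f, d, 0) η) := by
  induction ξ with
  | zero => simp
  | add a b ha hb =>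
    simp only [map_add, LinearMap.add_apply, mul_add, add_mul]
    linear_combination (norm := abel) ha + hb
  | tmul u x =>
    induction η with
    | zero => simp
    | add a b ha hb =>
      simp only [map_add, mul_add, add_mul]
      linear_combination (norm := abel) ha + hb
    | tmul v y =>
      simp only [GJ_act_tmul, map_add, LinearMap.add_apply, gammaPart_tmul, mul_smul_comm,
        smul_mul_assoc]
      have h1 := congrArg (tform hq x y • ·) (gammaV_equivariant hf u v)
      have h2 := congrArg (· • gammaV ω u v) (tform_skew hq hd x y)
      beta_reduce at h1 h2
      linear_combination (norm := module) h1 - h2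

theorem liePart_equivariant (hq : IsHurwitz q) {f : Module.End k V} (hf : f ∈ spV ω)
    {d : stab hq} (hd : d ∈ stabDer hq) (ξ η : V ⊗[k] TJ hq) :
    d * GJ.liePart ω hq ξ η - GJ.liePart ω hq ξ η * d
      = GJ.liePart ω hq (GJ.act hq (f, d, 0) ξ) η
        + GJ.liePart ω hq ξ (GJ.act hq (f, d, 0) η) := by
  rw [mem_spV] at hf
  induction ξ with
  | zero => simp
  | add a b ha hb =>
    simp only [map_add, LinearMap.add_apply, mul_add, add_mul]
    linear_combination (norm := abel) ha + hb
  | tmul u x =>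
    induction η with
    | zero => simp
    | add a b ha hb =>
      simp only [map_add, mul_add, add_mul]
      linear_combination (norm := abel) ha + hb
    | tmul v y =>
      simp only [GJ_act_tmul, map_add, LinearMap.add_apply, liePart_tmul, mul_smul_comm,
        smul_mul_assoc]
      have h1 := congrArg (ω u v • ·) (tlie_equivariant hq hd x y)
      have h2 := congrArg (· • tlie hq x y) (hf u v)
      beta_reduce at h1 h2
      linear_combination (norm := module) h1 - h2

/-- `(ξ, η, ζ) ↦ [[ξ, η], ζ]` for odd elements. -/
def GJ.oddTriple (ω : LinearMap.BilinForm k V) (hq : IsHurwitz q) (ξ η : V ⊗[k] TJ hq) :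
    Module.End k (V ⊗[k] TJ hq) :=
  GJ.act hq (-GJ.gammaPart ω hq ξ η, GJ.liePart ω hq ξ η, 0)

theorem oddTriple_add_left (hq : IsHurwitz q) (ξ ξ' η : V ⊗[k] TJ hq) :
    GJ.oddTriple ω hq (ξ + ξ') η = GJ.oddTriple ω hq ξ η + GJ.oddTriple ω hq ξ' η := by
  rw [GJ.oddTriple, GJ.oddTriple, GJ.oddTriple, ← map_add]
  simp only [map_add, LinearMap.add_apply, Prod.mk_add_mk, add_zero, neg_add]

theorem oddTriple_comm (hω : ω.IsAlt) (hq : IsHurwitz q) (ξ η : V ⊗[k] TJ hq) :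
    GJ.oddTriple ω hq ξ η = GJ.oddTriple ω hq η ξ := by
  rw [GJ.oddTriple, gammaPart_comm, liePart_comm hω, GJ.oddTriple]

theorem oddTriple_add_right (hω : ω.IsAlt) (hq : IsHurwitz q) (ξ η η' : V ⊗[k] TJ hq) :
    GJ.oddTriple ω hq ξ (η + η') = GJ.oddTriple ω hq ξ η + GJ.oddTriple ω hq ξ η' := by
  rw [oddTriple_comm hω, oddTriple_add_left, oddTriple_comm hω, oddTriple_comm hω hq η']

theorem oddTriple_tmul (hq : IsHurwitz q) (u v w : V) (x y z : TJ hq) :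
    GJ.oddTriple ω hq (u ⊗ₜ x) (v ⊗ₜ y) (w ⊗ₜ z)
      = -(tform hq x y * ω u w) • (v ⊗ₜ[k] z) - (tform hq x y * ω v w) • (u ⊗ₜ[k] z)
        + ω u v • (w ⊗ₜ[k] ttriple hq x y z) := by
  rw [GJ.oddTriple, GJ_act_tmul, gammaPart_tmul, liePart_tmul]
  simp only [LinearMap.neg_apply, LinearMap.smul_apply, gammaV_apply, map_smul, neg_tmul,
    ← smul_tmul', tmul_smul, add_tmul, ttriple_apply]
  module

/-- This is the Jacobi identity for three odd elements. On pure tensors the three rotated triple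
products are rewritten in terms of [xyz] and multiples of x, y, z; each of the resulting
V-coefficients is an instance of the plane identity. -/
theorem oddTriple_cyclic (hV : Module.finrank k V = 2) (hω : ω.IsAlt) (hq : IsHurwitz q)
    (ξ η ζ : V ⊗[k] TJ hq) :
    GJ.oddTriple ω hq ξ η ζ + GJ.oddTriple ω hq η ζ ξ + GJ.oddTriple ω hq ζ ξ η = 0 := by
  have hz : ∀ ξ, GJ.oddTriple ω hq 0 ξ = 0 := fun ξ => by
    have := oddTriple_add_left (ω := ω) hq 0 0 ξ
    simpa using this
  have hz' : ∀ ξ, GJ.oddTriple ω hq ξ 0 = 0 := fun ξ => by rw [oddTriple_comm hω, hz]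
  induction ξ with
  | zero => simp [hz, hz']
  | add a b ha hb =>
    simp only [oddTriple_add_left, oddTriple_add_right hω, map_add, LinearMap.add_apply]
    linear_combination (norm := abel) ha + hb
  | tmul u x =>
  induction η with
  | zero => simp [hz, hz']
  | add a b ha hb =>
    simp only [oddTriple_add_left, oddTriple_add_right hω, map_add, LinearMap.add_apply]
    linear_combination (norm := abel) ha + hb
  | tmul v y =>
  induction ζ with
  | zero => simp [hz, hz']
  | add a b ha hb =>
    simp only [oddTriple_add_left, oddTriple_add_right hω, map_add, LinearMap.add_apply]
    linear_combination (norm := abel) ha + hb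
  | tmul w z =>
  -- Polarisation of the identity for [xyy].
  have lin : ∀ x y z : TJ hq, ttriple hq x y z + ttriple hq x z y
      = tform hq x y • z + tform hq x z • y - (2 * tform hq y z) • x := by
    intro x y z
    have h := ttriple_right hq x (y + z)
    have hy := ttriple_right hq x y
    have hz := ttriple_right hq x z
    have hc := tform_comm hq z y
    simp only [map_add, LinearMap.add_apply, hc] at h
    linear_combination (norm := module) h - hy - hz
  have swap : ∀ x y z : TJ hq, ttriple hq x y z = -ttriple hq y x z := by
    intro x y z
    rw [ttriple_apply, tlie_swap, map_neg, LinearMap.neg_apply, ttriple_apply]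
  -- Skewness in the first two arguments together with the polarised identity expresses both
  -- rotations through [xyz].
  have h1 : ttriple hq z x y = ttriple hq x y z
      - (tform hq x y • z + tform hq x z • y - (2 * tform hq y z) • x) := by
    rw [swap z x y, ← lin]; abel
  have h2 : ttriple hq y z x = ttriple hq x y z
      + (tform hq y z • x + tform hq y x • z - (2 * tform hq z x) • y) := by
    rw [swap x y z, ← lin]; abel
  have hv : ∀ p : TJ hq, ω u v • (w ⊗ₜ[k] p) + ω v w • (u ⊗ₜ[k] p) + ω w u • (v ⊗ₜ[k] p) = 0 := by
    intro p
    rw [smul_tmul', smul_tmul', smul_tmul', ← add_tmul, ← add_tmul, alt_two_dim hV hω, zero_tmul]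
  have hx := hv x
  have hy := hv y
  have hzz := hv z
  have ht := hv (ttriple hq x y z)
  rw [oddTriple_tmul, oddTriple_tmul, oddTriple_tmul, h1, h2]
  simp only [tmul_add, tmul_sub, tmul_smul, tform_comm hq y x, tform_comm hq z x,
    tform_comm hq z y, ← hω.neg_eq w u, ← hω.neg_eq u v, ← hω.neg_eq v w]
  linear_combination (norm := module) ht + tform hq y z • hx - tform hq x z • hy

/-- The cyclic identity at ξ = η = ζ only gives 3[[ξ,ξ],ξ] = 0, which is void here. On pure tensors
the cube vanishes since ⟨u|u⟩ = 0, and the mixed terms in the cube of a sum are the cyclic sums for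
(a,a,b) and (b,b,a). -/
theorem oddTriple_self (hV : Module.finrank k V = 2) (hω : ω.IsAlt) (hq : IsHurwitz q)
    (ξ : V ⊗[k] TJ hq) : GJ.oddTriple ω hq ξ ξ ξ = 0 := by
  induction ξ with
  | zero => simp
  | add a b ha hb =>
    have h1 := oddTriple_cyclic hV hω hq a a b
    have h2 := oddTriple_cyclic hV hω hq b b a
    rw [oddTriple_comm hω hq b a] at h1 h2
    simp only [oddTriple_add_left, oddTriple_add_right hω, map_add, LinearMap.add_apply,
      oddTriple_comm hω hq b a]
    linear_combination (norm := abel) ha + hb + h1 + h2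
  | tmul u x =>
    rw [oddTriple_tmul, hω.self_eq_zero]
    simp

/-! ### The axioms of a Lie superalgebra for g(J) -/

theorem bracket_GJ_even_even (ω : LinearMap.BilinForm k V) (hq : IsHurwitz q)
    (f g : Module.End k V) (d e : stab hq) :
    GJ.bracket ω hq (f, d, 0) (g, e, 0) = (f * g - g * f, d * e - e * d, 0) := by
  simp [bracket_GJ_apply]

theorem bracket_GJ_even_odd (ω : LinearMap.BilinForm k V) (hq : IsHurwitz q)
    (f : Module.End k V) (d : stab hq) (ξ : V ⊗[k] TJ hq) :
    GJ.bracket ω hq (f, d, 0) (0, 0, ξ) = (0, 0, GJ.act hq (f, d, 0) ξ) := by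
  simp [bracket_GJ_apply]

theorem bracket_GJ_odd_even (ω : LinearMap.BilinForm k V) (hq : IsHurwitz q)
    (f : Module.End k V) (d : stab hq) (ξ : V ⊗[k] TJ hq) :
    GJ.bracket ω hq (0, 0, ξ) (f, d, 0) = (0, 0, -GJ.act hq (f, d, 0) ξ) := by
  simp [bracket_GJ_apply]

theorem bracket_GJ_odd_odd (ω : LinearMap.BilinForm k V) (hq : IsHurwitz q)
    (ξ η : V ⊗[k] TJ hq) : GJ.bracket ω hq (0, 0, ξ) (0, 0, η)
      = (-GJ.gammaPart ω hq ξ η, GJ.liePart ω hq ξ η, 0) := by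
  have : GJ.act hq ((0 : Module.End k V), (0 : stab hq), ξ) = 0 := by ext; simp [GJ.act]
  have : GJ.act hq ((0 : Module.End k V), (0 : stab hq), η) = 0 := by ext; simp [GJ.act]
  simp [bracket_GJ_apply, *]

theorem stabDer_comm (hq : IsHurwitz q) {d e : stab hq} (hd : d ∈ stabDer hq)
    (he : e ∈ stabDer hq) : d * e - e * d ∈ stabDer hq := by
  rw [mem_stabDer] at *
  intro x y
  have hd' : ∀ x y, d.1 (jmul hq x y) = jmul hq (d.1 x) y + jmul hq x (d.1 y) := hd
  have he' : ∀ x y, e.1 (jmul hq x y) = jmul hq (e.1 x) y + jmul hq x (e.1 y) := he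
  change d.1 (e.1 (jmul hq x y)) - e.1 (d.1 (jmul hq x y))
    = jmul hq (d.1 (e.1 x) - e.1 (d.1 x)) y + jmul hq x (d.1 (e.1 y) - e.1 (d.1 y))
  simp only [hd', he', map_add, map_sub, LinearMap.sub_apply]
  abel

theorem GJ_jacobi_even_even (hq : IsHurwitz q) (f g h : Module.End k V) (d e c : stab hq)
    (ζ : V ⊗[k] TJ hq) :
    GJ.bracket ω hq (f, d, 0) (GJ.bracket ω hq (g, e, 0) ((h, c, 0) + (0, 0, ζ)))
      = GJ.bracket ω hq (GJ.bracket ω hq (f, d, 0) (g, e, 0)) ((h, c, 0) + (0, 0, ζ))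
        + GJ.bracket ω hq (g, e, 0) (GJ.bracket ω hq (f, d, 0) ((h, c, 0) + (0, 0, ζ))) := by
  have h1 := GJ_act_comm hq (f, d, 0) (g, e, 0) ζ
  dsimp only at h1
  simp only [map_add, bracket_GJ_even_even, bracket_GJ_even_odd, h1]
  simp only [Prod.mk_add_mk, add_zero, zero_add]
  refine Prod.ext ?_ (Prod.ext ?_ ?_)
  · noncomm_ring
  · noncomm_ring
  · exact (sub_add_cancel _ _).symm

theorem GJ_jacobi_even_odd (hq : IsHurwitz q) {f : Module.End k V} (hf : f ∈ spV ω)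
    {d : stab hq} (hd : d ∈ stabDer hq) (h : Module.End k V) (c : stab hq)
    (η ζ : V ⊗[k] TJ hq) :
    GJ.bracket ω hq (f, d, 0) (GJ.bracket ω hq (0, 0, η) ((h, c, 0) + (0, 0, ζ)))
      = GJ.bracket ω hq (GJ.bracket ω hq (f, d, 0) (0, 0, η)) ((h, c, 0) + (0, 0, ζ))
        + GJ.bracket ω hq (0, 0, η) (GJ.bracket ω hq (f, d, 0) ((h, c, 0) + (0, 0, ζ))) := by
  have h1 := GJ_act_comm hq (f, d, 0) (h, c, 0) η
  dsimp only at h1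
  have h2 := gammaPart_equivariant hq hf hd η ζ
  have h3 := liePart_equivariant hq hf hd η ζ
  simp only [map_add, bracket_GJ_even_even, bracket_GJ_even_odd, bracket_GJ_odd_even,
    bracket_GJ_odd_odd, h1]
  simp only [Prod.mk_add_mk, add_zero, zero_add]
  refine Prod.ext ?_ (Prod.ext ?_ ?_)
  · linear_combination (norm := noncomm_ring) -h2
  · exact h3
  · simp only [map_neg]
    abel

/-- The case of an even first element, rearranged by super-anticommutativity. -/
theorem GJ_jacobi_odd_even (hq : IsHurwitz q) {g : Module.End k V} (hg : g ∈ spV ω)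
    {e : stab hq} (he : e ∈ stabDer hq) (h : Module.End k V) (c : stab hq)
    (ξ ζ : V ⊗[k] TJ hq) :
    GJ.bracket ω hq (0, 0, ξ) (GJ.bracket ω hq (g, e, 0) ((h, c, 0) + (0, 0, ζ)))
      = GJ.bracket ω hq (GJ.bracket ω hq (0, 0, ξ) (g, e, 0)) ((h, c, 0) + (0, 0, ζ))
        + GJ.bracket ω hq (g, e, 0) (GJ.bracket ω hq (0, 0, ξ) ((h, c, 0) + (0, 0, ζ))) := by
  have hs : GJ.bracket ω hq (0, 0, ξ) (g, e, 0) = -GJ.bracket ω hq (g, e, 0) (0, 0, ξ) := by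
    rw [bracket_GJ_odd_even, bracket_GJ_even_odd]
    simp
  have hj := GJ_jacobi_even_odd (ω := ω) hq hg he h c ξ ζ
  rw [hs, map_neg, LinearMap.neg_apply]
  exact (neg_add_eq_of_eq_add hj).symm

/-- Against an even third element the identity is equivariance of the two odd-odd products; against
an odd one it is the cyclic identity. -/
theorem GJ_jacobi_odd_odd (hV : Module.finrank k V = 2) (hω : ω.IsAlt) (hq : IsHurwitz q)
    {h : Module.End k V} (hh : h ∈ spV ω) {c : stab hq} (hc : c ∈ stabDer hq)
    (ξ η ζ : V ⊗[k] TJ hq) :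
    GJ.bracket ω hq (0, 0, ξ) (GJ.bracket ω hq (0, 0, η) ((h, c, 0) + (0, 0, ζ)))
      = GJ.bracket ω hq (GJ.bracket ω hq (0, 0, ξ) (0, 0, η)) ((h, c, 0) + (0, 0, ζ))
        - GJ.bracket ω hq (0, 0, η) (GJ.bracket ω hq (0, 0, ξ) ((h, c, 0) + (0, 0, ζ))) := by
  have h1 := oddTriple_cyclic hV hω hq ξ η ζ
  rw [oddTriple_comm hω hq ζ ξ, GJ.oddTriple, GJ.oddTriple, GJ.oddTriple] at h1
  have h2 := gammaPart_equivariant hq hh hc ξ η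
  have h3 := liePart_equivariant hq hh hc ξ η
  rw [gammaPart_comm ω hq (GJ.act hq _ ξ)] at h2
  rw [liePart_comm hω hq (GJ.act hq _ ξ)] at h3
  simp only [map_add, bracket_GJ_even_even, bracket_GJ_even_odd, bracket_GJ_odd_even,
    bracket_GJ_odd_odd, map_neg]
  simp only [Prod.mk_add_mk, add_zero, zero_add]
  refine Prod.ext ?_ (Prod.ext ?_ ?_)
  · simp only [Prod.fst_sub]
    linear_combination (norm := noncomm_ring) -h2
  · simp only [Prod.fst_sub, Prod.snd_sub]
    linear_combination (norm := noncomm_ring) h3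
  · simp only [Prod.snd_sub]
    linear_combination (norm := abel) -h1

theorem GJ_closed (hω : ω.IsAlt) (hq : IsHurwitz q) (i j : ZMod 2) {X Y : GJ.Space V hq}
    (hX : X ∈ GJ.part ω hq i) (hY : Y ∈ GJ.part ω hq j) :
    GJ.bracket ω hq X Y ∈ GJ.part ω hq (i + j) := by
  have e11 : (1 + 1 : ZMod 2) = 0 := rfl
  rcases zmod_two_cases i with rfl | rfl <;> rcases zmod_two_cases j with rfl | rfl
  · obtain ⟨f, hf, d, hd, rfl⟩ := (mem_GJ_part_zero ω hq X).1 hX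
    obtain ⟨g, hg, e, he, rfl⟩ := (mem_GJ_part_zero ω hq Y).1 hY
    rw [bracket_GJ_even_even, add_zero]
    exact (mem_GJ_part_zero ω hq _).2 ⟨_, spV_comm hf hg, _, stabDer_comm hq hd he, rfl⟩
  · obtain ⟨f, hf, d, hd, rfl⟩ := (mem_GJ_part_zero ω hq X).1 hX
    obtain ⟨η, rfl⟩ := (mem_GJ_part_one ω hq Y).1 hY
    rw [bracket_GJ_even_odd, zero_add]
    exact (mem_GJ_part_one ω hq _).2 ⟨_, rfl⟩
  · obtain ⟨ξ, rfl⟩ := (mem_GJ_part_one ω hq X).1 hX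
    obtain ⟨g, hg, e, he, rfl⟩ := (mem_GJ_part_zero ω hq Y).1 hY
    rw [bracket_GJ_odd_even, add_zero]
    exact (mem_GJ_part_one ω hq _).2 ⟨_, rfl⟩
  · obtain ⟨ξ, rfl⟩ := (mem_GJ_part_one ω hq X).1 hX
    obtain ⟨η, rfl⟩ := (mem_GJ_part_one ω hq Y).1 hY
    rw [bracket_GJ_odd_odd, e11]
    exact (mem_GJ_part_zero ω hq _).2 ⟨_, Submodule.neg_mem _ (gammaPart_mem hω hq ξ η), _,
      liePart_mem ω hq ξ η, rfl⟩

theorem GJ_skew (hω : ω.IsAlt) (hq : IsHurwitz q) (i j : ZMod 2) {X Y : GJ.Space V hq}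
    (hX : X ∈ GJ.part ω hq i) (hY : Y ∈ GJ.part ω hq j) :
    GJ.bracket ω hq X Y = -(koszul k i j • GJ.bracket ω hq Y X) := by
  rcases zmod_two_cases i with rfl | rfl <;> rcases zmod_two_cases j with rfl | rfl
  · obtain ⟨f, hf, d, hd, rfl⟩ := (mem_GJ_part_zero ω hq X).1 hX
    obtain ⟨g, hg, e, he, rfl⟩ := (mem_GJ_part_zero ω hq Y).1 hY
    rw [bracket_GJ_even_even, bracket_GJ_even_even, koszul_zero_left, one_smul]
    simp
  · obtain ⟨f, hf, d, hd, rfl⟩ := (mem_GJ_part_zero ω hq X).1 hX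
    obtain ⟨η, rfl⟩ := (mem_GJ_part_one ω hq Y).1 hY
    rw [bracket_GJ_even_odd, bracket_GJ_odd_even, koszul_zero_left, one_smul]
    simp
  · obtain ⟨ξ, rfl⟩ := (mem_GJ_part_one ω hq X).1 hX
    obtain ⟨g, hg, e, he, rfl⟩ := (mem_GJ_part_zero ω hq Y).1 hY
    rw [bracket_GJ_even_odd, bracket_GJ_odd_even, koszul_zero_right, one_smul]
    simp
  · obtain ⟨ξ, rfl⟩ := (mem_GJ_part_one ω hq X).1 hX
    obtain ⟨η, rfl⟩ := (mem_GJ_part_one ω hq Y).1 hY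
    rw [bracket_GJ_odd_odd, bracket_GJ_odd_odd, koszul_one_one, neg_one_smul, neg_neg,
      gammaPart_comm, liePart_comm hω]

set_option maxHeartbeats 1000000 in
theorem GJ_jacobi (hV : Module.finrank k V = 2) (hω : ω.IsAlt) (hq : IsHurwitz q) (i j : ZMod 2)
    {X Y Z : GJ.Space V hq} (hX : X ∈ GJ.part ω hq i) (hY : Y ∈ GJ.part ω hq j)
    (hZ : Z ∈ GJ.part ω hq 0 ⊔ GJ.part ω hq 1) :
    GJ.bracket ω hq X (GJ.bracket ω hq Y Z) = GJ.bracket ω hq (GJ.bracket ω hq X Y) Z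
      + koszul k i j • GJ.bracket ω hq Y (GJ.bracket ω hq X Z) := by
  obtain ⟨Z0, hZ0, Z1, hZ1, rfl⟩ := Submodule.mem_sup.1 hZ
  obtain ⟨h, hh, c, hc, rfl⟩ := (mem_GJ_part_zero ω hq Z0).1 hZ0
  obtain ⟨ζ, rfl⟩ := (mem_GJ_part_one ω hq Z1).1 hZ1
  rcases zmod_two_cases i with rfl | rfl <;> rcases zmod_two_cases j with rfl | rfl
  · obtain ⟨f, hf, d, hd, rfl⟩ := (mem_GJ_part_zero ω hq X).1 hX
    obtain ⟨g, hg, e, he, rfl⟩ := (mem_GJ_part_zero ω hq Y).1 hY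
    rw [koszul_zero_left, one_smul]
    exact GJ_jacobi_even_even hq f g h d e c ζ
  · obtain ⟨f, hf, d, hd, rfl⟩ := (mem_GJ_part_zero ω hq X).1 hX
    obtain ⟨η, rfl⟩ := (mem_GJ_part_one ω hq Y).1 hY
    rw [koszul_zero_left, one_smul]
    exact GJ_jacobi_even_odd hq hf hd h c η ζ
  · obtain ⟨ξ, rfl⟩ := (mem_GJ_part_one ω hq X).1 hX
    obtain ⟨g, hg, e, he, rfl⟩ := (mem_GJ_part_zero ω hq Y).1 hY
    rw [koszul_zero_right, one_smul]
    exact GJ_jacobi_odd_even hq hg he h c ξ ζ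
  · obtain ⟨ξ, rfl⟩ := (mem_GJ_part_one ω hq X).1 hX
    obtain ⟨η, rfl⟩ := (mem_GJ_part_one ω hq Y).1 hY
    rw [koszul_one_one, neg_one_smul, ← sub_eq_add_neg]
    exact GJ_jacobi_odd_odd hV hω hq hh hc ξ η ζ

/-- `g(J)` is a Lie superalgebra. -/
theorem isLieSuperalgebra_GJ (hV : Module.finrank k V = 2) (hω : ω.IsAlt) (hq : IsHurwitz q) :
    IsLieSuperalgebra (GJ.bracket ω hq) (GJ.part ω hq) where
  disjoint := by
    rw [Submodule.disjoint_def]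
    intro X h0 h1
    obtain ⟨f, -, d, -, rfl⟩ := (mem_GJ_part_zero ω hq X).1 h0
    obtain ⟨ξ, h⟩ := (mem_GJ_part_one ω hq _).1 h1
    simp only [Prod.mk.injEq] at h
    rw [h.1, h.2.1]
    rfl
  closed i j X Y hX hY := GJ_closed hω hq i j hX hY
  skew i j X Y hX hY := GJ_skew hω hq i j hX hY
  jacobi i j X Y Z hX hY hZ := GJ_jacobi hV hω hq i j hX hY hZ
  cube X hX := by
    obtain ⟨ξ, rfl⟩ := (mem_GJ_part_one ω hq X).1 hX
    have := oddTriple_self hV hω hq ξ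
    rw [GJ.oddTriple] at this
    rw [bracket_GJ_odd_odd, bracket_GJ_odd_even, this, neg_zero]
    rfl

/-- The index n = 2 behaves like the others only in characteristic 3: there both idempotents
contribute, giving -2ι_2(a) = ι_2(a). -/
theorem stabAct_tone (hq : IsHurwitz q) (n : Fin 3) (a : C) :
    stabAct hq (Di hq n a) (tone hq) = tiota hq n a := by
  rw [tone_eq, tiota_eq, stabAct_mk]
  refine congrArg _ (Subtype.ext ?_)
  change (Di hq n a).1 (je hq 0 - je hq 1) = jiota hq n a
  have h := Di_je hq n a
  rw [map_sub]
  fin_cases n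
  · have h1 : (Di hq 0 a).1 (je hq 0) = 0 := h.1
    have h2 : (Di hq 0 a).1 (je hq 1) = _ := h.2.1
    simp [h1, h2]
  · have h1 : (Di hq 1 a).1 (je hq 1) = 0 := h.1
    have h2 : (Di hq 1 a).1 (je hq 0) = _ := h.2.2
    simp [h1, h2]
  · have h1 : (Di hq 2 a).1 (je hq 0) = -jiota hq 2 a := h.2.1
    have h2 : (Di hq 2 a).1 (je hq 1) = jiota hq 2 a := h.2.2
    have h3 := three_smul_eq_zero (k := k) (jiota hq 2 a)
    simp only [Fin.reduceFinMk]
    rw [h1, h2]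
    linear_combination (norm := module) -h3

end GJLie


/-! ## Homogeneous elements of superspaces -/

section Homogeneous

variable {k M N : Type*} [Field k] [AddCommGroup M] [Module k M] [AddCommGroup N] [Module k N]

namespace Superspace

theorem pr_of_mem (P : Superspace k M) {i : ZMod 2} {x : M} (hx : x ∈ P.part i) (j : ZMod 2) :
    P.pr j x = if j = i then x else 0 := by
  obtain ⟨y, rfl⟩ := hx
  rw [P.pr_pr]
  split_ifs with h
  · rw [h]
  · rfl

theorem pr_mem (P : Superspace k M) (i : ZMod 2) (x : M) : P.pr i x ∈ P.part i := ⟨x, rfl⟩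

theorem endPr_of_mem (P : Superspace k M) {i : ZMod 2} {f : Module.End k M}
    (hf : ∀ p, ∀ x ∈ P.part p, f x ∈ P.part (i + p)) (j : ZMod 2) :
    P.endPr j f = if j = i then f else 0 := by
  ext x
  rw [endPr_apply, sum_zmod_two, P.pr_of_mem (hf 0 _ (P.pr_mem 0 x)),
    P.pr_of_mem (hf 1 _ (P.pr_mem 1 x))]
  simp only [add_left_inj]
  split_ifs with h
  · rw [← map_add, P.pr_add]
  · simp

/-- The supercommutator is a sum over all parity components; for homogeneous maps one summand
survives and the usual formula with a single sign remains. -/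
theorem superComm_of_mem (P : Superspace k M) {i j : ZMod 2} {f g : Module.End k M}
    (hf : ∀ p, ∀ x ∈ P.part p, f x ∈ P.part (i + p))
    (hg : ∀ p, ∀ x ∈ P.part p, g x ∈ P.part (j + p)) :
    P.superComm f g = f * g - koszul k i j • (g * f) := by
  rw [superComm_apply, Finset.sum_eq_single i, Finset.sum_eq_single j]
  · simp [P.endPr_of_mem hf, P.endPr_of_mem hg]
  · intro b _ hb
    simp [P.endPr_of_mem hg, hb]
  · simp
  · intro b _ hb
    simp [P.endPr_of_mem hf, hb]
  · simp

theorem tensorPr_tensorPr (P : Superspace k M) (Q : Superspace k N) (i j : ZMod 2)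
    (ξ : M ⊗[k] N) :
    P.tensorPr Q i (P.tensorPr Q j ξ) = if i = j then P.tensorPr Q j ξ else 0 := by
  induction ξ with
  | zero => simp
  | add a b ha hb => rw [map_add, map_add, ha, hb]; split_ifs <;> simp
  | tmul x y =>
    simp only [tensorPr, LinearMap.sum_apply, TensorProduct.map_tmul, sum_zmod_two, map_add,
      Superspace.pr_pr]
    rcases zmod_two_cases i with rfl | rfl <;> rcases zmod_two_cases j with rfl | rfl <;>
      simp [Superspace.pr_pr, show (1 + 1 : ZMod 2) = 0 from rfl]

end Superspace

/-! ### The bracket of g(S,S') on homogeneous elements and on its summands -/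

namespace Magic

open FormedSuperalgebra

variable {S S' : Type*} [AddCommGroup S] [Module k S] [AddCommGroup S'] [Module k S']
  (A : FormedSuperalgebra k S) (B : FormedSuperalgebra k S')

theorem pr_of_mem {i : ZMod 2} {X : MagicSpace k S S'} (hX : X ∈ part A B i) (j : ZMod 2) :
    pr A B j X = if j = i then X else 0 := by
  obtain ⟨h1, h2, h3⟩ := hX
  have e1 : ∀ n, A.endPr j (X.1 n) = if j = i then X.1 n else 0 :=
    fun n => A.endPr_of_mem (h1.1 n).1 j
  have e2 : ∀ n, B.endPr j (X.2.1 n) = if j = i then X.2.1 n else 0 :=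
    fun n => B.endPr_of_mem (h2.1 n).1 j
  have e3 : ∀ n, A.tensorPr B.toSuperspace j (X.2.2 n) = if j = i then X.2.2 n else 0 := by
    intro n
    obtain ⟨ξ, hξ⟩ := h3 n trivial
    change A.tensorPr B.toSuperspace i ξ = X.2.2 n at hξ
    rw [← hξ, Superspace.tensorPr_tensorPr]
  change (fun n => A.endPr j (X.1 n), fun n => B.endPr j (X.2.1 n),
    fun n => A.tensorPr B.toSuperspace j (X.2.2 n)) = _
  simp only [e1, e2, e3]
  split_ifs <;> rfl

theorem half_apply (X Y : MagicSpace k S S') (n : Fin 3) :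
    half A B X Y n = (X.1 n).rTensor S' (Y.2.2 n) + rAct A B (X.2.1 n) (Y.2.2 n)
      + tensorMul A B (X.2.2 (n + 1)) (Y.2.2 (n + 2)) := rfl

/-- The bracket of homogeneous elements. -/
theorem bracket_of_mem {i j : ZMod 2} {X Y : MagicSpace k S S'} (hX : X ∈ part A B i)
    (hY : Y ∈ part A B j) : bracket A B X Y =
      (fun n => X.1 n * Y.1 n - koszul k i j • (Y.1 n * X.1 n)
        + ∑ m, thetaPow m (tPart A B (X.2.2 m) (Y.2.2 m)) n,
       fun n => X.2.1 n * Y.2.1 n - koszul k i j • (Y.2.1 n * X.2.1 n)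
        + ∑ m, thetaPow m (tPart' A B (X.2.2 m) (Y.2.2 m)) n,
       half A B X Y - koszul k i j • half A B Y X) := by
  have e1 : ∀ n, A.superComm (X.1 n) (Y.1 n) = X.1 n * Y.1 n - koszul k i j • (Y.1 n * X.1 n) :=
    fun n => A.superComm_of_mem (hX.1.1 n).1 (hY.1.1 n).1
  have e2 : ∀ n, B.superComm (X.2.1 n) (Y.2.1 n)
      = X.2.1 n * Y.2.1 n - koszul k i j • (Y.2.1 n * X.2.1 n) :=
    fun n => B.superComm_of_mem (hX.2.1.1 n).1 (hY.2.1.1 n).1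
  have e3 : ∑ p, ∑ q, koszul k p q • half A B (pr A B q Y) (pr A B p X)
      = koszul k i j • half A B Y X := by
    rw [Finset.sum_eq_single i, Finset.sum_eq_single j]
    · rw [pr_of_mem A B hX, pr_of_mem A B hY, if_pos rfl, if_pos rfl]
    · intro b _ hb
      rw [pr_of_mem A B hY, if_neg hb, map_zero, LinearMap.zero_apply, smul_zero]
    · simp
    · intro b _ hb
      rw [pr_of_mem A B hX, if_neg hb]
      simp
    · simp
  change (fun n => A.superComm (X.1 n) (Y.1 n) + ∑ m, thetaPow m (tPart A B (X.2.2 m) (Y.2.2 m)) n,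
    fun n => B.superComm (X.2.1 n) (Y.2.1 n) + ∑ m, thetaPow m (tPart' A B (X.2.2 m) (Y.2.2 m)) n,
    half A B X Y - ∑ p, ∑ q, koszul k p q • half A B (pr A B q Y) (pr A B p X)) = _
  simp only [e1, e2, e3]

/-- The element `ι_n(ξ)`. -/
def iota (n : Fin 3) (ξ : S ⊗[k] S') : MagicSpace k S S' := (0, 0, Pi.single n ξ)

theorem bracket_tri_tri {i j : ZMod 2} {d e : Fin 3 → Module.End k S}
    {d' e' : Fin 3 → Module.End k S'} (hX : (d, d', 0) ∈ part A B i)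
    (hY : (e, e', 0) ∈ part A B j) : bracket A B (d, d', 0) (e, e', 0) =
      (fun n => d n * e n - koszul k i j • (e n * d n),
       fun n => d' n * e' n - koszul k i j • (e' n * d' n), 0) := by
  rw [bracket_of_mem A B hX hY]
  refine Prod.ext (funext fun n => ?_) (Prod.ext (funext fun n => ?_) (funext fun n => ?_))
  · simp [thetaPow]
  · simp [thetaPow]
  · simp [half_apply]

theorem bracket_tri_iota {i j : ZMod 2} {d : Fin 3 → Module.End k S}
    {d' : Fin 3 → Module.End k S'} {ξ : S ⊗[k] S'} {n : Fin 3} (hX : (d, d', 0) ∈ part A B i)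
    (hY : iota n ξ ∈ part A B j) : bracket A B (d, d', 0) (iota n ξ) =
      iota n ((d n).rTensor S' ξ + rAct A B (d' n) ξ) := by
  rw [bracket_of_mem A B hX hY]
  refine Prod.ext (funext fun m => ?_) (Prod.ext (funext fun m => ?_) (funext fun m => ?_))
  · simp [thetaPow, iota]
  · simp [thetaPow, iota]
  · rcases eq_or_ne m n with rfl | h
    · simp [half_apply, iota]
    · simp [half_apply, iota, h]

theorem bracket_iota_tri {i j : ZMod 2} {d : Fin 3 → Module.End k S}
    {d' : Fin 3 → Module.End k S'} {ξ : S ⊗[k] S'} {n : Fin 3} (hX : iota n ξ ∈ part A B i)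
    (hY : (d, d', 0) ∈ part A B j) : bracket A B (iota n ξ) (d, d', 0) =
      -(koszul k i j • bracket A B (d, d', 0) (iota n ξ)) := by
  rw [bracket_tri_iota A B hY hX, bracket_of_mem A B hX hY]
  refine Prod.ext (funext fun m => ?_) (Prod.ext (funext fun m => ?_) (funext fun m => ?_))
  · simp [thetaPow, iota]
  · simp [thetaPow, iota]
  · rcases eq_or_ne m n with rfl | h
    · simp [half_apply, iota]
    · simp [half_apply, iota, h]

theorem bracket_iota_iota {i j : ZMod 2} {ξ η : S ⊗[k] S'} {n : Fin 3}
    (hX : iota n ξ ∈ part A B i) (hY : iota n η ∈ part A B j) :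
    bracket A B (iota n ξ) (iota n η)
      = (thetaPow n (tPart A B ξ η), thetaPow n (tPart' A B ξ η), 0) := by
  obtain ⟨n1, n2, n3, n4, n5, n6⟩ := fin_three_ne n
  rw [bracket_of_mem A B hX hY]
  refine Prod.ext (funext fun m => ?_) (Prod.ext (funext fun m => ?_) (funext fun m => ?_))
  · simp [thetaPow, iota, Fin.sum_three_cyclic n, n3, n4]
  · simp [thetaPow, iota, Fin.sum_three_cyclic n, n3, n4]
  · rcases fin_three_cases n m with rfl | rfl | rfl
    · simp [half_apply, iota, n3, n4]
    · simp [half_apply, iota, fin_three_add n, n3, n4]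
    · simp [half_apply, iota, fin_three_add n, n3, n4]

theorem bracket_iota_iota_succ {i j : ZMod 2} {ξ η : S ⊗[k] S'} {n : Fin 3}
    (hX : iota n ξ ∈ part A B i) (hY : iota (n + 1) η ∈ part A B j) :
    bracket A B (iota n ξ) (iota (n + 1) η) = iota (n + 2) (tensorMul A B ξ η) := by
  obtain ⟨n1, n2, n3, n4, n5, n6⟩ := fin_three_ne n
  rw [bracket_of_mem A B hX hY]
  refine Prod.ext (funext fun m => ?_) (Prod.ext (funext fun m => ?_) (funext fun m => ?_))
  · simp [thetaPow, iota, Fin.sum_three_cyclic n, n1, n2, n3, n4, n5, n6]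
  · simp [thetaPow, iota, Fin.sum_three_cyclic n, n1, n2, n3, n4, n5, n6]
  · rcases fin_three_cases n m with rfl | rfl | rfl
    · simp [half_apply, iota, n1, n2, n3, n4, n5, n6]
    · simp [half_apply, iota, fin_three_add n, n1, n2, n3, n4, n5, n6]
    · simp [half_apply, iota, fin_three_add n, n1, n2, n3, n4, n5, n6]

theorem bracket_iota_succ_iota {i j : ZMod 2} {ξ η : S ⊗[k] S'} {n : Fin 3}
    (hX : iota (n + 1) ξ ∈ part A B i) (hY : iota n η ∈ part A B j) :
    bracket A B (iota (n + 1) ξ) (iota n η)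
      = -(koszul k i j • bracket A B (iota n η) (iota (n + 1) ξ)) := by
  obtain ⟨n1, n2, n3, n4, n5, n6⟩ := fin_three_ne n
  rw [bracket_iota_iota_succ A B hY hX, bracket_of_mem A B hX hY]
  refine Prod.ext (funext fun m => ?_) (Prod.ext (funext fun m => ?_) (funext fun m => ?_))
  · simp [thetaPow, iota, Fin.sum_three_cyclic n, n1, n2, n3, n4, n5, n6]
  · simp [thetaPow, iota, Fin.sum_three_cyclic n, n1, n2, n3, n4, n5, n6]
  · rcases fin_three_cases n m with rfl | rfl | rfl
    · simp [half_apply, iota, n1, n2, n3, n4, n5, n6]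
    · simp [half_apply, iota, fin_three_add n, n1, n2, n3, n4, n5, n6]
    · simp [half_apply, iota, fin_three_add n, n1, n2, n3, n4, n5, n6]

/-! ### Products when the second factor is a para-Hurwitz algebra -/

section Para

variable {C : Type*} [NonAssocRing C] [Module k C] [IsScalarTower k C C] [SMulCommClass k C C]
  (q : QuadraticForm k C)

theorem paraC_endPr_apply (i : ZMod 2) (f : Module.End k C) :
    (paraC q).endPr i f = if i = 0 then f else 0 := by
  ext x
  rw [Superspace.endPr_apply, sum_zmod_two, paraC_pr_zero, paraC_pr_one, add_zero]
  rcases zmod_two_cases i with rfl | rfl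
  · simp [paraC_pr_zero]
  · simp [paraC_pr_one]

theorem tensorPr_paraC (i : ZMod 2) (x : S) (a : C) :
    A.tensorPr (paraC q).toSuperspace i (x ⊗ₜ a) = A.pr i x ⊗ₜ a := by
  simp [Superspace.tensorPr, LinearMap.sum_apply, sum_zmod_two, paraC_pr_zero, paraC_pr_one]

/-- The second factor is purely even, so each sign involving one of its parities is 1, and the
parity components of x add up to x. The same applies to the three lemmas that follow. -/
theorem rAct_paraC (d : Module.End k C) (x : S) (a : C) :
    rAct A (paraC q) d (x ⊗ₜ a) = x ⊗ₜ d a := by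
  simp only [rAct, sum_zmod_two, LinearMap.add_apply, LinearMap.smul_apply,
    LinearMap.compl₂_apply, LinearMap.comp_apply, paraC_endPr_apply, koszul_zero_left, one_smul,
    LinearMap.rTensor_tmul]
  simp [← TensorProduct.add_tmul, A.pr_add]

theorem tensorMul_paraC (x y : S) (a b : C) :
    tensorMul A (paraC q) (x ⊗ₜ a) (y ⊗ₜ b) = A.mul x y ⊗ₜ (paraC q).mul a b := by
  simp only [tensorMul, sum_zmod_two, LinearMap.add_apply, LinearMap.smul_apply,
    LinearMap.compl₁₂_apply, koszul_zero_left, one_smul, LinearMap.rTensor_tmul,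
    LinearMap.lTensor_tmul, paraC_pr_zero, paraC_pr_one, TensorProduct.map₂_apply_tmul]
  simp [← TensorProduct.add_tmul, ← map_add, A.pr_add]

theorem tPart_paraC (x y : S) (a b : C) :
    tPart A (paraC q) (x ⊗ₜ a) (y ⊗ₜ b) = (paraC q).form a b • A.t x y := by
  simp only [tPart, sum_zmod_two, LinearMap.add_apply, LinearMap.smul_apply,
    LinearMap.compl₁₂_apply, LinearMap.compr₂_apply, koszul_zero_right, one_smul, mul_one,
    TensorProduct.map_tmul, paraC_pr_zero, paraC_pr_one, TensorProduct.map₂_apply_tmul]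
  simp only [LinearMap.id_apply, LinearMap.zero_apply, TensorProduct.tmul_zero, map_zero,
    smul_zero, add_zero, LinearEquiv.coe_coe, TensorProduct.rid_tmul]
  simp only [← smul_add, ← map_add, ← LinearMap.add_apply, A.pr_add]

theorem tPart'_paraC (x y : S) (a b : C) :
    tPart' A (paraC q) (x ⊗ₜ a) (y ⊗ₜ b) = A.form x y • (paraC q).t a b := by
  simp only [tPart', sum_zmod_two, LinearMap.add_apply, LinearMap.smul_apply,
    LinearMap.compl₁₂_apply, LinearMap.compr₂_apply, koszul_zero_right, one_smul, mul_one,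
    LinearMap.rTensor_tmul, LinearMap.lTensor_tmul, paraC_pr_zero, paraC_pr_one,
    TensorProduct.map₂_apply_tmul, TensorProduct.map_tmul]
  simp only [LinearMap.id_apply, LinearMap.zero_apply, TensorProduct.tmul_zero, map_zero,
    smul_zero, add_zero, LinearEquiv.coe_coe, TensorProduct.lid_tmul]
  simp only [← add_smul, ← map_add, ← LinearMap.add_apply, A.pr_add]

end Para

end Magic

end Homogeneous


/-! ## The superalgebra `S_{1,2}` in characteristic `3` -/

section SuperS

variable {k V : Type*} [Field k] [AddCommGroup V] [Module k V] {ω : LinearMap.BilinForm k V}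

theorem superS_pr_zero (ω : LinearMap.BilinForm k V) (x : k × V) :
    (superS ω).pr 0 x = (x.1, 0) := rfl

theorem superS_pr_one (ω : LinearMap.BilinForm k V) (x : k × V) :
    (superS ω).pr 1 x = (0, x.2) := rfl

theorem superS_form (ω : LinearMap.BilinForm k V) (x y : k × V) :
    (superS ω).form x y = 2 * (x.1 * y.1) + ω x.2 y.2 := rfl

theorem superS_mul (ω : LinearMap.BilinForm k V) (x y : k × V) :
    (superS ω).mul x y = (x.1 * y.1 + ω x.2 y.2, -(x.1 • y.2) - y.1 • x.2) := by
  -- Since b(1,1) = 2 and V is orthogonal to 1, the standard involution is 1 on k1 and -1 on V.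
  have hc : ∀ z : k × V, (superB ω).conj (1, 0) z = (z.1, -z.2) := by
    intro z
    rw [FormedSuperalgebra.conj_apply]
    refine Prod.ext ?_ ?_
    · simp [superB]; ring
    · simp [superB]
  change (superB ω).mul ((superB ω).conj (1, 0) x) ((superB ω).conj (1, 0) y) = _
  rw [hc, hc]
  refine Prod.ext ?_ ?_
  · simp [superB]
  · simp [superB]; abel

theorem mem_superS_part_zero (ω : LinearMap.BilinForm k V) (x : k × V) :
    x ∈ (superS ω).part 0 ↔ x.2 = 0 := by
  constructor
  · rintro ⟨y, rfl⟩
    rfl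
  · intro h
    exact ⟨x, Prod.ext rfl h.symm⟩

theorem mem_superS_part_one (ω : LinearMap.BilinForm k V) (x : k × V) :
    x ∈ (superS ω).part 1 ↔ x.1 = 0 := by
  constructor
  · rintro ⟨y, rfl⟩
    rfl
  · intro h
    exact ⟨x, Prod.ext h.symm rfl⟩

/-- The even map `f̃`, with `f̃(1) = 0` and `f̃|_V = f`. -/
abbrev evenS (f : Module.End k V) : Module.End k (k × V) := LinearMap.prodMap 0 f

/-- The odd map `σ_{1,u}`. -/
abbrev oddS (ω : LinearMap.BilinForm k V) (u : V) : Module.End k (k × V) :=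
  (superS ω).sigma (1, 0) (0, u)

theorem oddS_apply (ω : LinearMap.BilinForm k V) (u : V) (z : k × V) :
    oddS ω u z = (-ω u z.2, (2 * z.1) • u) := by
  rw [FormedSuperalgebra.sigma_apply]
  simp [sum_zmod_two, superS_pr_zero, superS_pr_one, superS_form, koszul_zero_left,
    koszul_zero_right, koszul_one_one, show (1 + 1 : ZMod 2) = 0 from rfl]

variable [CharP k 3]

theorem superS_t_one_one (ω : LinearMap.BilinForm k V) : (superS ω).t (1, 0) (1, 0) = 0 := by
  funext n
  refine LinearMap.ext fun z => ?_
  fin_cases n <;> refine Prod.ext ?_ ?_ <;>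
    simp [FormedSuperalgebra.t, FormedSuperalgebra.sigma_apply, FormedSuperalgebra.rmul_apply,
      FormedSuperalgebra.lmul, sum_zmod_two, superS_pr_zero, superS_pr_one, superS_form,
      superS_mul, koszul_zero_left, koszul_zero_right, koszul_one_one,
      inv_two_eq_neg_one_of_charP_three, two_eq_neg_one_of_charP_three]

/-- In characteristic 3 the three components coincide, so the products of ι_n(1 ⊗ a) and ι_n(u ⊗ s)
do not depend on n. -/
theorem superS_t_one_odd (hω : ω.IsAlt) (u : V) :
    (superS ω).t (1, 0) (0, u) = fun _ => oddS ω u := by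
  funext n
  refine LinearMap.ext fun z => ?_
  rw [oddS_apply]
  have h := hω.neg_eq u z.2
  fin_cases n <;> refine Prod.ext ?_ ?_ <;>
    simp [FormedSuperalgebra.t, FormedSuperalgebra.sigma_apply, FormedSuperalgebra.rmul_apply,
      FormedSuperalgebra.lmul, sum_zmod_two, superS_pr_zero, superS_pr_one, superS_form,
      superS_mul, koszul_zero_left, koszul_zero_right, koszul_one_one,
      inv_two_eq_neg_one_of_charP_three, two_eq_neg_one_of_charP_three, ← h]

theorem superS_t_odd_one (hω : ω.IsAlt) (u : V) :
    (superS ω).t (0, u) (1, 0) = fun _ => -oddS ω u := by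
  funext n
  refine LinearMap.ext fun z => ?_
  rw [LinearMap.neg_apply, oddS_apply]
  have h := hω.neg_eq u z.2
  fin_cases n <;> refine Prod.ext ?_ ?_ <;>
    simp [FormedSuperalgebra.t, FormedSuperalgebra.sigma_apply, FormedSuperalgebra.rmul_apply,
      FormedSuperalgebra.lmul, sum_zmod_two, superS_pr_zero, superS_pr_one, superS_form,
      superS_mul, koszul_zero_left, koszul_zero_right, koszul_one_one,
      inv_two_eq_neg_one_of_charP_three, two_eq_neg_one_of_charP_three, ← h]

/-- The first component is -γ by definition of σ. That the other two equal it uses the plane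
identity and the vanishing of 3. -/
theorem superS_t_odd_odd (hV : Module.finrank k V = 2) (hω : ω.IsAlt) (u v : V) :
    (superS ω).t (0, u) (0, v) = fun _ => evenS (-gammaV ω u v) := by
  funext n
  refine LinearMap.ext fun z => ?_
  have h1 := hω.neg_eq z.2 u
  have h2 := hω.neg_eq z.2 v
  have h3 := hω.neg_eq u v
  have h4 := alt_two_dim hV hω u v z.2
  rw [← h2] at h4
  have h5 := three_smul_eq_zero (k := k) (ω z.2 v • u)
  fin_cases n <;> refine Prod.ext ?_ ?_ <;>
    simp [FormedSuperalgebra.t, FormedSuperalgebra.sigma_apply, FormedSuperalgebra.rmul_apply,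
      FormedSuperalgebra.lmul, sum_zmod_two, superS_pr_zero, superS_pr_one, superS_form,
      superS_mul, koszul_zero_left, koszul_zero_right, koszul_one_one,
      inv_two_eq_neg_one_of_charP_three, two_eq_neg_one_of_charP_three, gammaV_apply,
      show (1 + 1 : ZMod 2) = 0 from rfl, ← h1, ← h2, ← h3]
  · abel
  · ring
  · linear_combination (norm := module) -h4 - h5
  · ring
  · linear_combination (norm := module) -h4 - h5

/-! ### The triality Lie superalgebra of `S_{1,2}` -/

/-- If u is orthogonal to everything, the plane identity reduces to ⟨v|w⟩u = 0, and some ⟨v|w⟩ is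
nonzero. -/
theorem eq_zero_of_alt_two_dim (hV : Module.finrank k V = 2) (hω : ω.IsAlt) (hω0 : ω ≠ 0) {u : V}
    (hu : ∀ v, ω u v = 0) : u = 0 := by
  obtain ⟨v, hv⟩ : ∃ v, ω v ≠ 0 := by
    by_contra! h
    exact hω0 (LinearMap.ext h)
  obtain ⟨w, hw⟩ : ∃ w, ω v w ≠ 0 := by
    by_contra! h
    exact hv (LinearMap.ext h)
  have h := alt_two_dim hV hω u v w
  rw [hu v, ← hω.neg_eq u w, hu w] at h
  simpa [hw] using h

theorem evenS_mem_tri {f : Module.End k V} (hf : f ∈ spV ω) :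
    (fun _ => evenS f) ∈ (superS ω).tri 0 := by
  rw [mem_spV] at hf
  refine ⟨fun _ => ⟨fun p x hx => ?_, fun p x hx y => ?_⟩, fun p x hx y => ?_⟩
  · rcases zmod_two_cases p with rfl | rfl
    · rw [mem_superS_part_zero] at hx
      exact (mem_superS_part_zero _ _).2 (by simp [hx])
    · exact (mem_superS_part_one _ _).2 (by simp)
  · simp [superS_form, koszul_zero_left, hf]
  · refine Prod.ext ?_ ?_
    · simp [superS_mul, koszul_zero_left, hf]
    · simp [superS_mul, koszul_zero_left]; abel

/-- In the triality relation, an even first argument leaves a multiple of 3, and two odd arguments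
leave a multiple of 3 and the plane identity. -/
theorem oddS_mem_tri (hV : Module.finrank k V = 2) (hω : ω.IsAlt) (u : V) :
    (fun _ => oddS ω u) ∈ (superS ω).tri 1 := by
  refine ⟨fun _ => ⟨fun p x hx => ?_, fun p x hx y => ?_⟩, fun p x hx y => ?_⟩
  · rcases zmod_two_cases p with rfl | rfl
    · rw [mem_superS_part_zero] at hx
      exact (mem_superS_part_one _ _).2 (by simp [oddS_apply, hx])
    · rw [mem_superS_part_one] at hx
      exact (mem_superS_part_zero _ _).2 (by simp [oddS_apply, hx])
  · rcases zmod_two_cases p with rfl | rfl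
    · rw [mem_superS_part_zero] at hx
      simp [oddS_apply, superS_form, koszul_zero_right, hx]
      ring
    · rw [mem_superS_part_one] at hx
      have h := hω.neg_eq u x.2
      simp [oddS_apply, superS_form, koszul_one_one, hx, ← h]
      ring
  · rcases zmod_two_cases p with rfl | rfl
    · rw [mem_superS_part_zero] at hx
      refine Prod.ext ?_ ?_
      · simp [oddS_apply, superS_mul, koszul_zero_right, hx]
        ring
      · have h3 := three_smul_eq_zero (k := k) ((x.1 * y.1) • u)
        simp [oddS_apply, superS_mul, koszul_zero_right, hx]
        linear_combination (norm := module) (2 : k) • h3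
    · rw [mem_superS_part_one] at hx
      have h := hω.neg_eq u x.2
      have h2 := hω.neg_eq u y.2
      refine Prod.ext ?_ ?_
      · simp [oddS_apply, superS_mul, koszul_one_one, hx, ← h]
        ring
      · have h3 := three_smul_eq_zero (k := k) ((ω x.2 y.2) • u)
        have h4 := alt_two_dim hV hω u x.2 y.2
        simp [oddS_apply, superS_mul, koszul_one_one, hx, ← h]
        rw [← h2] at h4
        linear_combination (norm := module) h3 - h4

/-- Skewness against 1 gives d_n(1) = 0, because k1 is an anisotropic line. The triality relation
with one argument equal to 1 then forces the three components to agree on V. -/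
theorem mem_superS_tri_zero {d : Fin 3 → Module.End k (k × V)} (hd : d ∈ (superS ω).tri 0) :
    ∃ f ∈ spV ω, d = fun _ => evenS f := by
  obtain ⟨h1, h2⟩ := hd
  have m0 : ((1, 0) : k × V) ∈ (superS ω).part 0 := (mem_superS_part_zero _ _).2 rfl
  have m1 : ∀ v : V, ((0, v) : k × V) ∈ (superS ω).part 1 :=
    fun v => (mem_superS_part_one _ _).2 rfl
  have e1 : ∀ n, d n (1, 0) = 0 := by
    intro n
    have a := (mem_superS_part_zero _ _).1 ((h1 n).1 0 _ m0)
    have b := (h1 n).2 0 _ m0 (1, 0)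
    simp only [superS_form, koszul_zero_left, two_eq_neg_one_of_charP_three, a] at b
    refine Prod.ext ?_ a
    simp at b
    have h3 : (3 : k) = 0 := three_eq_zero_of_charP_three k
    change (d n (1, 0)).1 = 0
    linear_combination (d n (1, 0)).1 * h3 + b
  have e2 : ∀ n v, (d n (0, v)).1 = 0 := fun n v =>
    (mem_superS_part_one _ _).1 ((h1 n).1 1 _ (m1 v))
  have e3 : ∀ v, d 0 (0, v) = d 2 (0, v) := by
    intro v
    have a := h2 0 _ m0 (0, v)
    have h : ((0, -v) : k × V) = -(0, v) := by simp
    simp only [superS_mul, koszul_zero_left, e1] at a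
    simp only [map_zero, e2, one_smul, zero_smul, mul_zero, add_zero, sub_zero, h, map_neg,
      LinearMap.zero_apply, zero_add] at a
    rw [← neg_inj, a]
    exact Prod.ext (by simp [e2]) (by simp)
  have e4 : ∀ v, d 0 (0, v) = d 1 (0, v) := by
    intro v
    have a := h2 1 _ (m1 v) (1, 0)
    have h : ((0, -v) : k × V) = -(0, v) := by simp
    simp only [superS_mul, koszul_zero_left, e1] at a
    simp only [map_zero, e2, one_smul, zero_smul, mul_zero, add_zero, zero_sub, h, map_neg,
      smul_zero, zero_mul, Prod.fst_zero, Prod.snd_zero, neg_zero] at a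
    rw [← neg_inj, a]
    exact Prod.ext (by simp [e2]) (by simp)
  refine ⟨(LinearMap.snd k k V).comp ((d 0).comp (LinearMap.inr k k V)), ?_, ?_⟩
  · rw [mem_spV]
    intro u v
    have a := (h1 0).2 1 _ (m1 u) (0, v)
    simp [superS_form, koszul_zero_left] at a
    simp
    linear_combination a
  · have e5 : ∀ n v, d n (0, v) = d 0 (0, v) := by
      intro n v
      fin_cases n
      · rfl
      · exact (e4 v).symm
      · exact (e3 v).symm
    funext n
    refine LinearMap.ext fun x => ?_
    have hx : x = x.1 • (1, 0) + (0, x.2) := by simp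
    conv_lhs => rw [hx, map_add, map_smul, e1, e5]
    exact Prod.ext (by simp [e2]) (by simp)

theorem mem_superS_tri_one (hV : Module.finrank k V = 2) (hω : ω.IsAlt) (hω0 : ω ≠ 0)
    {d : Fin 3 → Module.End k (k × V)} (hd : d ∈ (superS ω).tri 1) :
    ∃ u, d = fun _ => oddS ω u := by
  obtain ⟨h1, h2⟩ := hd
  have m0 : ((1, 0) : k × V) ∈ (superS ω).part 0 := (mem_superS_part_zero _ _).2 rfl
  have m1 : ∀ v : V, ((0, v) : k × V) ∈ (superS ω).part 1 :=
    fun v => (mem_superS_part_one _ _).2 rfl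
  have h3 : (3 : k) = 0 := three_eq_zero_of_charP_three k
  -- The three vectors w_n = d_n(1) determine the whole triple, since skewness against 1 gives d_n
  -- on V.
  obtain ⟨w, hw⟩ : ∃ w : Fin 3 → V, ∀ n, d n (1, 0) = (0, w n) :=
    ⟨fun n => (d n (1, 0)).2, fun n =>
      Prod.ext ((mem_superS_part_one _ _).1 ((h1 n).1 0 _ m0)) rfl⟩
  have e1 : ∀ n v, d n (0, v) = (ω (w n) v, 0) := by
    intro n v
    have a := (h1 n).2 0 _ m0 (0, v)
    rw [hw] at a
    simp [superS_form, koszul_zero_right] at a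
    refine Prod.ext ?_ ((mem_superS_part_zero _ _).1 ((h1 n).1 1 _ (m1 v)))
    linear_combination (d n (0, v)).1 * h3 - a
  -- The triality relation at 1•1.
  have e2 : w 0 = -w 1 - w 2 := by
    have a := congrArg Prod.snd (h2 0 _ m0 (1, 0))
    simpa [superS_mul, koszul_zero_right, hw, ← sub_eq_add_neg] using a
  -- The triality relation at v•v, where ⟨v|v⟩ = 0 removes the left side. After elimination of w_2
  -- it says that ⟨w_1-w_0|v⟩v = 0, modulo 3.
  have e3 : w 1 = w 0 := by
    rw [← sub_eq_zero]
    apply eq_zero_of_alt_two_dim hV hω hω0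
    intro v
    have a := congrArg Prod.snd (h2 1 _ (m1 v) (0, v))
    have b : d 0 (0, 0) = 0 := by rw [← Prod.zero_eq_mk, map_zero]
    simp [superS_mul, koszul_one_one, e1, hω.self_eq_zero, b] at a
    have c : w 2 = -w 0 - w 1 := by rw [e2]; abel
    have c' := congrArg (fun z => ω z v) c
    beta_reduce at c'
    rw [map_sub, map_neg, LinearMap.sub_apply, LinearMap.neg_apply] at c'
    rw [c'] at a
    rw [map_sub, LinearMap.sub_apply]
    rcases eq_or_ne v 0 with rfl | hv
    · simp
    · have e : (ω (w 1) v - ω (w 0) v) • v = 0 := by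
        have h5 := three_smul_eq_zero (k := k) (ω (w 1) v • v)
        linear_combination (norm := module) h5 - a
      exact (smul_eq_zero.1 e).resolve_right hv
  have e4 : w 2 = w 0 := by
    have h5 := three_smul_eq_zero (k := k) (w 0)
    rw [e3] at e2
    linear_combination (norm := module) e2 - h5
  have e5 : ∀ n, w n = w 0 := by
    intro n
    fin_cases n
    · rfl
    · exact e3
    · exact e4
  -- The sign comes from σ_{1,u}(1) = 2u = -u.
  refine ⟨-w 0, ?_⟩
  funext n
  refine LinearMap.ext fun x => ?_
  have hx : x = x.1 • (1, 0) + (0, x.2) := by simp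
  conv_lhs => rw [hx, map_add, map_smul, hw, e1, e5]
  rw [oddS_apply]
  exact Prod.ext (by simp) (by simp [two_eq_neg_one_of_charP_three])

end SuperS


/-! ## Generators of `g(S_{1,2},S)` and the linear map underlying `Ψ` -/

section Generators

variable {k V C : Type*} [Field k] [CharP k 3] [AddCommGroup V] [Module k V] [NonAssocRing C]
  [Module k C] [IsScalarTower k C C] [SMulCommClass k C C]

namespace Magic

/-- The homogeneous elements of `g(S_{1,2},S)` whose images under `Ψ` are prescribed. -/
inductive IsGen (ω : LinearMap.BilinForm k V) (q : QuadraticForm k C) :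
    ZMod 2 → MagicSpace k (k × V) C → Prop
  | sp (f : Module.End k V) (hf : f ∈ spV ω) : IsGen ω q 0 (fun _ => evenS f, 0, 0)
  | tri (d : Fin 3 → Module.End k C) (hd : d ∈ (paraC q).tri 0) : IsGen ω q 0 (0, d, 0)
  | iotaOne (n : Fin 3) (a : C) : IsGen ω q 0 (iota n ((1, 0) ⊗ₜ a))
  | odd (u : V) : IsGen ω q 1 (fun _ => oddS ω u, 0, 0)
  | iotaOdd (n : Fin 3) (u : V) (s : C) : IsGen ω q 1 (iota n ((0, u) ⊗ₜ s))

variable {ω : LinearMap.BilinForm k V} {q : QuadraticForm k C}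

theorem iota_mem {S S' : Type*} [AddCommGroup S] [Module k S] [AddCommGroup S'] [Module k S']
    (A : FormedSuperalgebra k S) (B : FormedSuperalgebra k S') (i : ZMod 2) (n : Fin 3)
    {ξ : S ⊗[k] S'} (h : A.tensorPr B.toSuperspace i ξ = ξ) : iota n ξ ∈ part A B i := by
  refine ⟨Submodule.zero_mem _, Submodule.zero_mem _, fun m _ => ?_⟩
  change (Pi.single n ξ : Fin 3 → S ⊗[k] S') m ∈ _
  rcases eq_or_ne m n with rfl | hm
  · rw [Pi.single_eq_same]
    exact ⟨ξ, h⟩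
  · rw [Pi.single_eq_of_ne hm]
    exact Submodule.zero_mem _

theorem IsGen.mem (hV : Module.finrank k V = 2) (hω : ω.IsAlt) {i : ZMod 2}
    {X : MagicSpace k (k × V) C} (hX : IsGen ω q i X) : X ∈ part (superS ω) (paraC q) i := by
  cases hX with
  | sp f hf => exact ⟨evenS_mem_tri hf, Submodule.zero_mem _, Submodule.zero_mem _⟩
  | tri d hd => exact ⟨Submodule.zero_mem _, hd, Submodule.zero_mem _⟩
  | iotaOne n a => exact iota_mem _ _ _ n (tensorPr_paraC _ _ _ _ _)
  | odd u => exact ⟨oddS_mem_tri hV hω u, Submodule.zero_mem _, Submodule.zero_mem _⟩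
  | iotaOdd n u s => exact iota_mem _ _ _ n (tensorPr_paraC _ _ _ _ _)

theorem eq_tri_add_iota {S S' : Type*} [AddCommGroup S] [Module k S] [AddCommGroup S'] [Module k S']
    (X : MagicSpace k S S') :
    X = (X.1, 0, 0) + (0, X.2.1, 0) + ∑ n, iota n (X.2.2 n) := by
  have h : ∀ n, iota n (X.2.2 n) = LinearMap.inr k _ _ (LinearMap.inr k _ _
      (LinearMap.single k (fun _ => S ⊗[k] S') n (X.2.2 n))) := fun n => rfl
  simp only [h, ← map_sum, LinearMap.single_apply, Finset.univ_sum_single]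
  simp

theorem iota_mem_of_tmul {S S' : Type*} [AddCommGroup S] [Module k S] [AddCommGroup S']
    [Module k S'] (P : Submodule k (MagicSpace k S S')) (n : Fin 3)
    (f : S ⊗[k] S' →ₗ[k] S ⊗[k] S') (h : ∀ x y, iota n (f (x ⊗ₜ y)) ∈ P) (ξ : S ⊗[k] S') :
    iota n (f ξ) ∈ P := by
  let g := (LinearMap.inr k (Fin 3 → Module.End k S) _).comp
    ((LinearMap.inr k (Fin 3 → Module.End k S') _).comp
      ((LinearMap.single k (fun _ => S ⊗[k] S') n).comp f))
  have hg : ∀ ξ, iota n (f ξ) = g ξ := fun _ => rfl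
  rw [hg]
  induction ξ with
  | zero => rw [map_zero]; exact P.zero_mem
  | add x y hx hy => rw [map_add]; exact P.add_mem hx hy
  | tmul x y => exact h x y

/-- This is where the computation of tri(S_{1,2}) and the vanishing of the odd part of tri(S) enter.
It reduces the range of Ψ, the compatibility with products and uniqueness to five families. -/
theorem part_eq_span (hV : Module.finrank k V = 2) (hω : ω.IsAlt) (hω0 : ω ≠ 0) (i : ZMod 2) :
    part (superS ω) (paraC q) i = Submodule.span k {X | IsGen ω q i X} := by
  apply le_antisymm
  · rintro X ⟨h1, h2, h3⟩
    have h3' : ∀ n, ∃ ξ, (superS ω).tensorPr (paraC q).toSuperspace i ξ = X.2.2 n :=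
      fun n => h3 n trivial
    rw [eq_tri_add_iota X]
    refine Submodule.add_mem _ (Submodule.add_mem _ ?_ ?_) (Submodule.sum_mem _ fun n _ => ?_)
    · rcases zmod_two_cases i with rfl | rfl
      · obtain ⟨f, hf, e⟩ := mem_superS_tri_zero h1
        rw [e]
        exact Submodule.subset_span (.sp f hf)
      · obtain ⟨u, e⟩ := mem_superS_tri_one hV hω hω0 h1
        rw [e]
        exact Submodule.subset_span (.odd u)
    · rcases zmod_two_cases i with rfl | rfl
      · exact Submodule.subset_span (.tri _ h2)
      · rw [paraC_tri_one, SetLike.mem_coe, Submodule.mem_bot] at h2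
        rw [h2]
        exact Submodule.zero_mem _
    · obtain ⟨ξ, e⟩ := h3' n
      rw [← e]
      refine iota_mem_of_tmul _ n _ (fun x a => ?_) ξ
      rw [tensorPr_paraC]
      rcases zmod_two_cases i with rfl | rfl
      · have e : (superS ω).pr 0 x ⊗ₜ[k] a = (1, 0) ⊗ₜ (x.1 • a) := by
          rw [superS_pr_zero, TensorProduct.tmul_smul, TensorProduct.smul_tmul']
          simp
        rw [e]
        exact Submodule.subset_span (.iotaOne n _)
      · exact Submodule.subset_span (.iotaOdd n _ _)
  · exact Submodule.span_le.2 fun X hX => IsGen.mem hV hω hX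

end Magic

variable {q : QuadraticForm k C}

/-- `a ↦ ι̂_n(a)` as a linear map. -/
def tiotaLin (hq : IsHurwitz q) (n : Fin 3) : C →ₗ[k] TJ hq :=
  (jscalar hq).mkQ.comp ((jiota hq n).codRestrict (jzero q) (jtrace_jiota hq n))

theorem tiotaLin_apply (hq : IsHurwitz q) (n : Fin 3) (a : C) :
    tiotaLin hq n a = tiota hq n a := rfl

/-- `a ↦ D_n(a)` as a linear map. -/
def DiLin (hq : IsHurwitz q) (n : Fin 3) : C →ₗ[k] stab hq :=
  (2 : k) • ((jlie hq).flip (je hq (n + 1))).comp (jiota hq n)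

theorem DiLin_apply (hq : IsHurwitz q) (n : Fin 3) (a : C) : DiLin hq n a = Di hq n a := rfl

/-- `d ↦ D_d` as a linear map. -/
def DtriLin (hq : IsHurwitz q) : (Fin 3 → Module.End k C) →ₗ[k] stab hq where
  toFun d := ⟨Dtri hq d, Dtri_mem_stab hq d⟩
  map_add' d e := by
    refine Subtype.ext (LinearMap.ext fun x => ?_)
    change Dtri hq (d + e) x = Dtri hq d x + Dtri hq e x
    simp [Dtri_apply, Finset.sum_add_distrib]
  map_smul' c d := by
    refine Subtype.ext (LinearMap.ext fun x => ?_)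
    change Dtri hq (c • d) x = c • Dtri hq d x
    simp [Dtri_apply, Finset.smul_sum]

theorem DtriLin_apply (hq : IsHurwitz q) (d : Fin 3 → Module.End k C) :
    DtriLin hq d = ⟨Dtri hq d, Dtri_mem_stab hq d⟩ := rfl

/-- The linear map underlying `Ψ`, extended to the ambient spaces. -/
def psiLin (V : Type*) [AddCommGroup V] [Module k V] (hq : IsHurwitz q) :
    MagicSpace k (k × V) C →ₗ[k] GJ.Space V hq where
  toFun X := ((LinearMap.snd k k V).comp ((X.1 0).comp (LinearMap.inr k k V)),
    DtriLin hq X.2.1 + ∑ n, DiLin hq n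
      (TensorProduct.lid k C ((LinearMap.fst k k V).rTensor C (X.2.2 n))),
    -- An element f of sp(V) is visible in d_0 restricted to V and σ_{1,u} in d_0(1) = -u, whence
    -- the sign. Each of the two readings vanishes on the other kind of triple, so no parity
    -- projection is needed.
    -(X.1 0 (1, 0)).2 ⊗ₜ tone hq
      + ∑ n, TensorProduct.map (LinearMap.snd k k V) (tiotaLin hq n) (X.2.2 n))
  map_add' X Y := by
    refine Prod.ext ?_ (Prod.ext ?_ ?_)
    · simp [LinearMap.add_comp, LinearMap.comp_add]
    · simp [Finset.sum_add_distrib]; abel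
    · simp [Finset.sum_add_distrib, TensorProduct.add_tmul, TensorProduct.neg_tmul]; abel
  map_smul' c X := by
    refine Prod.ext ?_ (Prod.ext ?_ ?_)
    · simp [LinearMap.smul_comp, LinearMap.comp_smul]
    · simp [Finset.smul_sum]
    · simp [Finset.smul_sum, TensorProduct.smul_tmul', TensorProduct.neg_tmul]

theorem psiLin_sp (hq : IsHurwitz q) (f : Module.End k V) :
    psiLin V hq (fun _ => evenS f, 0, 0) = (f, 0, 0) := by
  refine Prod.ext ?_ (Prod.ext ?_ ?_)
  · ext v; simp [psiLin]
  · simp [psiLin]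
  · simp [psiLin]

theorem psiLin_tri (hq : IsHurwitz q) (d : Fin 3 → Module.End k C) :
    psiLin V hq (0, d, 0) = (0, ⟨Dtri hq d, Dtri_mem_stab hq d⟩, 0) := by
  refine Prod.ext ?_ (Prod.ext ?_ ?_)
  · ext v; simp [psiLin]
  · simp [psiLin, DtriLin_apply]
  · simp [psiLin]

theorem psiLin_iota (hq : IsHurwitz q) (n : Fin 3) (ξ : (k × V) ⊗[k] C) :
    psiLin V hq (Magic.iota n ξ) = (0,
      DiLin hq n (TensorProduct.lid k C ((LinearMap.fst k k V).rTensor C ξ)),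
      TensorProduct.map (LinearMap.snd k k V) (tiotaLin hq n) ξ) := by
  have h : ∀ m, m ≠ n → (Magic.iota n ξ : MagicSpace k (k × V) C).2.2 m = 0 := fun m hm => by
    simp [Magic.iota, hm]
  refine Prod.ext ?_ (Prod.ext ?_ ?_)
  · ext v; simp [psiLin, Magic.iota]
  · change DtriLin hq 0 + ∑ m, _ = _
    rw [map_zero, zero_add, Finset.sum_eq_single n (fun m _ hm => by rw [h m hm]; simp) (by simp)]
    simp [Magic.iota]
  · change -((0 : k × V).2) ⊗ₜ tone hq + ∑ m, _ = _
    rw [Finset.sum_eq_single n (fun m _ hm => by rw [h m hm]; simp) (by simp)]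
    simp [Magic.iota]

theorem psiLin_iota_one (hq : IsHurwitz q) (n : Fin 3) (a : C) :
    psiLin V hq (Magic.iota n ((1, 0) ⊗ₜ a)) = (0, Di hq n a, 0) := by
  simp [psiLin_iota, DiLin_apply]

theorem psiLin_iota_odd (hq : IsHurwitz q) (n : Fin 3) (u : V) (s : C) :
    psiLin V hq (Magic.iota n ((0, u) ⊗ₜ s)) = (0, 0, u ⊗ₜ tiota hq n s) := by
  simp [psiLin_iota, tiotaLin_apply]

theorem psiLin_odd (ω : LinearMap.BilinForm k V) (hq : IsHurwitz q) (u : V) :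
    psiLin V hq (fun _ => oddS ω u, 0, 0) = (0, 0, u ⊗ₜ tone hq) := by
  refine Prod.ext ?_ (Prod.ext ?_ ?_)
  · ext v; simp [psiLin, oddS_apply]
  · simp [psiLin]
  · simp [psiLin, oddS_apply, two_eq_neg_one_of_charP_three, TensorProduct.neg_tmul]

theorem psiLin_mem_part (hV : Module.finrank k V = 2) {ω : LinearMap.BilinForm k V} (hω : ω.IsAlt)
    (hω0 : ω ≠ 0) (hq : IsHurwitz q) {i : ZMod 2} {X : MagicSpace k (k × V) C}
    (hX : X ∈ Magic.part (superS ω) (paraC q) i) : psiLin V hq X ∈ GJ.part ω hq i := by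
  rw [Magic.part_eq_span hV hω hω0] at hX
  revert hX
  suffices h : Submodule.span k {X | Magic.IsGen ω q i X}
      ≤ (GJ.part ω hq i).comap (psiLin V hq) from fun hX => h hX
  rw [Submodule.span_le]
  rintro X (⟨f, hf⟩ | ⟨d, hd⟩ | ⟨n, a⟩ | ⟨u⟩ | ⟨n, u, s⟩)
  · rw [SetLike.mem_coe, Submodule.mem_comap, psiLin_sp, mem_GJ_part_zero]
    exact ⟨f, hf, 0, Submodule.zero_mem _, rfl⟩
  · rw [SetLike.mem_coe, Submodule.mem_comap, psiLin_tri, mem_GJ_part_zero]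
    exact ⟨0, Submodule.zero_mem _, _, (mem_stabDer hq _).2 (Dtri_mem_der hq hd), rfl⟩
  · rw [SetLike.mem_coe, Submodule.mem_comap, psiLin_iota_one, mem_GJ_part_zero]
    exact ⟨0, Submodule.zero_mem _, _, (mem_stabDer hq _).2 (Di_mem_der hq n a), rfl⟩
  · rw [SetLike.mem_coe, Submodule.mem_comap, psiLin_odd, mem_GJ_part_one]
    exact ⟨_, rfl⟩
  · rw [SetLike.mem_coe, Submodule.mem_comap, psiLin_iota_odd, mem_GJ_part_one]
    exact ⟨_, rfl⟩

end Generators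


/-! ## Products in `g(J)` of the images of the generators -/

section Products

variable {k C : Type*} [Field k] [CharP k 3] [NonAssocRing C] [Module k C] [IsScalarTower k C C]
  [SMulCommClass k C C] {q : QuadraticForm k C}

theorem stab_comm_jlie (hq : IsHurwitz q) {d : stab hq} (hd : d ∈ stabDer hq) (x y : Herm q) :
    d * jlie hq x y - jlie hq x y * d = jlie hq (d.1 x) y + jlie hq x (d.1 y) :=
  Subtype.ext (LinearMap.ext fun z => der_comm_jlie hq ((mem_stabDer hq d).1 hd) x y z)

theorem Di_mem_stabDer (hq : IsHurwitz q) (n : Fin 3) (a : C) : Di hq n a ∈ stabDer hq :=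
  (mem_stabDer hq _).2 (Di_mem_der hq n a)

theorem Di_eq (hq : IsHurwitz q) (n : Fin 3) (a : C) :
    Di hq n a = -jlie hq (jiota hq n a) (je hq (n + 1)) := by
  rw [jlie_jiota_je_one, neg_neg]

/-- A derivation D satisfies [D,[L_x,L_y]] = [L_{Dx},L_y] + [L_x,L_{Dy}]. This is applied to D_n(b)
= -[L_{ι_n(b)},L_{e_{n+1}}]; D_n(a) sends ι_n(b) into the idempotents, whose multiplications
commute, so only the second term survives. -/
theorem Di_comm_self (hq : IsHurwitz q) (n : Fin 3) (a b : C) :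
    Di hq n a * Di hq n b - Di hq n b * Di hq n a
      = -⟨Dtri hq (thetaPow n ((paraC q).t a b)), Dtri_mem_stab hq _⟩ := by
  have h := stab_comm_jlie hq (Di_mem_stabDer hq n a) (jiota hq n b) (je hq (n + 1))
  rw [(Di_jiota hq n a b).1, (Di_je hq n a).2.1] at h
  simp only [map_smul, map_sub, map_neg, LinearMap.smul_apply, LinearMap.sub_apply, jlie_je_je,
    sub_zero, smul_zero, zero_add] at h
  rw [Di_eq hq n b, ← jlie_jiota_jiota, mul_neg, neg_mul, ← neg_sub', h, jlie_swap, neg_neg]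

theorem Di_comm_succ (hq : IsHurwitz q) (n : Fin 3) (a b : C) :
    Di hq n a * Di hq (n + 1) b - Di hq (n + 1) b * Di hq n a
      = Di hq (n + 2) ((paraC q).mul a b) := by
  have h := stab_comm_jlie hq (Di_mem_stabDer hq n a) (jiota hq (n + 1) b) (je hq (n + 2))
  rw [(Di_jiota hq n a b).2.1, (Di_je hq n a).2.2] at h
  simp only [map_neg, LinearMap.neg_apply, jlie_jiota_je, neg_zero, zero_add] at h
  have h2 := Di_eq hq (n + 1) b
  rw [show n + 1 + 1 = n + 2 from by simp [fin_three_add n]] at h2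
  rw [h2, mul_neg, neg_mul, ← neg_sub', h, ← jlie_swap, jlie_jiota_jiota_succ]

theorem Dtri_comm (hq : IsHurwitz q) (d e : Fin 3 → Module.End k C) :
    (⟨Dtri hq fun n => d n * e n - e n * d n, Dtri_mem_stab hq _⟩ : stab hq)
      = ⟨Dtri hq d, Dtri_mem_stab hq d⟩ * ⟨Dtri hq e, Dtri_mem_stab hq e⟩
        - ⟨Dtri hq e, Dtri_mem_stab hq e⟩ * ⟨Dtri hq d, Dtri_mem_stab hq d⟩ := by
  refine Subtype.ext (LinearMap.ext fun x => ?_)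
  rw [AddSubgroupClass.coe_sub, MulMemClass.mk_mul_mk, MulMemClass.mk_mul_mk]
  simp only [LinearMap.sub_apply, Module.End.mul_apply]
  rw [Dtri_apply, Dtri_apply hq e x, Dtri_apply hq d x]
  simp [Dtri_jiota, Finset.sum_sub_distrib]

theorem stabAct_Dtri_tone (hq : IsHurwitz q) (d : Fin 3 → Module.End k C) :
    stabAct hq ⟨Dtri hq d, Dtri_mem_stab hq d⟩ (tone hq) = 0 := by
  rw [tone_eq, stabAct_mk]
  refine (congrArg _ (Subtype.ext ?_)).trans (map_zero (jscalar hq).mkQ)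
  change Dtri hq d (je hq 0 - je hq 1) = 0
  rw [map_sub, Dtri_je, Dtri_je, sub_zero]

theorem stabAct_Dtri_tiota (hq : IsHurwitz q) (d : Fin 3 → Module.End k C) (n : Fin 3) (a : C) :
    stabAct hq ⟨Dtri hq d, Dtri_mem_stab hq d⟩ (tiota hq n a) = tiota hq n (d n a) := by
  rw [tiota_eq, tiota_eq, stabAct_mk]
  exact congrArg _ (Subtype.ext (Dtri_jiota hq d n a))

/-- In J the result is a multiple of e_{n+1}-e_{n+2}, and in T all cyclic differences of idempotents
have the class of e_0-e_1. -/
theorem stabAct_Di_tiota_self (hq : IsHurwitz q) (n : Fin 3) (a b : C) :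
    stabAct hq (Di hq n a) (tiota hq n b) = (paraC q).form a b • tone hq := by
  rw [tiota_eq, tone_eq, stabAct_mk, ← map_smul, SetLike.mk_smul_mk]
  refine mkQ_eq hq _ _ ?_ fun m => ?_
  · rw [(Di_jiota hq n a b).1]
    have h3 : (3 : k) = 0 := three_eq_zero_of_charP_three k
    fin_cases n <;> simp [jdiag_je] <;> linear_combination (paraC q).form a b * h3
  · rw [(Di_jiota hq n a b).1]
    simp [jcoord_je]

theorem stabAct_Di_tiota_succ (hq : IsHurwitz q) (n : Fin 3) (a b : C) :
    stabAct hq (Di hq n a) (tiota hq (n + 1) b) = -tiota hq (n + 2) ((paraC q).mul a b) := by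
  rw [tiota_eq, tiota_eq, stabAct_mk, ← map_neg]
  exact congrArg _ (Subtype.ext (Di_jiota hq n a b).2.1)

theorem stabAct_Di_succ_tiota (hq : IsHurwitz q) (n : Fin 3) (a b : C) :
    stabAct hq (Di hq (n + 1) a) (tiota hq n b) = tiota hq (n + 2) ((paraC q).mul b a) := by
  have h := (Di_jiota hq (n + 1) a b).2.2
  rw [show n + 1 + 2 = n from by simp [fin_three_add n],
    show n + 1 + 1 = n + 2 from by simp [fin_three_add n]] at h
  rw [tiota_eq, tiota_eq, stabAct_mk]
  exact congrArg _ (Subtype.ext h)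

theorem tform_tone_tiota (hq : IsHurwitz q) (n : Fin 3) (a : C) :
    tform hq (tone hq) (tiota hq n a) = 0 := by
  rw [tone_eq, tiota_eq, tform_mk, jform_eq]
  simp [jdiag_jiota, jcoord_je]

theorem tform_tiota_tiota (hq : IsHurwitz q) (n m : Fin 3) (a b : C) :
    tform hq (tiota hq n a) (tiota hq m b) = if n = m then (paraC q).form a b else 0 := by
  rw [tiota_eq, tiota_eq, tform_mk, jform_eq]
  simp only [jdiag_jiota, jcoord_jiota, zero_mul, zero_add]
  rw [Finset.sum_eq_single n (fun b _ hb => by simp [hb.symm]) (by simp)]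
  by_cases h : n = m <;> simp [h, eq_comm]

theorem tlie_tone_tone (hq : IsHurwitz q) : tlie hq (tone hq) (tone hq) = 0 := by
  rw [tone_eq, tlie_mk]
  simp [jlie_je_je]

theorem tlie_tone_tiota (hq : IsHurwitz q) (n : Fin 3) (a : C) :
    tlie hq (tone hq) (tiota hq n a) = -Di hq n a := by
  rw [tlie_swap, tone_eq, tiota_eq, tlie_mk, map_sub]
  have h0 := jlie_jiota_je hq n a
  have h1 := jlie_jiota_je_one hq n a
  have h2 := jlie_jiota_je_two hq n a
  fin_cases n
  · simp only [Fin.reduceFinMk, Fin.reduceAdd, Fin.zero_eta, zero_add] at h0 h1 h2 ⊢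
    rw [h0, h1]; simp
  · simp only [Fin.reduceFinMk, Fin.reduceAdd, Fin.mk_one] at h0 h1 h2 ⊢
    rw [h0, h2]; simp
  · simp only [Fin.reduceFinMk, Fin.reduceAdd] at h0 h1 h2 ⊢
    rw [h1, h2]
    have h3 := three_smul_eq_zero (k := k) (Di hq 2 a)
    linear_combination (norm := module) h3

theorem tlie_tiota_tiota (hq : IsHurwitz q) (n : Fin 3) (a b : C) :
    tlie hq (tiota hq n a) (tiota hq n b)
      = ⟨Dtri hq (thetaPow n ((paraC q).t a b)), Dtri_mem_stab hq _⟩ := by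
  rw [tiota_eq, tiota_eq, tlie_mk, jlie_jiota_jiota]

theorem tlie_tiota_tiota_succ (hq : IsHurwitz q) (n : Fin 3) (a b : C) :
    tlie hq (tiota hq n a) (tiota hq (n + 1) b) = Di hq (n + 2) ((paraC q).mul a b) := by
  rw [tiota_eq, tiota_eq, tlie_mk, jlie_jiota_jiota_succ]

end Products


/-! ## Compatibility of `Ψ` with the brackets -/

section Compat

variable {k V C : Type*} [Field k] [CharP k 3] [AddCommGroup V] [Module k V] [NonAssocRing C]
  [Module k C] [IsScalarTower k C C] [SMulCommClass k C C]
  {ω : LinearMap.BilinForm k V} {q : QuadraticForm k C}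

namespace Magic

/-- The product of `X` and `Y` has parity `i`, and `Ψ` preserves it. -/
def Compat (ω : LinearMap.BilinForm k V) (hq : IsHurwitz q) (i : ZMod 2)
    (X Y : MagicSpace k (k × V) C) : Prop :=
  bracket (superS ω) (paraC q) X Y ∈ part (superS ω) (paraC q) i ∧
    psiLin V hq (bracket (superS ω) (paraC q) X Y)
      = GJ.bracket ω hq (psiLin V hq X) (psiLin V hq Y)

theorem Compat.of_eq {hq : IsHurwitz q} {i : ZMod 2} {X Y Z : MagicSpace k (k × V) C}
    (e : bracket (superS ω) (paraC q) X Y = Z) (hZ : Z ∈ part (superS ω) (paraC q) i)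
    (h : psiLin V hq Z = GJ.bracket ω hq (psiLin V hq X) (psiLin V hq Y)) :
    Compat ω hq i X Y := by
  subst e
  exact ⟨hZ, h⟩

theorem compat_sp_sp (hV : Module.finrank k V = 2) (hω : ω.IsAlt) (hq : IsHurwitz q)
    {f g : Module.End k V} (hf : f ∈ spV ω) (hg : g ∈ spV ω) :
    Compat ω hq 0 (fun _ => evenS f, 0, 0) (fun _ => evenS g, 0, 0) := by
  have e : bracket (superS ω) (paraC q) (fun _ => evenS f, 0, 0) (fun _ => evenS g, 0, 0)
      = (fun _ => evenS (f * g - g * f), 0, 0) := by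
    rw [bracket_tri_tri _ _ (IsGen.mem hV hω (.sp f hf)) (IsGen.mem hV hω (.sp g hg)),
      koszul_zero_left]
    refine Prod.ext (funext fun _ => LinearMap.ext fun x => ?_) (Prod.ext ?_ rfl)
    · simp
    · funext n; simp
  refine .of_eq e (IsGen.mem hV hω (.sp _ (spV_comm hf hg))) ?_
  rw [psiLin_sp, psiLin_sp, psiLin_sp, bracket_GJ_even_even]
  simp

theorem compat_sp_tri (hV : Module.finrank k V = 2) (hω : ω.IsAlt) (hq : IsHurwitz q)
    {f : Module.End k V} (hf : f ∈ spV ω) {d : Fin 3 → Module.End k C}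
    (hd : d ∈ (paraC q).tri 0) : Compat ω hq 0 (fun _ => evenS f, 0, 0) (0, d, 0) := by
  refine .of_eq (Z := 0) ?_ (Submodule.zero_mem _) ?_
  · rw [bracket_tri_tri _ _ (IsGen.mem hV hω (.sp f hf)) (IsGen.mem hV hω (.tri d hd)),
      koszul_zero_left]
    refine Prod.ext ?_ (Prod.ext ?_ rfl) <;> funext n <;> simp
  · rw [psiLin_sp, psiLin_tri, bracket_GJ_even_even]
    simp only [map_zero, mul_zero, zero_mul, sub_zero]
    rfl

theorem compat_sp_iotaOne (hV : Module.finrank k V = 2) (hω : ω.IsAlt) (hq : IsHurwitz q)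
    {f : Module.End k V} (hf : f ∈ spV ω) (n : Fin 3) (a : C) :
    Compat ω hq 0 (fun _ => evenS f, 0, 0) (iota n ((1, 0) ⊗ₜ a)) := by
  refine .of_eq (Z := 0) ?_ (Submodule.zero_mem _) ?_
  · rw [bracket_tri_iota _ _ (IsGen.mem hV hω (.sp f hf)) (IsGen.mem hV hω (.iotaOne n a))]
    simp [rAct_paraC, iota, ← Prod.zero_eq_mk]
  · rw [psiLin_sp, psiLin_iota_one, bracket_GJ_even_even]
    simp only [map_zero, mul_zero, zero_mul, sub_zero]
    rfl

theorem compat_sp_odd (hV : Module.finrank k V = 2) (hω : ω.IsAlt) (hq : IsHurwitz q)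
    {f : Module.End k V} (hf : f ∈ spV ω) (u : V) :
    Compat ω hq 1 (fun _ => evenS f, 0, 0) (fun _ => oddS ω u, 0, 0) := by
  refine .of_eq (Z := (fun _ => oddS ω (f u), 0, 0)) ?_ (IsGen.mem hV hω (.odd _)) ?_
  · rw [bracket_tri_tri _ _ (IsGen.mem hV hω (.sp f hf)) (IsGen.mem hV hω (.odd u)),
      koszul_zero_left]
    refine Prod.ext (funext fun _ => LinearMap.ext fun x => ?_) (Prod.ext ?_ rfl)
    · have h := (mem_spV ω f).1 hf u x.2
      refine Prod.ext ?_ ?_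
      · simp [oddS_apply]
        linear_combination h
      · simp [oddS_apply]
    · funext n; simp
  · rw [psiLin_sp, psiLin_odd, psiLin_odd, bracket_GJ_even_odd, GJ_act_tmul]
    simp

theorem compat_sp_iotaOdd (hV : Module.finrank k V = 2) (hω : ω.IsAlt) (hq : IsHurwitz q)
    {f : Module.End k V} (hf : f ∈ spV ω) (n : Fin 3) (u : V) (s : C) :
    Compat ω hq 1 (fun _ => evenS f, 0, 0) (iota n ((0, u) ⊗ₜ s)) := by
  refine .of_eq (Z := iota n ((0, f u) ⊗ₜ s)) ?_ (IsGen.mem hV hω (.iotaOdd _ _ _)) ?_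
  · rw [bracket_tri_iota _ _ (IsGen.mem hV hω (.sp f hf)) (IsGen.mem hV hω (.iotaOdd n u s))]
    simp [rAct_paraC]
  · rw [psiLin_sp, psiLin_iota_odd, psiLin_iota_odd, bracket_GJ_even_odd, GJ_act_tmul]
    simp

theorem compat_tri_tri (hV : Module.finrank k V = 2) (hω : ω.IsAlt) (hq : IsHurwitz q)
    {d e : Fin 3 → Module.End k C} (hd : d ∈ (paraC q).tri 0)
    (he : e ∈ (paraC q).tri 0) : Compat ω hq 0 (0, d, 0) (0, e, 0) := by
  have hde : (fun n => d n * e n - e n * d n) ∈ (paraC q).tri 0 := by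
    rw [paraC_mem_tri_zero] at hd he ⊢
    refine ⟨fun n x y => ?_, fun x y => ?_⟩
    · simp only [LinearMap.sub_apply, Module.End.mul_apply, map_sub]
      linear_combination hd.1 n (e n x) y - he.1 n (d n x) y + hd.1 n x (e n y)
        - he.1 n x (d n y)
    · simp only [LinearMap.sub_apply, Module.End.mul_apply, map_sub, he.2, hd.2, map_add]
      abel
  refine .of_eq (Z := (0, fun n => d n * e n - e n * d n, 0)) ?_ (IsGen.mem hV hω (.tri _ hde)) ?_
  · rw [bracket_tri_tri _ _ (IsGen.mem hV hω (.tri d hd)) (IsGen.mem hV hω (.tri e he)),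
      koszul_zero_left]
    refine Prod.ext ?_ (Prod.ext ?_ rfl) <;> funext n <;> simp
  · rw [psiLin_tri, psiLin_tri, psiLin_tri, bracket_GJ_even_even]
    refine Prod.ext (by simp) (Prod.ext ?_ rfl)
    exact Dtri_comm hq d e

theorem compat_tri_iotaOne (hV : Module.finrank k V = 2) (hω : ω.IsAlt) (hq : IsHurwitz q)
    {d : Fin 3 → Module.End k C} (hd : d ∈ (paraC q).tri 0) (n : Fin 3)
    (a : C) : Compat ω hq 0 (0, d, 0) (iota n ((1, 0) ⊗ₜ a)) := by
  refine .of_eq (Z := iota n ((1, 0) ⊗ₜ d n a)) ?_ (IsGen.mem hV hω (.iotaOne _ _)) ?_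
  · rw [bracket_tri_iota _ _ (IsGen.mem hV hω (.tri d hd)) (IsGen.mem hV hω (.iotaOne n a))]
    simp [rAct_paraC]
  · rw [psiLin_tri, psiLin_iota_one, psiLin_iota_one, bracket_GJ_even_even]
    refine Prod.ext (by simp) (Prod.ext ?_ rfl)
    have hD : (⟨Dtri hq d, Dtri_mem_stab hq d⟩ : stab hq) ∈ stabDer hq :=
      (mem_stabDer hq _).2 (Dtri_mem_der hq hd)
    have h := stab_comm_jlie hq hD (jiota hq n a) (je hq (n + 1))
    rw [Dtri_jiota, Dtri_je, map_zero, add_zero] at h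
    rw [Di_eq, Di_eq, mul_neg, neg_mul, ← neg_sub', h]

theorem compat_tri_odd (hV : Module.finrank k V = 2) (hω : ω.IsAlt) (hq : IsHurwitz q)
    {d : Fin 3 → Module.End k C} (hd : d ∈ (paraC q).tri 0) (u : V) :
    Compat ω hq 1 (0, d, 0) (fun _ => oddS ω u, 0, 0) := by
  refine .of_eq (Z := 0) ?_ (Submodule.zero_mem _) ?_
  · rw [bracket_tri_tri _ _ (IsGen.mem hV hω (.tri d hd)) (IsGen.mem hV hω (.odd u)),
      koszul_zero_left]
    refine Prod.ext ?_ (Prod.ext ?_ rfl) <;> funext n <;> simp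
  · rw [psiLin_tri, psiLin_odd, bracket_GJ_even_odd, GJ_act_tmul, stabAct_Dtri_tone]
    simp only [map_zero, LinearMap.zero_apply, TensorProduct.zero_tmul, TensorProduct.tmul_zero,
      add_zero]
    rfl

theorem compat_tri_iotaOdd (hV : Module.finrank k V = 2) (hω : ω.IsAlt) (hq : IsHurwitz q)
    {d : Fin 3 → Module.End k C} (hd : d ∈ (paraC q).tri 0) (n : Fin 3)
    (u : V) (s : C) : Compat ω hq 1 (0, d, 0) (iota n ((0, u) ⊗ₜ s)) := by
  refine .of_eq (Z := iota n ((0, u) ⊗ₜ d n s)) ?_ (IsGen.mem hV hω (.iotaOdd _ _ _)) ?_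
  · rw [bracket_tri_iota _ _ (IsGen.mem hV hω (.tri d hd)) (IsGen.mem hV hω (.iotaOdd n u s))]
    simp [rAct_paraC]
  · rw [psiLin_tri, psiLin_iota_odd, psiLin_iota_odd, bracket_GJ_even_odd, GJ_act_tmul,
      stabAct_Dtri_tiota]
    simp

theorem compat_odd_iotaOne (hV : Module.finrank k V = 2) (hω : ω.IsAlt) (hq : IsHurwitz q)
    (u : V) (n : Fin 3) (a : C) :
    Compat ω hq 1 (fun _ => oddS ω u, 0, 0) (iota n ((1, 0) ⊗ₜ a)) := by
  -- The sign is σ_{1,u}(1) = 2u = -u; on the other side it comes from the order odd before even.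
  refine .of_eq (Z := iota n ((0, -u) ⊗ₜ a)) ?_ (IsGen.mem hV hω (.iotaOdd _ _ _)) ?_
  · rw [bracket_tri_iota _ _ (IsGen.mem hV hω (.odd u)) (IsGen.mem hV hω (.iotaOne n a))]
    simp [rAct_paraC, oddS_apply, two_eq_neg_one_of_charP_three]
  · rw [psiLin_odd, psiLin_iota_one, psiLin_iota_odd, bracket_GJ_odd_even, GJ_act_tmul,
      stabAct_tone]
    simp [TensorProduct.neg_tmul]

theorem compat_odd_odd (hV : Module.finrank k V = 2) (hω : ω.IsAlt) (hq : IsHurwitz q)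
    (u v : V) :
    Compat ω hq 0 (fun _ => oddS ω u, 0, 0) (fun _ => oddS ω v, 0, 0) := by
  -- The anticommutator of σ_{1,u} and σ_{1,v} is γ_{u,v}; it matches because e_0-e_1 has norm -1
  -- for the form on T.
  refine .of_eq (Z := (fun _ => evenS (gammaV ω u v), 0, 0)) ?_
    (IsGen.mem hV hω (.sp _ (gammaV_mem_spV hω u v))) ?_
  · rw [bracket_tri_tri _ _ (IsGen.mem hV hω (.odd u)) (IsGen.mem hV hω (.odd v)),
      koszul_one_one]
    refine Prod.ext (funext fun _ => LinearMap.ext fun x => ?_) (Prod.ext ?_ rfl)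
    · have h := hω.neg_eq u v
      refine Prod.ext ?_ ?_
      · simp [oddS_apply, ← h]
      · simp [oddS_apply, gammaV_apply, two_eq_neg_one_of_charP_three]
        abel
    · funext n; simp
  · rw [psiLin_odd, psiLin_odd, psiLin_sp, bracket_GJ_odd_odd, gammaPart_tmul, liePart_tmul,
      tform_tone_tone, tlie_tone_tone]
    simp

theorem compat_odd_iotaOdd (hV : Module.finrank k V = 2) (hω : ω.IsAlt) (hq : IsHurwitz q)
    (u : V) (n : Fin 3) (v : V) (s : C) :
    Compat ω hq 0 (fun _ => oddS ω u, 0, 0) (iota n ((0, v) ⊗ₜ s)) := by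
  refine .of_eq (Z := iota n ((1, 0) ⊗ₜ (-ω u v • s))) ?_ (IsGen.mem hV hω (.iotaOne _ _)) ?_
  · rw [bracket_tri_iota _ _ (IsGen.mem hV hω (.odd u)) (IsGen.mem hV hω (.iotaOdd n v s)),
      TensorProduct.tmul_smul, TensorProduct.smul_tmul']
    simp [rAct_paraC, oddS_apply]
  · rw [psiLin_odd, psiLin_iota_one, psiLin_iota_odd, bracket_GJ_odd_odd, gammaPart_tmul,
      liePart_tmul, tform_tone_tiota, tlie_tone_tiota, ← DiLin_apply, ← DiLin_apply, map_smul]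
    simp

theorem compat_iotaOne_iotaOne_self (hV : Module.finrank k V = 2) (hω : ω.IsAlt) (hq : IsHurwitz q)
    (n : Fin 3) (a b : C) :
    Compat ω hq 0 (iota n ((1, 0) ⊗ₜ a)) (iota n ((1, 0) ⊗ₜ b)) := by
  -- Only the second triple contributes, as t_{1,1} = 0, with coefficient b(1,1) = 2 = -1.
  refine .of_eq (Z := -(0, thetaPow n ((paraC q).t a b), 0)) ?_
    (Submodule.neg_mem _ (IsGen.mem hV hω (.tri _ (hq.thetaPow_t_mem_tri n a b)))) ?_
  · rw [bracket_iota_iota (S := k × V) _ _ (IsGen.mem hV hω (.iotaOne n a)) (IsGen.mem hV hω (.iotaOne n b)),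
      tPart_paraC, tPart'_paraC, superS_t_one_one, superS_form]
    refine Prod.ext ?_ (Prod.ext ?_ ?_)
    · funext m; simp [thetaPow]
    · funext m; simp [thetaPow, two_eq_neg_one_of_charP_three]
    · simp
  · rw [map_neg, psiLin_tri, psiLin_iota_one, psiLin_iota_one, bracket_GJ_even_even, Di_comm_self]
    simp

theorem compat_iotaOne_iotaOne_succ (hV : Module.finrank k V = 2) (hω : ω.IsAlt) (hq : IsHurwitz q)
    (n : Fin 3) (a b : C) :
    Compat ω hq 0 (iota n ((1, 0) ⊗ₜ a)) (iota (n + 1) ((1, 0) ⊗ₜ b)) := by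
  refine .of_eq (Z := iota (n + 2) ((1, 0) ⊗ₜ (paraC q).mul a b)) ?_
    (IsGen.mem hV hω (.iotaOne _ _)) ?_
  · rw [bracket_iota_iota_succ (S := k × V) _ _ (IsGen.mem hV hω (.iotaOne n a))
      (IsGen.mem hV hω (.iotaOne (n + 1) b)), tensorMul_paraC, superS_mul]
    simp
  · rw [psiLin_iota_one, psiLin_iota_one, psiLin_iota_one, bracket_GJ_even_even, Di_comm_succ]
    simp

theorem compat_iotaOne_iotaOdd_self (hV : Module.finrank k V = 2) (hω : ω.IsAlt) (hq : IsHurwitz q)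
    (n : Fin 3) (a : C) (u : V) (s : C) :
    Compat ω hq 1 (iota n ((1, 0) ⊗ₜ a)) (iota n ((0, u) ⊗ₜ s)) := by
  refine .of_eq (Z := (paraC q).form a s • (fun _ => oddS ω u, 0, 0)) ?_
    (Submodule.smul_mem _ _ (IsGen.mem hV hω (.odd u))) ?_
  · rw [bracket_iota_iota (S := k × V) _ _ (IsGen.mem hV hω (.iotaOne n a))
      (IsGen.mem hV hω (.iotaOdd n u s)), tPart_paraC, tPart'_paraC, superS_t_one_odd hω,
      superS_form]
    refine Prod.ext ?_ (Prod.ext ?_ ?_)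
    · funext m; simp [thetaPow]
    · funext m; simp [thetaPow]
    · simp
  · rw [map_smul, psiLin_odd, psiLin_iota_one, psiLin_iota_odd, bracket_GJ_even_odd, GJ_act_tmul,
      stabAct_Di_tiota_self]
    simp

theorem compat_iotaOne_iotaOdd_succ (hV : Module.finrank k V = 2) (hω : ω.IsAlt) (hq : IsHurwitz q)
    (n : Fin 3) (a : C) (u : V) (s : C) :
    Compat ω hq 1 (iota n ((1, 0) ⊗ₜ a)) (iota (n + 1) ((0, u) ⊗ₜ s)) := by
  refine .of_eq (Z := iota (n + 2) ((0, -u) ⊗ₜ (paraC q).mul a s)) ?_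
    (IsGen.mem hV hω (.iotaOdd _ _ _)) ?_
  · rw [bracket_iota_iota_succ (S := k × V) _ _ (IsGen.mem hV hω (.iotaOne n a))
      (IsGen.mem hV hω (.iotaOdd (n + 1) u s)), tensorMul_paraC, superS_mul]
    simp
  · rw [psiLin_iota_odd, psiLin_iota_odd, psiLin_iota_one, bracket_GJ_even_odd, GJ_act_tmul,
      stabAct_Di_tiota_succ]
    simp [TensorProduct.neg_tmul, TensorProduct.tmul_neg]

theorem compat_iotaOdd_iotaOne_succ (hV : Module.finrank k V = 2) (hω : ω.IsAlt) (hq : IsHurwitz q)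
    (n : Fin 3) (a : C) (u : V) (s : C) :
    Compat ω hq 1 (iota n ((0, u) ⊗ₜ s)) (iota (n + 1) ((1, 0) ⊗ₜ a)) := by
  refine .of_eq (Z := iota (n + 2) ((0, -u) ⊗ₜ (paraC q).mul s a)) ?_
    (IsGen.mem hV hω (.iotaOdd _ _ _)) ?_
  · rw [bracket_iota_iota_succ (S := k × V) _ _ (IsGen.mem hV hω (.iotaOdd n u s))
      (IsGen.mem hV hω (.iotaOne (n + 1) a)), tensorMul_paraC, superS_mul]
    simp
  · rw [psiLin_iota_odd, psiLin_iota_odd, psiLin_iota_one, bracket_GJ_odd_even, GJ_act_tmul,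
      stabAct_Di_succ_tiota]
    simp [TensorProduct.neg_tmul]

theorem compat_iotaOdd_iotaOdd_self (hV : Module.finrank k V = 2) (hω : ω.IsAlt) (hq : IsHurwitz q)
    (n : Fin 3) (u v : V) (s s' : C) :
    Compat ω hq 0 (iota n ((0, u) ⊗ₜ s)) (iota n ((0, v) ⊗ₜ s')) := by
  refine .of_eq (Z := -((paraC q).form s s') • (fun _ => evenS (gammaV ω u v), 0, 0)
      + ω u v • (0, thetaPow n ((paraC q).t s s'), 0)) ?_
    (Submodule.add_mem _
      (Submodule.smul_mem _ _ (IsGen.mem hV hω (.sp _ (gammaV_mem_spV hω u v))))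
      (Submodule.smul_mem _ _ (IsGen.mem hV hω (.tri _ (hq.thetaPow_t_mem_tri n s s'))))) ?_
  · rw [bracket_iota_iota (S := k × V) _ _ (IsGen.mem hV hω (.iotaOdd n u s))
      (IsGen.mem hV hω (.iotaOdd n v s')), tPart_paraC, tPart'_paraC, superS_t_odd_odd hV hω,
      superS_form]
    refine Prod.ext ?_ (Prod.ext ?_ ?_)
    · funext m; refine LinearMap.ext fun x => ?_; simp [thetaPow]
    · funext m; simp [thetaPow]
    · simp
  · rw [map_add, map_smul, map_smul, psiLin_sp, psiLin_tri, psiLin_iota_odd, psiLin_iota_odd,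
      bracket_GJ_odd_odd, gammaPart_tmul, liePart_tmul, tform_tiota_tiota, tlie_tiota_tiota]
    simp

theorem compat_iotaOdd_iotaOdd_succ (hV : Module.finrank k V = 2) (hω : ω.IsAlt) (hq : IsHurwitz q)
    (n : Fin 3) (u v : V) (s s' : C) :
    Compat ω hq 0 (iota n ((0, u) ⊗ₜ s)) (iota (n + 1) ((0, v) ⊗ₜ s')) := by
  refine .of_eq (Z := iota (n + 2) ((1, 0) ⊗ₜ (ω u v • (paraC q).mul s s'))) ?_
    (IsGen.mem hV hω (.iotaOne _ _)) ?_
  · rw [bracket_iota_iota_succ (S := k × V) _ _ (IsGen.mem hV hω (.iotaOdd n u s))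
      (IsGen.mem hV hω (.iotaOdd (n + 1) v s')), tensorMul_paraC, superS_mul,
      TensorProduct.tmul_smul, TensorProduct.smul_tmul']
    simp
  · rw [psiLin_iota_odd, psiLin_iota_odd, psiLin_iota_one, bracket_GJ_odd_odd, gammaPart_tmul,
      liePart_tmul, tform_tiota_tiota, tlie_tiota_tiota_succ, if_neg (by simp),
      ← DiLin_apply, ← DiLin_apply, map_smul]
    simp

end Magic

end Compat


/-! ### Reversed pairs of generators and extension to all homogeneous elements -/

section CompatAll

variable {k V C : Type*} [Field k] [CharP k 3] [AddCommGroup V] [Module k V] [NonAssocRing C]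
  [Module k C] [IsScalarTower k C C] [SMulCommClass k C C]
  {ω : LinearMap.BilinForm k V} {q : QuadraticForm k C}

namespace Magic

theorem bracket_tri_tri_swap {S S' : Type*} [AddCommGroup S] [Module k S] [AddCommGroup S']
    [Module k S'] (A : FormedSuperalgebra k S) (B : FormedSuperalgebra k S') {i j : ZMod 2}
    {d e : Fin 3 → Module.End k S} {d' e' : Fin 3 → Module.End k S'}
    (hX : (d, d', 0) ∈ part A B i) (hY : (e, e', 0) ∈ part A B j) :
    bracket A B (e, e', 0) (d, d', 0) = -(koszul k j i • bracket A B (d, d', 0) (e, e', 0)) := by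
  rw [bracket_tri_tri A B hX hY, bracket_tri_tri A B hY hX]
  rcases zmod_two_cases i with rfl | rfl <;> rcases zmod_two_cases j with rfl | rfl <;>
    simp only [koszul_zero_left, koszul_zero_right, koszul_one_one] <;>
    refine Prod.ext (funext fun n => ?_) (Prod.ext (funext fun n => ?_) ?_) <;> simp <;> abel

/-- For equal indices the bracket is given by t_{x,y} in either order, so its anticommutativity is
not built into the definition; this order is therefore checked directly. -/
theorem compat_iotaOdd_iotaOne_self (hV : Module.finrank k V = 2) (hω : ω.IsAlt)
    (hq : IsHurwitz q) (n : Fin 3) (a : C) (u : V) (s : C) :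
    Compat ω hq 1 (iota n ((0, u) ⊗ₜ s)) (iota n ((1, 0) ⊗ₜ a)) := by
  refine .of_eq (Z := -((paraC q).form s a) • (fun _ => oddS ω u, 0, 0)) ?_
    (Submodule.smul_mem _ _ (IsGen.mem hV hω (.odd u))) ?_
  · rw [bracket_iota_iota (S := k × V) _ _ (IsGen.mem hV hω (.iotaOdd n u s))
      (IsGen.mem hV hω (.iotaOne n a)), tPart_paraC, tPart'_paraC, superS_t_odd_one hω,
      superS_form]
    refine Prod.ext ?_ (Prod.ext ?_ ?_)
    · funext m; simp [thetaPow]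
    · funext m; simp [thetaPow]
    · simp
  · rw [map_smul, psiLin_odd, psiLin_iota_one, psiLin_iota_odd, bracket_GJ_odd_even, GJ_act_tmul,
      stabAct_Di_tiota_self, paraC_form_comm]
    simp

/-- The super-anticommutativity of the product of `X` and `Y`. -/
def SkewPair (ω : LinearMap.BilinForm k V) (q : QuadraticForm k C) (i j : ZMod 2)
    (X Y : MagicSpace k (k × V) C) : Prop :=
  bracket (superS ω) (paraC q) Y X = -(koszul k j i • bracket (superS ω) (paraC q) X Y)

theorem skewPair_tri_tri (hV : Module.finrank k V = 2) (hω : ω.IsAlt) {i j : ZMod 2}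
    {d e : Fin 3 → Module.End k (k × V)} {d' e' : Fin 3 → Module.End k C}
    (hX : IsGen ω q i (d, d', 0)) (hY : IsGen ω q j (e, e', 0)) :
    SkewPair ω q i j (d, d', 0) (e, e', 0) := by
  unfold SkewPair
  rw [bracket_tri_tri_swap (S := k × V) _ _ (IsGen.mem hV hω hX) (IsGen.mem hV hω hY)]

theorem skewPair_tri_iota (hV : Module.finrank k V = 2) (hω : ω.IsAlt) {i j : ZMod 2}
    {d : Fin 3 → Module.End k (k × V)} {d' : Fin 3 → Module.End k C} {n : Fin 3}
    {x : k × V} {a : C} (hX : IsGen ω q i (d, d', 0)) (hY : IsGen ω q j (iota n (x ⊗ₜ a))) :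
    SkewPair ω q i j (d, d', 0) (iota n (x ⊗ₜ a)) := by
  unfold SkewPair
  rw [bracket_iota_tri (S := k × V) _ _ (IsGen.mem hV hω hY) (IsGen.mem hV hω hX)]

theorem skewPair_iota_iota_succ (hV : Module.finrank k V = 2) (hω : ω.IsAlt) {i j : ZMod 2}
    {n : Fin 3} {x y : k × V} {a b : C} (hX : IsGen ω q i (iota n (x ⊗ₜ a)))
    (hY : IsGen ω q j (iota (n + 1) (y ⊗ₜ b))) :
    SkewPair ω q i j (iota n (x ⊗ₜ a)) (iota (n + 1) (y ⊗ₜ b)) := by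
  unfold SkewPair
  rw [bracket_iota_succ_iota (S := k × V) _ _ (IsGen.mem hV hω hY) (IsGen.mem hV hω hX)]

/-- Super-anticommutativity holds in g(J) and, for the given pair, by construction in g(S_{1,2},S),
so compatibility in one order implies it in the other. -/
theorem Compat.swap (hV : Module.finrank k V = 2) (hω : ω.IsAlt) (hω0 : ω ≠ 0) {hq : IsHurwitz q}
    {i j l : ZMod 2} {X Y : MagicSpace k (k × V) C} (h : Compat ω hq l X Y)
    (hX : IsGen ω q i X) (hY : IsGen ω q j Y) (hs : SkewPair ω q i j X Y) :
    Compat ω hq l Y X := by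
  refine .of_eq hs (Submodule.neg_mem _ (Submodule.smul_mem _ _ h.1)) ?_
  rw [map_neg, map_smul, h.2, GJ_skew hω hq j i
    (psiLin_mem_part hV hω hω0 hq (IsGen.mem hV hω hY))
    (psiLin_mem_part hV hω hω0 hq (IsGen.mem hV hω hX))]

theorem compat_iota_iota (hV : Module.finrank k V = 2) (hω : ω.IsAlt) (hω0 : ω ≠ 0)
    (hq : IsHurwitz q) {i j l : ZMod 2} {x y : k × V} {a b : C} (n m : Fin 3)
    (hX : ∀ n, IsGen ω q i (iota n (x ⊗ₜ a))) (hY : ∀ n, IsGen ω q j (iota n (y ⊗ₜ b)))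
    (h0 : ∀ n, Compat ω hq l (iota n (x ⊗ₜ a)) (iota n (y ⊗ₜ b)))
    (h1 : ∀ n, Compat ω hq l (iota n (x ⊗ₜ a)) (iota (n + 1) (y ⊗ₜ b)))
    (h2 : ∀ n, Compat ω hq l (iota n (y ⊗ₜ b)) (iota (n + 1) (x ⊗ₜ a))) :
    Compat ω hq l (iota n (x ⊗ₜ a)) (iota m (y ⊗ₜ b)) := by
  rcases fin_three_cases n m with h | h | h
  · rw [h]; exact h0 n
  · rw [h]; exact h1 n
  · have e : n = m + 1 := by rw [h]; simp [fin_three_add n]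
    rw [e]
    exact (h2 m).swap hV hω hω0 (hY m) (hX (m + 1))
      (skewPair_iota_iota_succ hV hω (hY m) (hX (m + 1)))

theorem compat_gen (hV : Module.finrank k V = 2) (hω : ω.IsAlt) (hω0 : ω ≠ 0) (hq : IsHurwitz q)
    {i j : ZMod 2} {X Y : MagicSpace k (k × V) C} (hX : IsGen ω q i X) (hY : IsGen ω q j Y) :
    Compat ω hq (i + j) X Y := by
  have e00 : (0 + 0 : ZMod 2) = 0 := rfl
  have e01 : (0 + 1 : ZMod 2) = 1 := rfl
  have e10 : (1 + 0 : ZMod 2) = 1 := rfl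
  have e11 : (1 + 1 : ZMod 2) = 0 := rfl
  have hX' := hX
  have hY' := hY
  cases hX with
  | sp f hf =>
    cases hY with
    | sp g hg => rw [e00]; exact compat_sp_sp hV hω hq hf hg
    | tri d hd => rw [e00]; exact compat_sp_tri hV hω hq hf hd
    | iotaOne n a => rw [e00]; exact compat_sp_iotaOne hV hω hq hf n a
    | odd u => rw [e01]; exact compat_sp_odd hV hω hq hf u
    | iotaOdd n u s => rw [e01]; exact compat_sp_iotaOdd hV hω hq hf n u s
  | tri d hd =>
    cases hY with
    | sp g hg =>
      rw [e00]
      exact (compat_sp_tri hV hω hq hg hd).swap hV hω hω0 hY' hX'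
        (skewPair_tri_tri hV hω hY' hX')
    | tri e he => rw [e00]; exact compat_tri_tri hV hω hq hd he
    | iotaOne n a => rw [e00]; exact compat_tri_iotaOne hV hω hq hd n a
    | odd u => rw [e01]; exact compat_tri_odd hV hω hq hd u
    | iotaOdd n u s => rw [e01]; exact compat_tri_iotaOdd hV hω hq hd n u s
  | iotaOne n a =>
    cases hY with
    | sp g hg =>
      rw [e00]
      exact (compat_sp_iotaOne hV hω hq hg n a).swap hV hω hω0 hY' hX'
        (skewPair_tri_iota hV hω hY' hX')
    | tri e he =>
      rw [e00]
      exact (compat_tri_iotaOne hV hω hq he n a).swap hV hω hω0 hY' hX'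
        (skewPair_tri_iota hV hω hY' hX')
    | iotaOne m b =>
      rw [e00]
      exact compat_iota_iota hV hω hω0 hq n m (fun n => .iotaOne n a) (fun n => .iotaOne n b)
        (fun n => compat_iotaOne_iotaOne_self hV hω hq n a b)
        (fun n => compat_iotaOne_iotaOne_succ hV hω hq n a b)
        (fun n => compat_iotaOne_iotaOne_succ hV hω hq n b a)
    | odd u =>
      rw [e01]
      exact (compat_odd_iotaOne hV hω hq u n a).swap hV hω hω0 hY' hX'
        (skewPair_tri_iota hV hω hY' hX')
    | iotaOdd m u s =>
      rw [e01]
      exact compat_iota_iota hV hω hω0 hq n m (fun n => .iotaOne n a) (fun n => .iotaOdd n u s)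
        (fun n => compat_iotaOne_iotaOdd_self hV hω hq n a u s)
        (fun n => compat_iotaOne_iotaOdd_succ hV hω hq n a u s)
        (fun n => compat_iotaOdd_iotaOne_succ hV hω hq n a u s)
  | odd u =>
    cases hY with
    | sp g hg =>
      rw [e10]
      exact (compat_sp_odd hV hω hq hg u).swap hV hω hω0 hY' hX'
        (skewPair_tri_tri hV hω hY' hX')
    | tri e he =>
      rw [e10]
      exact (compat_tri_odd hV hω hq he u).swap hV hω hω0 hY' hX'
        (skewPair_tri_tri hV hω hY' hX')
    | iotaOne n a => rw [e10]; exact compat_odd_iotaOne hV hω hq u n a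
    | odd v => rw [e11]; exact compat_odd_odd hV hω hq u v
    | iotaOdd n v s => rw [e11]; exact compat_odd_iotaOdd hV hω hq u n v s
  | iotaOdd n u s =>
    cases hY with
    | sp g hg =>
      rw [e10]
      exact (compat_sp_iotaOdd hV hω hq hg n u s).swap hV hω hω0 hY' hX'
        (skewPair_tri_iota hV hω hY' hX')
    | tri e he =>
      rw [e10]
      exact (compat_tri_iotaOdd hV hω hq he n u s).swap hV hω hω0 hY' hX'
        (skewPair_tri_iota hV hω hY' hX')
    | iotaOne m a =>
      rw [e10]
      exact compat_iota_iota hV hω hω0 hq n m (fun n => .iotaOdd n u s) (fun n => .iotaOne n a)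
        (fun n => compat_iotaOdd_iotaOne_self hV hω hq n a u s)
        (fun n => compat_iotaOdd_iotaOne_succ hV hω hq n a u s)
        (fun n => compat_iotaOne_iotaOdd_succ hV hω hq n a u s)
    | odd v =>
      rw [e11]
      exact (compat_odd_iotaOdd hV hω hq v n u s).swap hV hω hω0 hY' hX'
        (skewPair_tri_iota hV hω hY' hX')
    | iotaOdd m v s' =>
      rw [e11]
      exact compat_iota_iota hV hω hω0 hq n m (fun n => .iotaOdd n u s) (fun n => .iotaOdd n v s')
        (fun n => compat_iotaOdd_iotaOdd_self hV hω hq n u v s s')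
        (fun n => compat_iotaOdd_iotaOdd_succ hV hω hq n u v s s')
        (fun n => compat_iotaOdd_iotaOdd_succ hV hω hq n v u s' s)

theorem Compat.zero_left (hq : IsHurwitz q) (i : ZMod 2) (Y : MagicSpace k (k × V) C) :
    Compat ω hq i 0 Y := by
  refine .of_eq (Z := 0) ?_ (Submodule.zero_mem _) ?_
  · rw [map_zero, LinearMap.zero_apply]
  · rw [map_zero, map_zero, LinearMap.zero_apply]

theorem Compat.zero_right (hq : IsHurwitz q) (i : ZMod 2) (X : MagicSpace k (k × V) C) :
    Compat ω hq i X 0 := by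
  refine .of_eq (Z := 0) ?_ (Submodule.zero_mem _) ?_
  · rw [map_zero]
  · rw [map_zero, map_zero]

theorem Compat.add_left {hq : IsHurwitz q} {i : ZMod 2} {X X' Y : MagicSpace k (k × V) C}
    (h : Compat ω hq i X Y) (h' : Compat ω hq i X' Y) : Compat ω hq i (X + X') Y := by
  refine .of_eq ?_ (Submodule.add_mem _ h.1 h'.1) ?_
  · rw [map_add, LinearMap.add_apply]
  · rw [map_add, map_add, map_add, LinearMap.add_apply, h.2, h'.2]

theorem Compat.add_right {hq : IsHurwitz q} {i : ZMod 2} {X Y Y' : MagicSpace k (k × V) C}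
    (h : Compat ω hq i X Y) (h' : Compat ω hq i X Y') : Compat ω hq i X (Y + Y') := by
  refine .of_eq ?_ (Submodule.add_mem _ h.1 h'.1) ?_
  · rw [map_add]
  · rw [map_add, map_add, map_add, h.2, h'.2]

theorem Compat.smul_left {hq : IsHurwitz q} {i : ZMod 2} {X Y : MagicSpace k (k × V) C} (c : k)
    (h : Compat ω hq i X Y) : Compat ω hq i (c • X) Y := by
  refine .of_eq ?_ (Submodule.smul_mem _ c h.1) ?_
  · rw [map_smul, LinearMap.smul_apply]
  · rw [map_smul, map_smul, map_smul, LinearMap.smul_apply, h.2]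

theorem Compat.smul_right {hq : IsHurwitz q} {i : ZMod 2} {X Y : MagicSpace k (k × V) C} (c : k)
    (h : Compat ω hq i X Y) : Compat ω hq i X (c • Y) := by
  refine .of_eq ?_ (Submodule.smul_mem _ c h.1) ?_
  · rw [map_smul]
  · rw [map_smul, map_smul, map_smul, h.2]

/-- `Ψ` preserves the products of homogeneous elements. -/
theorem compat_of_mem (hV : Module.finrank k V = 2) (hω : ω.IsAlt) (hω0 : ω ≠ 0)
    (hq : IsHurwitz q) {i j : ZMod 2} {X Y : MagicSpace k (k × V) C}
    (hX : X ∈ part (superS ω) (paraC q) i) (hY : Y ∈ part (superS ω) (paraC q) j) :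
    Compat ω hq (i + j) X Y := by
  rw [part_eq_span hV hω hω0] at hX hY
  induction hY using Submodule.span_induction with
  | zero => exact .zero_right hq _ X
  | add Y Y' _ _ h h' => exact h.add_right h'
  | smul c Y _ h => exact h.smul_right c
  | mem Y hY =>
    induction hX using Submodule.span_induction with
    | zero => exact .zero_left hq _ Y
    | add X X' _ _ h h' => exact h.add_left h'
    | smul c X _ h => exact h.smul_left c
    | mem X hX => exact compat_gen hV hω hω0 hq hX hY

end Magic

end CompatAll


/-! ## Bijectivity of `Ψ` -/

section Coordinates

variable {k C : Type*} [Field k] [CharP k 3] [NonAssocRing C] [Module k C] [IsScalarTower k C C]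
  [SMulCommClass k C C] {q : QuadraticForm k C}

/-- The coordinate of `T_J` dual to `ι̂(1)`. -/
def tdiag (hq : IsHurwitz q) : TJ hq →ₗ[k] k :=
  (jscalar hq).liftQ ((jdiag q 1 - jdiag q 0).comp (jzero q).subtype) (by
    intro x hx
    obtain ⟨c, hc⟩ := Submodule.mem_span_singleton.1 hx
    rw [LinearMap.mem_ker, LinearMap.comp_apply, ← hc]
    simp [jdiag_jone])

/-- The coordinate of `T_J` in `ι̂_n(S)`. -/
def tcoord (hq : IsHurwitz q) (n : Fin 3) : TJ hq →ₗ[k] C :=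
  (jscalar hq).liftQ ((jcoord q n).comp (jzero q).subtype) (by
    intro x hx
    obtain ⟨c, hc⟩ := Submodule.mem_span_singleton.1 hx
    rw [LinearMap.mem_ker, LinearMap.comp_apply, ← hc]
    simp [jcoord_jone])

theorem tdiag_tone (hq : IsHurwitz q) : tdiag hq (tone hq) = 1 := by
  change jdiag q 1 (je hq 0 - je hq 1) - jdiag q 0 (je hq 0 - je hq 1) = 1
  have h3 : (3 : k) = 0 := three_eq_zero_of_charP_three k
  simp [jdiag_je]
  linear_combination -h3

theorem tdiag_tiota (hq : IsHurwitz q) (n : Fin 3) (a : C) : tdiag hq (tiota hq n a) = 0 := by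
  change jdiag q 1 (jiota hq n a) - jdiag q 0 (jiota hq n a) = 0
  simp [jdiag_jiota]

theorem tcoord_tone (hq : IsHurwitz q) (n : Fin 3) : tcoord hq n (tone hq) = 0 := by
  change jcoord q n (je hq 0 - je hq 1) = 0
  simp [jcoord_je]

theorem tcoord_tiota (hq : IsHurwitz q) (n m : Fin 3) (a : C) :
    tcoord hq n (tiota hq m a) = if m = n then a else 0 :=
  jcoord_jiota hq n m a

theorem tj_eq_sum (hq : IsHurwitz q) (x : TJ hq) :
    x = tdiag hq x • tone hq + ∑ n, tiota hq n (tcoord hq n x) := by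
  induction x using TJ_induction hq with | h x hx => ?_
  have hd : tdiag hq ((jscalar hq).mkQ ⟨x, hx⟩) = jdiag q 1 x - jdiag q 0 x := rfl
  have hc : ∀ n, tcoord hq n ((jscalar hq).mkQ ⟨x, hx⟩) = jcoord q n x := fun n => rfl
  simp only [hd, hc, tone_eq, tiota_eq, ← map_smul, ← map_sum, ← map_add]
  have hy : (jdiag q 1 x - jdiag q 0 x) • (je hq 0 - je hq 1)
      + ∑ n, jiota hq n (jcoord q n x) ∈ jzero q :=
    Submodule.add_mem _ (Submodule.smul_mem _ _ (je_sub_mem_jzero hq))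
      (Submodule.sum_mem _ fun n _ => jiota_mem_jzero hq n _)
  have := mkQ_eq hq hx hy ?_ fun n => ?_
  · exact this.trans (congrArg _ (Subtype.ext (by simp)))
  · have h3 : (3 : k) = 0 := three_eq_zero_of_charP_three k
    simp [jdiag_je, jdiag_jiota]
    linear_combination (jdiag q 1 x - jdiag q 0 x) * h3
  · simp [jcoord_je, jcoord_jiota]

/-- Derivations of `J` are determined by their action on `T_J`. -/
theorem eq_zero_of_stabAct (hq : IsHurwitz q) {d : Fin 3 → Module.End k C} {a : Fin 3 → C}
    (h : stabAct hq (DtriLin hq d + ∑ n, DiLin hq n (a n)) = 0) : d = 0 ∧ a = 0 := by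
  have ha : a = 0 := by
    funext m
    -- Evaluation on the class of e_0-e_1 isolates a, because triality derivations kill it while
    -- D_m(a) sends it to the class of ι_m(a). With a = 0, evaluation on the classes of ι_n(s) then
    -- isolates d.
    have h1 := congrArg (tcoord hq m) (LinearMap.congr_fun h (tone hq))
    simp only [map_add, map_sum, LinearMap.add_apply, LinearMap.sum_apply, DtriLin_apply,
      DiLin_apply, stabAct_Dtri_tone, stabAct_tone, map_zero, LinearMap.zero_apply, tcoord_tiota,
      zero_add] at h1
    simpa using h1
  refine ⟨funext fun n => LinearMap.ext fun s => ?_, ha⟩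
  have h1 := congrArg (tcoord hq n) (LinearMap.congr_fun h (tiota hq n s))
  simpa [ha, DtriLin_apply, stabAct_Dtri_tiota, tcoord_tiota] using h1

theorem stabAct_injective_of_der (hq : IsHurwitz q) {d : Module.End k (Herm q)}
    (hd : d ∈ GJ.der hq) (h : stabAct hq ⟨d, der_le_stab hq hd⟩ = 0) : d = 0 := by
  obtain ⟨d', -, a, e⟩ := der_decomposition hq hd
  have e' : (⟨d, der_le_stab hq hd⟩ : stab hq) = DtriLin hq d' + ∑ n, DiLin hq n (a n) := by
    refine Subtype.ext (e.trans ?_)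
    simp [DtriLin_apply, DiLin_apply]
  rw [e'] at h
  obtain ⟨h1, h2⟩ := eq_zero_of_stabAct hq h
  have h3 := congrArg Subtype.val e'
  rw [h1, h2] at h3
  simpa using h3

end Coordinates

section Bijective

variable {k V C : Type*} [Field k] [CharP k 3] [AddCommGroup V] [Module k V] [NonAssocRing C]
  [Module k C] [IsScalarTower k C C] [SMulCommClass k C C]
  {ω : LinearMap.BilinForm k V} {q : QuadraticForm k C}

theorem tensorPr_superS_zero (ω : LinearMap.BilinForm k V) (q : QuadraticForm k C)
    (ξ : (k × V) ⊗[k] C) : (superS ω).tensorPr (paraC q).toSuperspace 0 ξ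
      = (1, 0) ⊗ₜ TensorProduct.lid k C ((LinearMap.fst k k V).rTensor C ξ) := by
  induction ξ with
  | zero => simp
  | add x y hx hy => rw [map_add, hx, hy, map_add, map_add, TensorProduct.tmul_add]
  | tmul x a =>
    rw [Magic.tensorPr_paraC, superS_pr_zero, LinearMap.rTensor_tmul, TensorProduct.lid_tmul,
      TensorProduct.tmul_smul, TensorProduct.smul_tmul']
    simp

theorem tensorPr_superS_one (ω : LinearMap.BilinForm k V) (q : QuadraticForm k C)
    (ξ : (k × V) ⊗[k] C) : (superS ω).tensorPr (paraC q).toSuperspace 1 ξ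
      = (LinearMap.inr k k V).rTensor C ((LinearMap.snd k k V).rTensor C ξ) := by
  induction ξ with
  | zero => simp
  | add x y hx hy => rw [map_add, hx, hy, map_add, map_add]
  | tmul x a => rw [Magic.tensorPr_paraC, superS_pr_one]; simp

theorem eq_tensorPr_of_mem {i : ZMod 2} {X : MagicSpace k (k × V) C}
    (hX : X ∈ Magic.part (superS ω) (paraC q) i) (n : Fin 3) :
    (superS ω).tensorPr (paraC q).toSuperspace i (X.2.2 n) = X.2.2 n := by
  have h : X.2.2 n ∈ LinearMap.range ((superS ω).tensorPr (paraC q).toSuperspace i) :=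
    hX.2.2 n trivial
  obtain ⟨ξ, hξ⟩ := h
  rw [← hξ, Superspace.tensorPr_tensorPr, if_pos rfl]

/-- The sp(V) component is read off directly; the der J component is handled by the faithful action
on T, which separates the triality triple from the three D_n(a_n). -/
theorem psiLin_injective_zero (hq : IsHurwitz q) {X : MagicSpace k (k × V) C}
    (hX : X ∈ Magic.part (superS ω) (paraC q) 0) (h : psiLin V hq X = 0) : X = 0 := by
  obtain ⟨f, -, hf⟩ := mem_superS_tri_zero hX.1
  have h1 : (LinearMap.snd k k V).comp ((X.1 0).comp (LinearMap.inr k k V)) = 0 :=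
    congrArg Prod.fst h
  have h2 : DtriLin hq X.2.1 + ∑ n, DiLin hq n
      (TensorProduct.lid k C ((LinearMap.fst k k V).rTensor C (X.2.2 n))) = 0 :=
    congrArg (fun Y => Y.2.1) h
  obtain ⟨e1, e2⟩ := eq_zero_of_stabAct hq (by rw [h2, map_zero])
  refine Prod.ext ?_ (Prod.ext e1 (funext fun n => ?_))
  · have hf0 : f = 0 := by
      rw [hf] at h1
      exact LinearMap.ext fun v => by simpa using LinearMap.congr_fun h1 v
    rw [hf, hf0]
    funext n
    refine LinearMap.ext fun x => ?_
    simp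
  · rw [← eq_tensorPr_of_mem hX, tensorPr_superS_zero, congrFun e2 n]
    simp

/-- Tensoring with V the coordinate functions of T recovers u from the class of e_0-e_1 and each V ⊗
S component from the classes of ι_n(S). -/
theorem psiLin_injective_one (hV : Module.finrank k V = 2) (hω : ω.IsAlt) (hω0 : ω ≠ 0)
    (hq : IsHurwitz q) {X : MagicSpace k (k × V) C}
    (hX : X ∈ Magic.part (superS ω) (paraC q) 1) (h : psiLin V hq X = 0) : X = 0 := by
  obtain ⟨u, hu⟩ := mem_superS_tri_one hV hω hω0 hX.1
  have h2 : X.2.1 = 0 := by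
    have := hX.2.1
    rwa [paraC_tri_one] at this
  have h3 : -(X.1 0 (1, 0)).2 ⊗ₜ tone hq
      + ∑ n, TensorProduct.map (LinearMap.snd k k V) (tiotaLin hq n) (X.2.2 n) = 0 :=
    congrArg (fun Y => Y.2.2) h
  have h4 : ∀ n ξ, TensorProduct.map (LinearMap.snd k k V) (tiotaLin hq n) ξ
      = (tiotaLin hq n).lTensor V ((LinearMap.snd k k V).rTensor C ξ) := fun n ξ => by
    rw [← LinearMap.comp_apply, LinearMap.lTensor_comp_rTensor]
  simp only [hu, h4] at h3
  have h5 : ∀ m n (ξ : V ⊗[k] C), (tcoord hq m).lTensor V ((tiotaLin hq n).lTensor V ξ)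
      = if n = m then ξ else 0 := by
    intro m n ξ
    rw [← LinearMap.comp_apply, ← LinearMap.lTensor_comp]
    have e : (tcoord hq m).comp (tiotaLin hq n) = if n = m then LinearMap.id else 0 := by
      refine LinearMap.ext fun a => ?_
      rw [LinearMap.comp_apply, tiotaLin_apply, tcoord_tiota]
      split_ifs <;> rfl
    rw [e]
    split_ifs <;> simp
  have h6 : ∀ n (ξ : V ⊗[k] C), (tdiag hq).lTensor V ((tiotaLin hq n).lTensor V ξ) = 0 := by
    intro n ξ
    rw [← LinearMap.comp_apply, ← LinearMap.lTensor_comp]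
    have e : (tdiag hq).comp (tiotaLin hq n) = 0 := LinearMap.ext fun a => tdiag_tiota hq n a
    rw [e]
    simp
  have hu0 : u = 0 := by
    have := congrArg (fun ξ => TensorProduct.rid k V ((tdiag hq).lTensor V ξ)) h3
    simpa [oddS_apply, two_eq_neg_one_of_charP_three, h6, tdiag_tone] using this
  have hξ : ∀ n, (LinearMap.snd k k V).rTensor C (X.2.2 n) = 0 := by
    intro m
    have := congrArg ((tcoord hq m).lTensor V) h3
    simpa [h5, tcoord_tone] using this
  refine Prod.ext ?_ (Prod.ext h2 (funext fun n => ?_))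
  · rw [hu, hu0]
    funext n
    refine LinearMap.ext fun x => ?_
    simp [oddS_apply]
  · rw [← eq_tensorPr_of_mem hX, tensorPr_superS_one, hξ]
    simp

theorem disjoint_GJ_part (ω : LinearMap.BilinForm k V) (hq : IsHurwitz q) :
    Disjoint (GJ.part ω hq 0) (GJ.part ω hq 1) := by
  rw [Submodule.disjoint_def]
  intro X h0 h1
  obtain ⟨f, -, d, -, rfl⟩ := (mem_GJ_part_zero ω hq X).1 h0
  obtain ⟨ξ, h⟩ := (mem_GJ_part_one ω hq _).1 h1
  have e1 : f = 0 := congrArg Prod.fst h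
  have e2 : d = 0 := congrArg (fun Y => Y.2.1) h
  rw [e1, e2]
  rfl

theorem psiLin_eq_zero (hV : Module.finrank k V = 2) (hω : ω.IsAlt) (hω0 : ω ≠ 0)
    (hq : IsHurwitz q) {X : MagicSpace k (k × V) C}
    (hX : X ∈ Magic.part (superS ω) (paraC q) 0 ⊔ Magic.part (superS ω) (paraC q) 1)
    (h : psiLin V hq X = 0) : X = 0 := by
  obtain ⟨Y, hY, Z, hZ, rfl⟩ := Submodule.mem_sup.1 hX
  rw [map_add] at h
  have hY' := psiLin_mem_part hV hω hω0 hq hY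
  have hZ' := psiLin_mem_part hV hω hω0 hq hZ
  have e : psiLin V hq Y = -psiLin V hq Z := eq_neg_of_add_eq_zero_left h
  have hY0 : psiLin V hq Y = 0 := (Submodule.disjoint_def.1 (disjoint_GJ_part ω hq)) _ hY'
    (by rw [e]; exact Submodule.neg_mem _ hZ')
  have hZ0 : psiLin V hq Z = 0 := by rwa [hY0, zero_add] at h
  rw [psiLin_injective_zero hq hY hY0, psiLin_injective_one hV hω hω0 hq hZ hZ0, add_zero]

/-- In even degree this is the decomposition of der J; in odd degree it is the decomposition of T
into the classes of e_0-e_1 and of the ι_n(S). -/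
theorem GJ_part_le_map_psiLin (hV : Module.finrank k V = 2) (hω : ω.IsAlt) (hq : IsHurwitz q)
    (i : ZMod 2) :
    GJ.part ω hq i ≤ (Magic.part (superS ω) (paraC q) i).map (psiLin V hq) := by
  have hg : ∀ {X : MagicSpace k (k × V) C}, Magic.IsGen ω q i X →
      psiLin V hq X ∈ (Magic.part (superS ω) (paraC q) i).map (psiLin V hq) :=
    fun hX => Submodule.mem_map_of_mem (Magic.IsGen.mem hV hω hX)
  intro Y hY
  rcases zmod_two_cases i with rfl | rfl
  · obtain ⟨f, hf, d, hd, rfl⟩ := (mem_GJ_part_zero ω hq Y).1 hY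
    obtain ⟨d', hd', a, e⟩ := der_decomposition hq ((mem_stabDer hq d).1 hd)
    have e' : d = ⟨Dtri hq d', Dtri_mem_stab hq d'⟩ + ∑ n, Di hq n (a n) := by
      refine Subtype.ext ?_
      rw [e]
      simp
    have hinr : ∀ n, ((0, Di hq n (a n), 0) : GJ.Space V hq)
        = LinearMap.inr k _ _ (LinearMap.inl k _ _ (Di hq n (a n))) := fun n => rfl
    have e2 : ((f, d, 0) : GJ.Space V hq) = (f, 0, 0)
        + (0, ⟨Dtri hq d', Dtri_mem_stab hq d'⟩, 0) + ∑ n, (0, Di hq n (a n), 0) := by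
      simp only [hinr, ← map_sum]
      rw [e']
      refine Prod.ext ?_ (Prod.ext ?_ ?_) <;> simp [Prod.fst_sum, Prod.snd_sum]
    rw [e2]
    refine Submodule.add_mem _ (Submodule.add_mem _ ?_ ?_) (Submodule.sum_mem _ fun n _ => ?_)
    · rw [← psiLin_sp]; exact hg (.sp f hf)
    · rw [← psiLin_tri]; exact hg (.tri d' hd')
    · rw [← psiLin_iota_one]; exact hg (.iotaOne n (a n))
  · obtain ⟨ξ, rfl⟩ := (mem_GJ_part_one ω hq Y).1 hY
    let inj : V ⊗[k] TJ hq →ₗ[k] GJ.Space V hq := (LinearMap.inr k _ _).comp (LinearMap.inr k _ _)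
    have hinj : ∀ η, ((0, 0, η) : GJ.Space V hq) = inj η := fun _ => rfl
    rw [hinj]
    clear hY
    induction ξ with
    | zero => rw [map_zero]; exact Submodule.zero_mem _
    | add x y hx hy => rw [map_add]; exact Submodule.add_mem _ hx hy
    | tmul u x =>
      rw [tj_eq_sum hq x, TensorProduct.tmul_add, TensorProduct.tmul_smul, TensorProduct.tmul_sum,
        map_add, map_smul, map_sum]
      refine Submodule.add_mem _ (Submodule.smul_mem _ _ ?_) (Submodule.sum_mem _ fun n _ => ?_)
      · rw [← hinj, ← psiLin_odd ω]; exact hg (.odd u)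
      · rw [← hinj, ← psiLin_iota_odd]; exact hg (.iotaOdd n u _)

end Bijective


/-! ## Transport of the structure of Lie superalgebra -/

section Transport

variable {k A B : Type*} [Field k] [AddCommGroup A] [Module k A] [AddCommGroup B] [Module k B]
  {br : A →ₗ[k] A →ₗ[k] A} {G : ZMod 2 → Submodule k A} {br' : B →ₗ[k] B →ₗ[k] B}
  {G' : ZMod 2 → Submodule k B}

/-- `φ` maps `G 0 ⊕ G 1` injectively onto `G' 0 ⊕ G' 1`, and preserves parity and products. -/
structure IsSuperEmbedding (br : A →ₗ[k] A →ₗ[k] A) (G : ZMod 2 → Submodule k A)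
    (br' : B →ₗ[k] B →ₗ[k] B) (G' : ZMod 2 → Submodule k B) (φ : A →ₗ[k] B) : Prop where
  eq_zero : ∀ x ∈ G 0 ⊔ G 1, φ x = 0 → x = 0
  mem : ∀ i, ∀ x ∈ G i, φ x ∈ G' i
  surj : ∀ i, G' i ≤ (G i).map φ
  br_mem : ∀ i j x y, x ∈ G i → y ∈ G j → br x y ∈ G (i + j)
  map_br : ∀ i j x y, x ∈ G i → y ∈ G j → φ (br x y) = br' (φ x) (φ y)

theorem part_le_sup (G : ZMod 2 → Submodule k A) (i : ZMod 2) : G i ≤ G 0 ⊔ G 1 := by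
  rcases zmod_two_cases i with rfl | rfl
  · exact le_sup_left
  · exact le_sup_right

namespace IsSuperEmbedding

variable {φ : A →ₗ[k] B}

theorem eq_of_map_eq (h : IsSuperEmbedding br G br' G' φ) {x y : A} (hx : x ∈ G 0 ⊔ G 1)
    (hy : y ∈ G 0 ⊔ G 1) (e : φ x = φ y) : x = y :=
  sub_eq_zero.1 (h.eq_zero _ (Submodule.sub_mem _ hx hy) (by rw [map_sub, e, sub_self]))

theorem map_mem_sup (h : IsSuperEmbedding br G br' G' φ) {x : A} (hx : x ∈ G 0 ⊔ G 1) :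
    φ x ∈ G' 0 ⊔ G' 1 := by
  obtain ⟨y, hy, z, hz, rfl⟩ := Submodule.mem_sup.1 hx
  rw [map_add]
  exact Submodule.add_mem _ (part_le_sup G' 0 (h.mem 0 y hy)) (part_le_sup G' 1 (h.mem 1 z hz))

theorem br_sup (h : IsSuperEmbedding br G br' G' φ) {x z : A} (hx : x ∈ G 0 ⊔ G 1)
    (hz : z ∈ G 0 ⊔ G 1) : br x z ∈ G 0 ⊔ G 1 ∧ φ (br x z) = br' (φ x) (φ z) := by
  obtain ⟨x0, hx0, x1, hx1, rfl⟩ := Submodule.mem_sup.1 hx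
  obtain ⟨z0, hz0, z1, hz1, rfl⟩ := Submodule.mem_sup.1 hz
  have m := fun i j x y hx hy => part_le_sup G _ (h.br_mem i j x y hx hy)
  simp only [map_add, LinearMap.add_apply]
  refine ⟨Submodule.add_mem _ (Submodule.add_mem _ (m 0 0 _ _ hx0 hz0) (m 1 0 _ _ hx1 hz0))
    (Submodule.add_mem _ (m 0 1 _ _ hx0 hz1) (m 1 1 _ _ hx1 hz1)), ?_⟩
  rw [h.map_br 0 0 _ _ hx0 hz0, h.map_br 0 1 _ _ hx0 hz1, h.map_br 1 0 _ _ hx1 hz0,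
    h.map_br 1 1 _ _ hx1 hz1]

/-- Every axiom is an equality, or a trivial intersection, that can be tested after applying an
injective map compatible with products. -/
theorem isLieSuperalgebra (h : IsSuperEmbedding br G br' G' φ)
    (h' : IsLieSuperalgebra br' G') : IsLieSuperalgebra br G where
  disjoint := by
    rw [Submodule.disjoint_def]
    intro x h0 h1
    exact h.eq_zero x (part_le_sup G 0 h0)
      (Submodule.disjoint_def.1 h'.disjoint _ (h.mem 0 x h0) (h.mem 1 x h1))
  closed := h.br_mem
  skew i j x y hx hy := by
    have hxs := part_le_sup G i hx
    have hys := part_le_sup G j hy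
    refine h.eq_of_map_eq (h.br_sup hxs hys).1
      (Submodule.neg_mem _ (Submodule.smul_mem _ _ (h.br_sup hys hxs).1)) ?_
    rw [map_neg, map_smul, (h.br_sup hxs hys).2, (h.br_sup hys hxs).2]
    exact h'.skew i j _ _ (h.mem i x hx) (h.mem j y hy)
  jacobi i j x y z hx hy hz := by
    have hxs := part_le_sup G i hx
    have hys := part_le_sup G j hy
    have hyz := h.br_sup hys hz
    have hxz := h.br_sup hxs hz
    have hxy := h.br_sup hxs hys
    refine h.eq_of_map_eq (h.br_sup hxs hyz.1).1 (Submodule.add_mem _ (h.br_sup hxy.1 hz).1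
      (Submodule.smul_mem _ _ (h.br_sup hys hxz.1).1)) ?_
    rw [map_add, map_smul, (h.br_sup hxs hyz.1).2, (h.br_sup hxy.1 hz).2, (h.br_sup hys hxz.1).2,
      hyz.2, hxz.2, hxy.2]
    exact h'.jacobi i j _ _ _ (h.mem i x hx) (h.mem j y hy) (h.map_mem_sup hz)
  cube x hx := by
    have hxs := part_le_sup G 1 hx
    have hxx := h.br_sup hxs hxs
    refine h.eq_zero _ (h.br_sup hxs hxx.1).1 ?_
    rw [(h.br_sup hxs hxx.1).2, hxx.2]
    exact h'.cube _ (h.mem 1 x hx)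

theorem isLieSuperIso (h : IsSuperEmbedding br G br' G' φ)
    {Ψ : ↥(G 0 ⊔ G 1) →ₗ[k] ↥(G' 0 ⊔ G' 1)} (hΨ : ∀ x, (Ψ x : B) = φ x) :
    IsLieSuperIso br G br' G' Ψ where
  bijective := by
    refine ⟨fun x y e => Subtype.ext (h.eq_of_map_eq x.2 y.2 ?_), fun y => ?_⟩
    · rw [← hΨ, ← hΨ, e]
    · have hs : G' 0 ⊔ G' 1 ≤ (G 0 ⊔ G 1).map φ := by
        rw [Submodule.map_sup]
        exact sup_le_sup (h.surj 0) (h.surj 1)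
      obtain ⟨x, hx, e⟩ := hs y.2
      exact ⟨⟨x, hx⟩, Subtype.ext ((hΨ _).trans e)⟩
  parity i x hx := by
    rw [hΨ]
    exact h.mem i _ hx
  map_br x y z e := by
    rw [hΨ, hΨ, hΨ, e]
    exact (h.br_sup x.2 y.2).2

end IsSuperEmbedding

end Transport

/-! ### Existence and uniqueness of Ψ, and the theorem -/

section Main

variable {k V C : Type*} [Field k] [CharP k 3] [AddCommGroup V] [Module k V] [NonAssocRing C]
  [Module k C] [IsScalarTower k C C] [SMulCommClass k C C]
  {ω : LinearMap.BilinForm k V} {q : QuadraticForm k C}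

theorem isSuperEmbedding_psiLin (hV : Module.finrank k V = 2) (hω : ω.IsAlt) (hω0 : ω ≠ 0)
    (hq : IsHurwitz q) :
    IsSuperEmbedding (Magic.bracket (superS ω) (paraC q)) (Magic.part (superS ω) (paraC q))
      (GJ.bracket ω hq) (GJ.part ω hq) (psiLin V hq) where
  eq_zero _ hX h := psiLin_eq_zero hV hω hω0 hq hX h
  mem _ _ hX := psiLin_mem_part hV hω hω0 hq hX
  surj i := GJ_part_le_map_psiLin hV hω hq i
  br_mem _ _ _ _ hX hY := (Magic.compat_of_mem hV hω hω0 hq hX hY).1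
  map_br _ _ _ _ hX hY := (Magic.compat_of_mem hV hω hω0 hq hX hY).2

/-- Every generator lies in the domain of `Ψ`. -/
theorem Magic.IsGen.mem_sup (hV : Module.finrank k V = 2) (hω : ω.IsAlt) {i : ZMod 2}
    {X : MagicSpace k (k × V) C} (hX : IsGen ω q i X) :
    X ∈ part (superS ω) (paraC q) 0 ⊔ part (superS ω) (paraC q) 1 :=
  part_le_sup _ i (hX.mem hV hω)

theorem isPsi_of_eq_psiLin (hV : Module.finrank k V = 2) (hω : ω.IsAlt) (hq : IsHurwitz q)
    {Ψ : ↥(Magic.part (superS ω) (paraC q) 0 ⊔ Magic.part (superS ω) (paraC q) 1) →ₗ[k]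
      ↥(GJ.part ω hq 0 ⊔ GJ.part ω hq 1)} (hΨ : ∀ X, (Ψ X : GJ.Space V hq) = psiLin V hq X) :
    IsPsi ω hq Ψ where
  sp f hf := ⟨Magic.IsGen.mem_sup hV hω (.sp f hf), (hΨ _).trans (psiLin_sp hq f)⟩
  tri d hd := ⟨Magic.IsGen.mem_sup hV hω (.tri d hd), (hΨ _).trans (psiLin_tri hq d)⟩
  iota_one n a := ⟨Magic.IsGen.mem_sup hV hω (.iotaOne n a), (hΨ _).trans (psiLin_iota_one hq n a)⟩
  odd u := ⟨Magic.IsGen.mem_sup hV hω (.odd u), (hΨ _).trans (psiLin_odd ω hq u)⟩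
  iota_odd n u s :=
    ⟨Magic.IsGen.mem_sup hV hω (.iotaOdd n u s), (hΨ _).trans (psiLin_iota_odd hq n u s)⟩

theorem IsPsi.eq_psiLin_of_isGen {hq : IsHurwitz q}
    {Ψ : ↥(Magic.part (superS ω) (paraC q) 0 ⊔ Magic.part (superS ω) (paraC q) 1) →ₗ[k]
      ↥(GJ.part ω hq 0 ⊔ GJ.part ω hq 1)} (hΨ : IsPsi ω hq Ψ) {i : ZMod 2}
    {X : MagicSpace k (k × V) C} (hX : Magic.IsGen ω q i X) :
    ∃ h, (Ψ ⟨X, h⟩ : GJ.Space V hq) = psiLin V hq X := by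
  cases hX with
  | sp f hf => obtain ⟨h, e⟩ := hΨ.sp f hf; exact ⟨h, e.trans (psiLin_sp hq f).symm⟩
  | tri d hd => obtain ⟨h, e⟩ := hΨ.tri d hd; exact ⟨h, e.trans (psiLin_tri hq d).symm⟩
  | iotaOne n a =>
    obtain ⟨h, e⟩ := hΨ.iota_one n a; exact ⟨h, e.trans (psiLin_iota_one hq n a).symm⟩
  | odd u => obtain ⟨h, e⟩ := hΨ.odd u; exact ⟨h, e.trans (psiLin_odd ω hq u).symm⟩
  | iotaOdd n u s =>
    obtain ⟨h, e⟩ := hΨ.iota_odd n u s; exact ⟨h, e.trans (psiLin_iota_odd hq n u s).symm⟩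

theorem IsPsi.eq_psiLin (hV : Module.finrank k V = 2) (hω : ω.IsAlt) (hω0 : ω ≠ 0)
    {hq : IsHurwitz q}
    {Ψ : ↥(Magic.part (superS ω) (paraC q) 0 ⊔ Magic.part (superS ω) (paraC q) 1) →ₗ[k]
      ↥(GJ.part ω hq 0 ⊔ GJ.part ω hq 1)} (hΨ : IsPsi ω hq Ψ)
    (X : ↥(Magic.part (superS ω) (paraC q) 0 ⊔ Magic.part (superS ω) (paraC q) 1)) :
    (Ψ X : GJ.Space V hq) = psiLin V hq X := by
  -- The subspace where Ψ and `psiLin` agree, viewed in the ambient space so that it can be compared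
  -- with the span of the generators.
  let E : Submodule k (MagicSpace k (k × V) C) :=
    (LinearMap.eqLocus ((Submodule.subtype _).comp Ψ)
      ((psiLin V hq).comp (Submodule.subtype _))).map (Submodule.subtype _)
  have hle : ∀ i, Magic.part (superS ω) (paraC q) i ≤ E := by
    intro i
    rw [Magic.part_eq_span hV hω hω0, Submodule.span_le]
    intro Y hY
    obtain ⟨h, e⟩ := hΨ.eq_psiLin_of_isGen hY
    exact ⟨⟨Y, h⟩, e, rfl⟩
  obtain ⟨Y, hY, e⟩ := sup_le (hle 0) (hle 1) X.2
  rw [← Subtype.ext e]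
  exact hY

end Main

theorem mainTheorem1 {k V C : Type*} [Field k] [CharP k 3]
    [AddCommGroup V] [Module k V] (hV : Module.finrank k V = 2)
    (ω : LinearMap.BilinForm k V) (hω : ω.IsAlt) (hω0 : ω ≠ 0)
    [NonAssocRing C] [Module k C] [IsScalarTower k C C] [SMulCommClass k C C]
    (q : QuadraticForm k C) (hq : IsHurwitz q) :
    IsLieSuperalgebra (Magic.bracket (superS ω) (paraC q)) (Magic.part (superS ω) (paraC q)) ∧
    IsOrthogonalTripleSystem (tform hq) (ttriple hq) ∧
    (∀ d ∈ GJ.der hq, ∃ h : d ∈ stab hq, stabAct hq ⟨d, h⟩ = 0 → d = 0) ∧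
    IsLieSuperalgebra (GJ.bracket ω hq) (GJ.part ω hq) ∧
    (∃! Ψ, IsPsi ω hq Ψ) ∧
    ∀ Ψ, IsPsi ω hq Ψ →
      IsLieSuperIso (Magic.bracket (superS ω) (paraC q)) (Magic.part (superS ω) (paraC q))
        (GJ.bracket ω hq) (GJ.part ω hq) Ψ := by
  have hE := isSuperEmbedding_psiLin hV hω hω0 hq
  refine ⟨hE.isLieSuperalgebra (isLieSuperalgebra_GJ hV hω hq), isOrthogonalTripleSystem_TJ hq,
    fun d hd => ⟨der_le_stab hq hd, stabAct_injective_of_der hq hd⟩,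
    isLieSuperalgebra_GJ hV hω hq,
    ⟨(psiLin V hq).restrict fun X hX => hE.map_mem_sup hX,
      isPsi_of_eq_psiLin hV hω hq fun _ => rfl, fun Ψ hΨ => ?_⟩,
    fun Ψ hΨ => hE.isLieSuperIso (hΨ.eq_psiLin hV hω hω0)⟩
  exact LinearMap.ext fun X => Subtype.ext (hΨ.eq_psiLin hV hω hω0 X)
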